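/- For a sequence $g=(\hat g_m)_{m\in\mathbb Z}$ of Fourier coefficients of a 1-periodic distribution and $s\in\mathbb R$ put $\|g\|_{H^s}^2=|\hat g_0|^2+\sum_{m\ne0}|m|^{2s}|\hat g_m|^2$, and let $H^s$ be the space of 1-periodic distributions $g$ with $\|g\|_{H^s}<\infty$. Let $d\ge 0$ be an integer and $\alpha\in\mathbb R$ with $d>2\alpha$. Let $V$ be a linear operator on 1-periodic distributions which, for every $s\in\mathbb R$, restricts to a continuous isomorphism $V:H^{s+\alpha}\to H^{s-\alpha}$. For $N\ge1$ let $\Delta_N=\{0=x_1<\dots<x_N<1\}$ be a periodic mesh ($x_{N+1}=1$, identified with $x_1$) that is $\rho$-quasi-uniform, that is, $\max_j(x_{j+1}-x_j)\le\rho\min_j(x_{j+1}-x_j)$, with $\rho$ independent of $N$. Let $S_N$ be the space of 1-periodic complex splines of degree $d$ on $\Delta_N$ (functions of class $C^{d-1}$, with no continuity required if $d=0$, that are polynomials of degree at most $d$ on each interval $[x_j,x_{j+1})$). Let $M=M(N)\ge N^\beta$ for some fixed $$\beta>2+\frac1{2d+1-4\alpha},$$ and take the $M$ equispaced collocation points $y_m=\tilde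 x+m/M$ (mod 1), $m=1,\dots,M$, with an arbitrary real offset $\tilde x=\tilde x(N)$. For $u\in H^{d+1}$ and $f=Vu$, the oversampled collocation approximation $u_N^{(M)}=\sum_n a_n\phi_n\in S_N$, where $(\phi_n)$ is a basis of $S_N$, is defined by the weighted normal equations $$(G^\dagger W G)\,a=G^\dagger W\,(f(y_m))_{m},\qquad G=\big((V\phi_n)(y_m)\big)_{m,n},\qquad W=\mathrm{diag}\Big(\tfrac12(y_{m+1}-y_{m-1})\Big)=\tfrac1M I .$$ Then there are $N_0$ and $C$, depending only on $V,\alpha,d,\rho,\beta$ (and so not on $N\ge N_0$, on the meshes, on $M$, $\tilde x$ or $u$), such that for all $N\ge N_0$ and all $u\in H^{d+1}$ the approximation $u_N^{(M)}$ exists, is unique, and satisfies $$\|u_N^{(M)}-u\|_{H^{-d-1+4\alpha}}\le C\,N^{4\alpha-2d-2}\,\|u\|_{H^{d+1}} .$$ Moreover, for any given sequences $\Delta_N$, $M(N)$, $\tilde x(N)$ ($N\ge1$) as above there is a constant $C$, independent of $N$ and $u$, with which the estimate holds for every $N\ge1$ for which $u_N^{(M)}$ is uniquely determined. That is, slightly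 more than quadratic oversampling doubles the convergence rate. -/

import Mathlib

open scoped Polynomial

namespace OversampledCollocation

noncomputable section

/-- The bracket `[m]`: it is `1` for `m = 0` and `|m|` for every other integer `m`. -/
def bracket (m : ℤ) : ℝ := max 1 |(m : ℝ)|

theorem one_le_bracket (m : ℤ) : 1 ≤ bracket m := le_max_left _ _

theorem bracket_pos (m : ℤ) : 0 < bracket m := lt_of_lt_of_le one_pos (one_le_bracket m)

/-- The space of 1-periodic distributions. A 1-periodic distribution is represented by its
sequence of Fourier coefficients; exactly the sequences of at most polynomial growth occur. -/
def PeriodicDistribution : Submodule ℂ (ℤ → ℂ) where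
  carrier := {c | ∃ (k : ℕ) (C : ℝ), ∀ m, ‖c m‖ ≤ C * bracket m ^ k}
  zero_mem' := ⟨0, 0, fun m => by simp⟩
  add_mem' := by
    rintro a b ⟨k, C, h⟩ ⟨l, D, h'⟩
    refine ⟨k + l, |C| + |D|, fun m => ?_⟩
    have h1 := one_le_bracket m
    have hk : bracket m ^ k ≤ bracket m ^ (k + l) :=
      pow_le_pow_right₀ h1 (Nat.le_add_right k l)
    have hl : bracket m ^ l ≤ bracket m ^ (k + l) :=
      pow_le_pow_right₀ h1 (Nat.le_add_left l k)
    have hp : (0 : ℝ) ≤ bracket m ^ k := pow_nonneg (bracket_pos m).le _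
    have hq : (0 : ℝ) ≤ bracket m ^ l := pow_nonneg (bracket_pos m).le _
    calc ‖(a + b) m‖ ≤ ‖a m‖ + ‖b m‖ := norm_add_le _ _
      _ ≤ C * bracket m ^ k + D * bracket m ^ l := add_le_add (h m) (h' m)
      _ ≤ |C| * bracket m ^ k + |D| * bracket m ^ l :=
          add_le_add (mul_le_mul_of_nonneg_right (le_abs_self C) hp)
            (mul_le_mul_of_nonneg_right (le_abs_self D) hq)
      _ ≤ |C| * bracket m ^ (k + l) + |D| * bracket m ^ (k + l) :=
          add_le_add (mul_le_mul_of_nonneg_left hk (abs_nonneg C))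
            (mul_le_mul_of_nonneg_left hl (abs_nonneg D))
      _ = (|C| + |D|) * bracket m ^ (k + l) := by ring
  smul_mem' := by
    rintro z a ⟨k, C, h⟩
    refine ⟨k, ‖z‖ * C, fun m => ?_⟩
    calc ‖(z • a) m‖ = ‖z‖ * ‖a m‖ := norm_mul _ _
      _ ≤ ‖z‖ * (C * bracket m ^ k) := mul_le_mul_of_nonneg_left (h m) (norm_nonneg z)
      _ = ‖z‖ * C * bracket m ^ k := by ring

/-- The `m`-th Fourier coefficient of a distribution. -/
def coeff (g : PeriodicDistribution) (m : ℤ) : ℂ := (g : ℤ → ℂ) m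

/-- The periodic Sobolev space `H^s`, for arbitrary real `s`. -/
def sobolev (s : ℝ) : Submodule ℂ PeriodicDistribution where
  carrier := {g | Summable fun m : ℤ => bracket m ^ (2 * s) * ‖coeff g m‖ ^ 2}
  zero_mem' := by
    have h : (fun m : ℤ => bracket m ^ (2 * s) * ‖coeff 0 m‖ ^ 2) = fun _ => 0 := by
      funext m
      simp [coeff]
    show Summable _
    rw [h]
    exact summable_zero
  add_mem' := by
    intro a b ha hb
    have ha' : Summable fun m : ℤ => bracket m ^ (2 * s) * ‖coeff a m‖ ^ 2 := ha
    have hb' : Summable fun m : ℤ => bracket m ^ (2 * s) * ‖coeff b m‖ ^ 2 := hb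
    refine Summable.of_nonneg_of_le (fun m => ?_) (fun m => ?_)
      ((ha'.mul_left 2).add (hb'.mul_left 2))
    · exact mul_nonneg (Real.rpow_nonneg (bracket_pos m).le _) (sq_nonneg _)
    · have hw : 0 ≤ bracket m ^ (2 * s) := Real.rpow_nonneg (bracket_pos m).le _
      have h1 : ‖coeff (a + b) m‖ ≤ ‖coeff a m‖ + ‖coeff b m‖ := norm_add_le _ _
      have h2 : ‖coeff (a + b) m‖ ^ 2 ≤ 2 * ‖coeff a m‖ ^ 2 + 2 * ‖coeff b m‖ ^ 2 := by
        nlinarith [norm_nonneg (coeff (a + b) m), sq_nonneg (‖coeff a m‖ - ‖coeff b m‖)]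
      calc bracket m ^ (2 * s) * ‖coeff (a + b) m‖ ^ 2
          ≤ bracket m ^ (2 * s) * (2 * ‖coeff a m‖ ^ 2 + 2 * ‖coeff b m‖ ^ 2) :=
            mul_le_mul_of_nonneg_left h2 hw
        _ = 2 * (bracket m ^ (2 * s) * ‖coeff a m‖ ^ 2)
            + 2 * (bracket m ^ (2 * s) * ‖coeff b m‖ ^ 2) := by ring
  smul_mem' := by
    intro z a ha
    have ha' : Summable fun m : ℤ => bracket m ^ (2 * s) * ‖coeff a m‖ ^ 2 := ha
    refine (ha'.mul_left (‖z‖ ^ 2)).congr (fun m => ?_)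
    have h : ‖coeff (z • a) m‖ = ‖z‖ * ‖coeff a m‖ := norm_mul _ _
    rw [h]
    ring

/-- The norm of `H^s`, i.e. the square root of
`|ĝ₀|² + ∑_{m ≠ 0} |m|^{2s} |ĝ_m|²` (meaningful for `g ∈ H^s`). -/
def sobolevNorm (s : ℝ) (g : PeriodicDistribution) : ℝ :=
  Real.sqrt (∑' m : ℤ, bracket m ^ (2 * s) * ‖coeff g m‖ ^ 2)

/-- The value at `x` of (the continuous representative of) `g`, the sum of its Fourier series;
the series converges absolutely and uniformly as soon as `g ∈ H^s` for some `s > 1/2`. -/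
def pointValue (g : PeriodicDistribution) (x : ℝ) : ℂ :=
  ∑' m : ℤ, coeff g m * Complex.exp (2 * Real.pi * Complex.I * m * x)

/-- The distribution given by (the 1-periodic extension of) an integrable function on `[0,1)`,
with Fourier coefficients `∫₀¹ e^{-2πimt} f(t) dt`. -/
def ofFunction (f : ℝ → ℂ) : PeriodicDistribution :=
  ⟨fun m => ∫ t in (0 : ℝ)..1, Complex.exp (-(2 * Real.pi * Complex.I * m * t)) * f t, by
    refine ⟨0, ∫ t in (0 : ℝ)..1, ‖f t‖, fun m => ?_⟩
    have h : ∀ t : ℝ,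
        ‖Complex.exp (-(2 * Real.pi * Complex.I * m * t)) * f t‖ = ‖f t‖ := by
      intro t
      have e : -(2 * Real.pi * Complex.I * m * t)
          = ((-(2 * Real.pi * m * t) : ℝ) : ℂ) * Complex.I := by
        push_cast
        ring
      rw [norm_mul, e, Complex.norm_exp_ofReal_mul_I, one_mul]
    have h2 := intervalIntegral.norm_integral_le_integral_norm
      (f := fun t : ℝ => Complex.exp (-(2 * Real.pi * Complex.I * m * t)) * f t)
      (μ := MeasureTheory.volume) (zero_le_one' ℝ)
    simp only [h] at h2
    simpa using h2⟩

/-- `V` is an operator of order `2α` with the mapping properties of the theory: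
for every real `s` it restricts to a continuous linear bijection `H^{s+α} → H^{s-α}`
with continuous inverse. -/
def IsIsomorphismOfOrder (α : ℝ) (V : PeriodicDistribution →ₗ[ℂ] PeriodicDistribution) : Prop :=
  ∀ s : ℝ,
    (∀ g ∈ sobolev (s + α), V g ∈ sobolev (s - α)) ∧
    (∃ C : ℝ, ∀ g ∈ sobolev (s + α), sobolevNorm (s - α) (V g) ≤ C * sobolevNorm (s + α) g) ∧
    (∀ f ∈ sobolev (s - α), ∃! g, g ∈ sobolev (s + α) ∧ V g = f) ∧
    (∃ C : ℝ, ∀ g ∈ sobolev (s + α), sobolevNorm (s + α) g ≤ C * sobolevNorm (s - α) (V g))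

/-- A periodic mesh with `N` knots `0 = x₀ < x₁ < ⋯ < x_{N-1} < 1` on `[0,1)`; the point
`x_N = 1`, which is identified with `x₀`, is listed as well. -/
structure Mesh (N : ℕ) where
  pts : Fin (N + 1) → ℝ
  strictMono : StrictMono pts
  pts_zero : pts 0 = 0
  pts_last : pts (Fin.last N) = 1

/-- The length of the `j`-th mesh interval. -/
def Mesh.gap {N : ℕ} (Δ : Mesh N) (j : Fin N) : ℝ := Δ.pts j.succ - Δ.pts j.castSucc

/-- `ρ`-quasi-uniformity: the largest mesh interval is at most `ρ` times the smallest one. -/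
def Mesh.IsQuasiUniform {N : ℕ} (Δ : Mesh N) (ρ : ℝ) : Prop :=
  ∀ i j : Fin N, Δ.gap i ≤ ρ * Δ.gap j

/-- The space of 1-periodic complex splines of degree `d` on the mesh: polynomials of degree at
most `d` on each mesh interval, globally of class `C^{d-1}` (no continuity is asked if `d = 0`;
at the knots a piecewise constant function takes its right limit). -/
def splineSpace (d : ℕ) {N : ℕ} (Δ : Mesh N) : Submodule ℂ (ℝ → ℂ) where
  carrier := {f | Function.Periodic f 1 ∧
    (∀ j : Fin N, ∃ p : ℂ[X], p.natDegree ≤ d ∧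
      ∀ t ∈ Set.Ico (Δ.pts j.castSucc) (Δ.pts j.succ), f t = p.eval (t : ℂ)) ∧
    ∀ k : ℕ, k < d → ContDiff ℝ k f}
  zero_mem' := ⟨fun _ => rfl, fun _ => ⟨0, by simp, fun _ _ => by simp⟩,
    fun _ _ => contDiff_const⟩
  add_mem' := by
    rintro f g ⟨hf, hf', hf''⟩ ⟨hg, hg', hg''⟩
    refine ⟨hf.add hg, fun j => ?_, fun k hk => (hf'' k hk).add (hg'' k hk)⟩
    obtain ⟨p, hp, hp'⟩ := hf' j
    obtain ⟨q, hq, hq'⟩ := hg' j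
    refine ⟨p + q, Polynomial.natDegree_add_le_of_degree_le hp hq, fun t ht => ?_⟩
    simp [hp' t ht, hq' t ht]
  smul_mem' := by
    rintro z f ⟨hf, hf', hf''⟩
    refine ⟨fun t => by simp [hf t], fun j => ?_, fun k hk => (hf'' k hk).const_smul z⟩
    obtain ⟨p, hp, hp'⟩ := hf' j
    exact ⟨z • p, (Polynomial.natDegree_smul_le z p).trans hp, fun t ht => by simp [hp' t ht]⟩

/-- The `M` equispaced points `x̃ + j/M` of the circle, listed periodically over `j ∈ ℤ`
(so that `x_{j+M} = x_j + 1`). -/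
def equispaced (M : ℕ) (x₀ : ℝ) (j : ℤ) : ℝ := x₀ + j / M

/-- The weight `½ (x_{j+1} - x_{j-1})`, half the arc length from `x_{j-1}` to `x_{j+1}`. -/
def arcWeight (x : ℤ → ℝ) (j : ℤ) : ℝ := (x (j + 1) - x (j - 1)) / 2

/-- The collocation matrix `G` with entries `(V φ_n)(x_m)`, for `m = 1, …, M`. -/
def collocationMatrix (V : PeriodicDistribution →ₗ[ℂ] PeriodicDistribution) (M : ℕ)
    (x : ℤ → ℝ) {n : ℕ} (φ : Fin n → ℝ → ℂ) : Matrix (Fin M) (Fin n) ℂ :=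
  Matrix.of fun j i => pointValue (V (ofFunction (φ i))) (x ((j : ℕ) + 1))

/-- The diagonal weight matrix `W`. -/
def weightMatrix (M : ℕ) (x : ℤ → ℝ) : Matrix (Fin M) (Fin M) ℂ :=
  Matrix.diagonal fun j => (arcWeight x ((j : ℕ) + 1) : ℂ)

open Matrix in
/-- `v` is an oversampled collocation approximation from the trial space `S` to the solution of
`V u = f` with collocation points `x₁, …, x_M`: the coefficient vector `a` of `v` in a basis
`φ` of `S` solves the weighted normal equations `(Gᴴ W G) a = Gᴴ W f`, where the vector `f` on
the right consists of the values of `f` at the collocation points. -/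
def IsCollocationSolution (V : PeriodicDistribution →ₗ[ℂ] PeriodicDistribution)
    (S : Submodule ℂ (ℝ → ℂ)) (M : ℕ) (x : ℤ → ℝ) (f : PeriodicDistribution)
    (v : ℝ → ℂ) : Prop :=
  ∃ (n : ℕ) (φ : Module.Basis (Fin n) ℂ S) (a : Fin n → ℂ),
    (let G := collocationMatrix V M x fun i => (φ i : ℝ → ℂ)
     let W := weightMatrix M x
     (Gᴴ * W * G) *ᵥ a = (Gᴴ * W) *ᵥ fun j : Fin M => pointValue f (x ((j : ℕ) + 1))) ∧
    v = ∑ i, a i • (φ i : ℝ → ℂ)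

end

end OversampledCollocation

open OversampledCollocation

/-! Put γ = d + 1 - 2α, so that γ > 1, and let X be the image of the spline space under V. The
normal equations say that V u_N - V u is orthogonal to X in the discrete inner product of the
collocation points (`isCollocationSolution_iff`), so the method is discrete least squares for V u in
X. Sampling at M equispaced points folds the frequencies modulo M. This changes the L² product by at
most a constant times M^{-σ} ‖F‖_σ ‖G‖_σ, for each σ > 1/2 (`exists_quadrature_bound`).

Write γ = σ + τ. The space X has the inverse estimate ‖x‖_σ ≲ N^σ ‖x‖_0, and it approximates H^γ to
order γ in L² and to order τ in H^σ (`exists_image_estimates`). With M ≥ N^β, the quadrature defect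
on X is a factor N^{2σ-βσ}, hence small for large N. The discrete product is then coercive on X,
which gives unique solvability and the errors N^{-γ} in L² and N^{-τ} in H^σ. Duality doubles the
rate (`exists_discrete_least_squares_bound`): the squared H^{-γ} norm of the error E is its pairing
with some ψ in H^γ. Approximate ψ by q in X. The pairing of E with ψ - q is of order N^{-2γ}, and by
discrete orthogonality the pairing of E with q is a mere quadrature error, of order N^{-βσ-τ}. Both
are acceptable if βσ ≥ 2σ + τ. Since the splines are placed in H^{d+1-τ} and this needs τ > 1/2, the
limit τ → 1/2 produces exactly the threshold for β (`exists_exponents`). Continuity of V⁻¹ carries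
the H^{-γ} estimate back to u.

The spline estimates come from Fourier analysis alone. The derivative of order d + 1 of a spline is
a comb of point masses at the knots with total mass zero, and every such comb occurs
(`exists_coeff_of_mem_splineSpace`, `combSpline_mem_splineSpace`). For separated knots a Schur test
with squared Dirichlet kernels compares the ℓ² norm of the masses with the Fourier coefficients in
windows of length comparable to N (`exists_comb_bounds`), and the inverse estimate follows. For
approximation, take the best comb in a negative Sobolev space. Its dual residual is constant on the
knots, and a function constant on the knots is nearly constant (`exists_sampling_inequality`).

For the estimate along given sequences only finitely many N remain, and on each fixed mesh an
injective collocation map has a left inverse (`exists_bound_of_fixed_mesh`). -/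

namespace OversampledCollocation

/-! ### Sobolev norms, duality and point values -/

/-- The Cauchy–Schwarz inequality for series of non-negative reals. -/
theorem summable_mul_and_tsum_mul_le {ι : Type*} {a b : ι → ℝ} (ha : ∀ i, 0 ≤ a i)
    (hb : ∀ i, 0 ≤ b i) (hsa : Summable fun i => a i ^ 2) (hsb : Summable fun i => b i ^ 2) :
    (Summable fun i => a i * b i) ∧
      ∑' i, a i * b i ≤ Real.sqrt (∑' i, a i ^ 2) * Real.sqrt (∑' i, b i ^ 2) := by
  have hsa' : Summable fun i => a i ^ (2 : ℝ) := by simpa using hsa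
  have hsb' : Summable fun i => b i ^ (2 : ℝ) := by simpa using hsb
  have h := Real.summable_and_inner_le_Lp_mul_Lq_tsum_of_nonneg
    (Real.HolderConjugate.two_two) ha hb hsa' hsb'
  refine ⟨h.1, ?_⟩
  have h2 := h.2
  simpa [Real.sqrt_eq_rpow] using h2

theorem mem_sobolev_iff {s : ℝ} {g : PeriodicDistribution} :
    g ∈ sobolev s ↔ Summable fun m : ℤ => bracket m ^ (2 * s) * ‖coeff g m‖ ^ 2 := Iff.rfl

@[simp] theorem coeff_add (f g : PeriodicDistribution) (m : ℤ) :
    coeff (f + g) m = coeff f m + coeff g m := rfl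

@[simp] theorem coeff_sub (f g : PeriodicDistribution) (m : ℤ) :
    coeff (f - g) m = coeff f m - coeff g m := rfl

@[simp] theorem coeff_smul (c : ℂ) (g : PeriodicDistribution) (m : ℤ) :
    coeff (c • g) m = c * coeff g m := rfl

@[simp] theorem coeff_zero (m : ℤ) : coeff 0 m = 0 := rfl

theorem ext_coeff {f g : PeriodicDistribution} (h : ∀ m, coeff f m = coeff g m) : f = g :=
  Subtype.ext (funext h)

theorem sobolevNorm_nonneg (s : ℝ) (g : PeriodicDistribution) : 0 ≤ sobolevNorm s g :=
  Real.sqrt_nonneg _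

theorem weighted_sq (s : ℝ) (c : ℂ) (m : ℤ) :
    bracket m ^ (2 * s) * ‖c‖ ^ 2 = (bracket m ^ s * ‖c‖) ^ 2 := by
  rw [mul_pow, mul_comm 2 s, Real.rpow_mul (bracket_pos m).le]
  simp

theorem weighted_sq_nonneg (s : ℝ) (c : ℂ) (m : ℤ) : 0 ≤ bracket m ^ (2 * s) * ‖c‖ ^ 2 :=
  mul_nonneg (Real.rpow_nonneg (bracket_pos m).le _) (sq_nonneg _)

theorem sobolevNorm_sq (s : ℝ) (g : PeriodicDistribution) :
    sobolevNorm s g ^ 2 = ∑' m : ℤ, bracket m ^ (2 * s) * ‖coeff g m‖ ^ 2 :=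
  Real.sq_sqrt (tsum_nonneg fun m => weighted_sq_nonneg s _ m)

theorem sobolev_mono {s t : ℝ} (h : s ≤ t) : sobolev t ≤ sobolev s := by
  intro g hg
  refine Summable.of_nonneg_of_le (fun m => weighted_sq_nonneg s _ m) (fun m => ?_)
    (mem_sobolev_iff.1 hg)
  gcongr
  exact one_le_bracket m

theorem sobolevNorm_mono {s t : ℝ} (h : s ≤ t) {g : PeriodicDistribution} (hg : g ∈ sobolev t) :
    sobolevNorm s g ≤ sobolevNorm t g := by
  refine Real.sqrt_le_sqrt (Summable.tsum_le_tsum (fun m => ?_) (sobolev_mono h hg) hg)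
  gcongr
  exact one_le_bracket m

/-- The weighted coefficient sequence of an element of `H^s`, a linear isometry onto `ℓ²`. -/
noncomputable def toEllTwo (s : ℝ) : sobolev s →ₗ[ℂ] lp (fun _ : ℤ => ℂ) 2 where
  toFun g := ⟨fun m => ((bracket m ^ s : ℝ) : ℂ) * coeff g.1 m, memℓp_gen (by
    refine (mem_sobolev_iff.1 g.2).congr fun m => ?_
    rw [weighted_sq, norm_mul, Complex.norm_real,
      Real.norm_of_nonneg (Real.rpow_nonneg (bracket_pos m).le _)]
    simp)⟩
  map_add' f g := by
    ext m
    exact mul_add _ _ _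
  map_smul' c g := by
    ext m
    simp [mul_left_comm]

theorem norm_toEllTwo (s : ℝ) (g : sobolev s) : ‖toEllTwo s g‖ = sobolevNorm s g.1 := by
  rw [lp.norm_eq_tsum_rpow (by norm_num), sobolevNorm, Real.sqrt_eq_rpow]
  simp only [ENNReal.toReal_ofNat]
  congr 1
  refine tsum_congr fun m => ?_
  rw [weighted_sq]
  simp [toEllTwo, abs_of_nonneg (Real.rpow_nonneg (bracket_pos m).le s)]

theorem sobolevNorm_add_le {s : ℝ} {f g : PeriodicDistribution} (hf : f ∈ sobolev s)
    (hg : g ∈ sobolev s) : sobolevNorm s (f + g) ≤ sobolevNorm s f + sobolevNorm s g := by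
  have h := norm_add_le (toEllTwo s ⟨f, hf⟩) (toEllTwo s ⟨g, hg⟩)
  rw [← map_add] at h
  simp only [norm_toEllTwo] at h
  exact h

theorem sobolevNorm_sub_le {s : ℝ} {f g : PeriodicDistribution} (hf : f ∈ sobolev s)
    (hg : g ∈ sobolev s) : sobolevNorm s (f - g) ≤ sobolevNorm s f + sobolevNorm s g := by
  have h := norm_sub_le (toEllTwo s ⟨f, hf⟩) (toEllTwo s ⟨g, hg⟩)
  rw [← map_sub] at h
  simp only [norm_toEllTwo] at h
  exact h

theorem sobolevNorm_smul (s : ℝ) (c : ℂ) (g : PeriodicDistribution) :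
    sobolevNorm s (c • g) = ‖c‖ * sobolevNorm s g := by
  have h : ∀ m : ℤ, bracket m ^ (2 * s) * ‖coeff (c • g) m‖ ^ 2
      = ‖c‖ ^ 2 * (bracket m ^ (2 * s) * ‖coeff g m‖ ^ 2) := fun m => by
    rw [coeff_smul, norm_mul]; ring
  simp only [sobolevNorm, h, tsum_mul_left]
  rw [Real.sqrt_mul (sq_nonneg _), Real.sqrt_sq (norm_nonneg _)]

theorem sobolevNorm_zero (s : ℝ) : sobolevNorm s 0 = 0 := by
  simp [sobolevNorm]

theorem sobolevNorm_sum_le {ι : Type*} (t : Finset ι) {s : ℝ} {f : ι → PeriodicDistribution}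
    (hf : ∀ i, f i ∈ sobolev s) : sobolevNorm s (∑ i ∈ t, f i) ≤ ∑ i ∈ t, sobolevNorm s (f i) := by
  classical
  induction t using Finset.induction_on with
  | empty => simp [sobolevNorm_zero]
  | insert i t hi ih =>
    rw [Finset.sum_insert hi, Finset.sum_insert hi]
    exact (sobolevNorm_add_le (hf i) (Submodule.sum_mem _ fun j _ => hf j)).trans (by linarith)

theorem eq_zero_of_sobolevNorm_eq_zero {s : ℝ} {g : PeriodicDistribution} (hg : g ∈ sobolev s)
    (h : sobolevNorm s g = 0) : g = 0 := by
  refine ext_coeff fun m => ?_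
  have h0 : ∑' m : ℤ, bracket m ^ (2 * s) * ‖coeff g m‖ ^ 2 = 0 := by
    rw [← sobolevNorm_sq, h]; simp
  have h1 := (hasSum_zero_iff_of_nonneg fun m => weighted_sq_nonneg s _ m).1
    (h0 ▸ (mem_sobolev_iff.1 hg).hasSum)
  have h2 := congrFun h1 m
  have h3 : (bracket m ^ (2 * s)) ≠ 0 := (Real.rpow_pos_of_pos (bracket_pos m) _).ne'
  simpa [h3] using h2

theorem summable_abs_int_rpow {s : ℝ} (hs : 1 < s) :
    Summable fun m : ℤ => bracket m ^ (-s) := by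
  have h : Summable fun n : ℕ => (max 1 (n : ℝ)) ^ (-s) := by
    refine (summable_congr_atTop ?_).2 (Real.summable_nat_rpow.2 (by linarith : -s < -1))
    filter_upwards [Filter.eventually_ge_atTop 1] with n hn
    rw [max_eq_right (by exact_mod_cast hn)]
  refine Summable.of_nat_of_neg ?_ ?_
  · simpa [bracket] using h
  · simpa [bracket] using h

theorem summable_bracket_rpow {s : ℝ} (hs : 1 / 2 < s) :
    Summable fun m : ℤ => (bracket m ^ (-s)) ^ 2 := by
  refine (summable_abs_int_rpow (s := 2 * s) (by linarith)).congr fun m => ?_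
  rw [← Real.rpow_natCast, ← Real.rpow_mul (bracket_pos m).le]
  congr 1
  push_cast
  ring

theorem rpow_neg_mul_rpow (s : ℝ) (m : ℤ) : bracket m ^ (-s) * bracket m ^ s = 1 := by
  rw [← Real.rpow_add (bracket_pos m)]; simp

/-- Duality of `H^{-s}` and `H^s`. -/
theorem summable_and_tsum_norm_mul_le {s : ℝ} {f g : PeriodicDistribution}
    (hf : f ∈ sobolev (-s)) (hg : g ∈ sobolev s) :
    (Summable fun m => ‖coeff f m‖ * ‖coeff g m‖) ∧
      ∑' m, ‖coeff f m‖ * ‖coeff g m‖ ≤ sobolevNorm (-s) f * sobolevNorm s g := by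
  have h := summable_mul_and_tsum_mul_le
    (a := fun m => bracket m ^ (-s) * ‖coeff f m‖) (b := fun m => bracket m ^ s * ‖coeff g m‖)
    (fun m => mul_nonneg (Real.rpow_nonneg (bracket_pos m).le _) (norm_nonneg _))
    (fun m => mul_nonneg (Real.rpow_nonneg (bracket_pos m).le _) (norm_nonneg _))
    ((mem_sobolev_iff.1 hf).congr fun m => weighted_sq _ _ _)
    ((mem_sobolev_iff.1 hg).congr fun m => weighted_sq _ _ _)
  have e : ∀ m, bracket m ^ (-s) * ‖coeff f m‖ * (bracket m ^ s * ‖coeff g m‖)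
      = ‖coeff f m‖ * ‖coeff g m‖ := fun m => by
    rw [mul_mul_mul_comm, rpow_neg_mul_rpow, one_mul]
  simpa only [e, ← weighted_sq, sobolevNorm] using h

/-- Sobolev embedding: Cauchy–Schwarz against the weights `bracket m ^ (-s)`, which are square
summable exactly because s > 1/2. All point evaluations rest on this absolute convergence. -/
theorem summable_norm_coeff {s : ℝ} (hs : 1 / 2 < s) {g : PeriodicDistribution}
    (hg : g ∈ sobolev s) : (Summable fun m => ‖coeff g m‖) ∧
      ∑' m, ‖coeff g m‖ ≤ Real.sqrt (∑' m : ℤ, (bracket m ^ (-s)) ^ 2) * sobolevNorm s g := by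
  have h := summable_mul_and_tsum_mul_le
    (a := fun m => bracket m ^ (-s)) (b := fun m => bracket m ^ s * ‖coeff g m‖)
    (fun m => Real.rpow_nonneg (bracket_pos m).le _)
    (fun m => mul_nonneg (Real.rpow_nonneg (bracket_pos m).le _) (norm_nonneg _))
    (summable_bracket_rpow hs)
    ((mem_sobolev_iff.1 hg).congr fun m => weighted_sq _ _ _)
  have e : ∀ m, bracket m ^ (-s) * (bracket m ^ s * ‖coeff g m‖)
      = ‖coeff g m‖ := fun m => by
    rw [← mul_assoc, rpow_neg_mul_rpow, one_mul]
  simpa only [e, ← weighted_sq, sobolevNorm] using h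

theorem norm_character (m : ℤ) (x : ℝ) :
    ‖Complex.exp (2 * Real.pi * Complex.I * m * x)‖ = 1 := by
  have e : 2 * Real.pi * Complex.I * m * x = ((2 * Real.pi * m * x : ℝ) : ℂ) * Complex.I := by
    push_cast; ring
  rw [e, Complex.norm_exp_ofReal_mul_I]

theorem summable_pointValue {s : ℝ} (hs : 1 / 2 < s) {g : PeriodicDistribution}
    (hg : g ∈ sobolev s) (x : ℝ) :
    Summable fun m : ℤ => coeff g m * Complex.exp (2 * Real.pi * Complex.I * m * x) := by
  refine Summable.of_norm ((summable_norm_coeff hs hg).1.congr fun m => ?_)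
  rw [norm_mul, norm_character, mul_one]

theorem norm_pointValue_le {s : ℝ} (hs : 1 / 2 < s) {g : PeriodicDistribution}
    (hg : g ∈ sobolev s) (x : ℝ) : ‖pointValue g x‖ ≤
      Real.sqrt (∑' m : ℤ, (bracket m ^ (-s)) ^ 2) * sobolevNorm s g := by
  refine le_trans ?_ (summable_norm_coeff hs hg).2
  refine (norm_tsum_le_tsum_norm ?_).trans (le_of_eq ?_)
  · exact (summable_norm_coeff hs hg).1.congr fun m => by
      rw [norm_mul, norm_character, mul_one]
  · exact tsum_congr fun m => by rw [norm_mul, norm_character, mul_one]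

theorem pointValue_add {s : ℝ} (hs : 1 / 2 < s) {f g : PeriodicDistribution}
    (hf : f ∈ sobolev s) (hg : g ∈ sobolev s) (x : ℝ) :
    pointValue (f + g) x = pointValue f x + pointValue g x := by
  simp only [pointValue, coeff_add, add_mul]
  exact (summable_pointValue hs hf x).tsum_add (summable_pointValue hs hg x)

theorem pointValue_smul (c : ℂ) (g : PeriodicDistribution) (x : ℝ) :
    pointValue (c • g) x = c * pointValue g x := by
  simp only [pointValue, coeff_smul, mul_assoc, tsum_mul_left]

theorem pointValue_sub {s : ℝ} (hs : 1 / 2 < s) {f g : PeriodicDistribution}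
    (hf : f ∈ sobolev s) (hg : g ∈ sobolev s) (x : ℝ) :
    pointValue (f - g) x = pointValue f x - pointValue g x := by
  simp only [pointValue, coeff_sub, sub_mul]
  exact (summable_pointValue hs hf x).tsum_sub (summable_pointValue hs hg x)

end OversampledCollocation

/-! ### Aliasing and the equispaced rectangle rule -/

namespace OversampledCollocation
open ComplexConjugate

/-- The character `x ↦ e^{2πimx}`. -/
noncomputable def character (m : ℤ) (x : ℝ) : ℂ :=
  Complex.exp (2 * Real.pi * Complex.I * m * x)

theorem pointValue_eq (g : PeriodicDistribution) (x : ℝ) :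
    pointValue g x = ∑' m : ℤ, coeff g m * character m x := rfl

@[simp] theorem norm_character_eq_one (m : ℤ) (x : ℝ) : ‖character m x‖ = 1 := norm_character m x

theorem character_add_left (m n : ℤ) (x : ℝ) :
    character (m + n) x = character m x * character n x := by
  rw [character, character, character, ← Complex.exp_add]
  congr 1; push_cast; ring

theorem character_add_right (m : ℤ) (x y : ℝ) :
    character m (x + y) = character m x * character m y := by
  rw [character, character, character, ← Complex.exp_add]
  congr 1; push_cast; ring

theorem character_neg_left (m : ℤ) (x : ℝ) : character (-m) x = conj (character m x) := by
  rw [character, character, ← Complex.exp_conj]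
  congr 1; simp [Complex.conj_ofNat]

@[simp] theorem character_zero_left (x : ℝ) : character 0 x = 1 := by simp [character]

@[simp] theorem character_zero_right (m : ℤ) : character m 0 = 1 := by simp [character]

theorem character_neg_right (m : ℤ) (x : ℝ) : character m (-x) = conj (character m x) := by
  rw [← character_neg_left, character, character]
  congr 1; push_cast; ring

theorem character_int (m n : ℤ) : character m n = 1 := by
  rw [character, Complex.exp_eq_one_iff]
  exact ⟨m * n, by push_cast; ring⟩

theorem character_mul_conj (m : ℤ) (x : ℝ) : character m x * conj (character m x) = 1 := by
  rw [Complex.mul_conj, Complex.normSq_eq_norm_sq]; simp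

theorem character_natCast_mul (m : ℤ) (n : ℕ) (x : ℝ) : character m (n * x) = character m x ^ n := by
  rw [character, character, ← Complex.exp_nat_mul]
  congr 1; push_cast; ring

/-- A geometric sum: its ratio is an M-th root of unity, and it differs from 1 off the diagonal
because 0 < |r - s| < M. -/
theorem sum_character_div {M : ℕ} (r s : Fin M) :
    ∑ j : Fin M, character ((r : ℕ) - (s : ℕ)) ((j : ℕ) / M) = if r = s then (M : ℂ) else 0 := by
  have hM : (M : ℝ) ≠ 0 := by
    have := r.pos
    positivity
  split_ifs with h
  · simp [h]
  · have e : ∀ j : Fin M, character ((r : ℕ) - (s : ℕ)) ((j : ℕ) / M)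
        = character ((r : ℕ) - (s : ℕ)) (1 / M) ^ (j : ℕ) := fun j => by
      rw [← character_natCast_mul]; congr 1; ring
    simp only [e]
    rw [Fin.sum_univ_eq_sum_range (fun j => character ((r : ℕ) - (s : ℕ)) (1 / M) ^ j)]
    have h1 : character ((r : ℕ) - (s : ℕ)) (1 / M) ^ M = 1 := by
      rw [← character_natCast_mul, mul_one_div_cancel hM]
      exact_mod_cast character_int ((r : ℕ) - (s : ℕ)) 1
    have h2 : character ((r : ℕ) - (s : ℕ)) (1 / M) ≠ 1 := by
      intro h3
      rw [character, Complex.exp_eq_one_iff] at h3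
      obtain ⟨n, hn⟩ := h3
      have hMc : (M : ℂ) ≠ 0 := by exact_mod_cast hM
      have h4 : (((r : ℕ) : ℂ) - (s : ℕ)) = n * M := by
        have h5 := Complex.two_pi_I_ne_zero
        push_cast at hn
        have h6 : (2 * Real.pi * Complex.I) * (((r : ℕ) : ℂ) - (s : ℕ)) =
            (2 * Real.pi * Complex.I) * (n * M) := by
          field_simp at hn
          linear_combination (2 * Real.pi * Complex.I) * hn
        exact mul_left_cancel₀ h5 h6
      have h7 : ((r : ℕ) : ℤ) - (s : ℕ) = n * M := by exact_mod_cast h4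
      have hr := r.2
      have hs := s.2
      have h8 : n = 0 := by
        have h9 : |n * (M : ℤ)| < 1 * (M : ℤ) := by rw [← h7, abs_lt]; omega
        rw [abs_mul, Nat.abs_cast] at h9
        have := lt_of_mul_lt_mul_right h9 (by positivity)
        exact Int.abs_lt_one_iff.1 this
      rw [h8] at h7
      exact h (Fin.ext (by omega))
    have h3 := geom_sum_mul (character ((r : ℕ) - (s : ℕ)) (1 / M)) M
    rw [h1, sub_self] at h3
    exact (mul_eq_zero.1 h3).resolve_right (sub_ne_zero.2 h2)

/-- Parseval's identity for the discrete Fourier transform. -/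
theorem discrete_parseval {M : ℕ} (hM : 0 < M) (h : ℤ) (a b : Fin M → ℂ) :
    (1 / M : ℂ) * ∑ j : Fin M, (∑ r : Fin M, a r * character ((r : ℕ) - h) ((j : ℕ) / M)) *
      conj (∑ r : Fin M, b r * character ((r : ℕ) - h) ((j : ℕ) / M))
      = ∑ r, a r * conj (b r) := by
  have e : ∀ j : Fin M, (∑ r : Fin M, a r * character ((r : ℕ) - h) ((j : ℕ) / M)) *
      conj (∑ r : Fin M, b r * character ((r : ℕ) - h) ((j : ℕ) / M))
      = ∑ r : Fin M, ∑ s : Fin M, (a r * conj (b s)) *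
        character ((r : ℕ) - (s : ℕ)) ((j : ℕ) / M) := fun j => by
    rw [map_sum, Finset.sum_mul_sum]
    refine Finset.sum_congr rfl fun r _ => Finset.sum_congr rfl fun s _ => ?_
    have : ((r : ℕ) : ℤ) - (s : ℕ) = ((r : ℕ) - h) + -((s : ℕ) - h) := by ring
    rw [this, character_add_left, character_neg_left, map_mul]
    ring
  simp only [e]
  rw [Finset.sum_comm]
  have e2 : ∀ r : Fin M, ∑ j : Fin M, ∑ s : Fin M, (a r * conj (b s)) *
        character ((r : ℕ) - (s : ℕ)) ((j : ℕ) / M) = M * (a r * conj (b r)) := fun r => by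
    rw [Finset.sum_comm]
    simp only [← Finset.mul_sum, sum_character_div]
    simp [mul_comm]
  have hMc : (M : ℂ) ≠ 0 := by exact_mod_cast hM.ne'
  simp only [e2, ← Finset.mul_sum]
  field_simp

/-- A product of two sums is close to the sum of the products when the terms with non-zero
index are small. -/
theorem norm_tsum_mul_conj_tsum_sub_le {σ η : ℝ} (hσ : 1 / 2 < σ) {c d : ℤ → ℂ} {w : ℤ → ℝ}
    (h0 : 1 ≤ w 0) (hw : ∀ k, 0 ≤ w k) (hη : 0 ≤ η) (h1 : ∀ k ≠ 0, bracket k ^ σ ≤ η * w k)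
    (hc : Summable fun k => (w k * ‖c k‖) ^ 2) (hd : Summable fun k => (w k * ‖d k‖) ^ 2) :
    ‖(∑' k, c k) * conj (∑' k, d k) - ∑' k, c k * conj (d k)‖ ≤
      (2 * Real.sqrt (∑' m : ℤ, (bracket m ^ (-σ)) ^ 2) * η +
        ((∑' m : ℤ, (bracket m ^ (-σ)) ^ 2) + 1) * η ^ 2) *
        (Real.sqrt (∑' k, (w k * ‖c k‖) ^ 2) * Real.sqrt (∑' k, (w k * ‖d k‖) ^ 2)) := by
  set Z := Real.sqrt (∑' m : ℤ, (bracket m ^ (-σ)) ^ 2) with hZ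
  have hZ2 : ∑' m : ℤ, (bracket m ^ (-σ)) ^ 2 = Z ^ 2 :=
    (Real.sq_sqrt (tsum_nonneg fun m => sq_nonneg _)).symm
  have hZ0 : 0 ≤ Z := Real.sqrt_nonneg _
  -- the part of a sequence away from the index `0`
  have key : ∀ c : ℤ → ℂ, (Summable fun k => (w k * ‖c k‖) ^ 2) →
      (Summable fun k => ‖if k = 0 then 0 else c k‖) ∧
      ‖∑' k, (if k = 0 then 0 else c k)‖ ≤ Z * η * Real.sqrt (∑' k, (w k * ‖c k‖) ^ 2) ∧
      ‖c 0‖ ≤ Real.sqrt (∑' k, (w k * ‖c k‖) ^ 2) := by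
    intro c hc
    have hle : ∀ k, ‖if k = 0 then 0 else c k‖ ≤ η * (bracket k ^ (-σ) * (w k * ‖c k‖)) := by
      intro k
      split_ifs with h
      · have := Real.rpow_nonneg (bracket_pos k).le (-σ)
        have := hw k
        simp only [norm_zero]; positivity
      · have h2 := mul_le_mul_of_nonneg_left (h1 k h)
          (Real.rpow_nonneg (bracket_pos k).le (-σ))
        rw [rpow_neg_mul_rpow] at h2
        nlinarith [mul_le_mul_of_nonneg_right h2 (norm_nonneg (c k))]
    have hcs := summable_mul_and_tsum_mul_le (a := fun k => bracket k ^ (-σ))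
      (b := fun k => w k * ‖c k‖) (fun k => Real.rpow_nonneg (bracket_pos k).le _)
      (fun k => mul_nonneg (hw k) (norm_nonneg _)) (summable_bracket_rpow hσ) hc
    have hs := Summable.of_nonneg_of_le (fun k => norm_nonneg _) hle (hcs.1.mul_left η)
    refine ⟨hs, ?_, ?_⟩
    · calc ‖∑' k, (if k = 0 then 0 else c k)‖ ≤ ∑' k, ‖if k = 0 then 0 else c k‖ :=
            norm_tsum_le_tsum_norm hs
        _ ≤ ∑' k, η * (bracket k ^ (-σ) * (w k * ‖c k‖)) :=
            hs.tsum_le_tsum hle (hcs.1.mul_left η)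
        _ = η * ∑' k, (bracket k ^ (-σ) * (w k * ‖c k‖)) := tsum_mul_left
        _ ≤ η * (Z * Real.sqrt (∑' k, (w k * ‖c k‖) ^ 2)) :=
            mul_le_mul_of_nonneg_left hcs.2 hη
        _ = _ := by ring
    · refine Real.le_sqrt_of_sq_le (le_trans ?_ (hc.le_tsum 0 fun k _ => sq_nonneg _))
      gcongr
      nlinarith [norm_nonneg (c 0)]
  obtain ⟨hc1, hc2, hc3⟩ := key c hc
  obtain ⟨hd1, hd2, hd3⟩ := key d hd
  set P := Real.sqrt (∑' k, (w k * ‖c k‖) ^ 2)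
  set Q := Real.sqrt (∑' k, (w k * ‖d k‖) ^ 2)
  have hP : 0 ≤ P := Real.sqrt_nonneg _
  have hQ : 0 ≤ Q := Real.sqrt_nonneg _
  have split : ∀ c : ℤ → ℂ, (Summable fun k => ‖if k = 0 then 0 else c k‖) →
      ∑' k, c k = c 0 + ∑' k, (if k = 0 then 0 else c k) := by
    intro c hc
    have h2 : Summable c := by
      refine (summable_congr_cofinite ?_).1 hc.of_norm
      filter_upwards [(Set.finite_singleton (0 : ℤ)).compl_mem_cofinite] with k hk
      rw [if_neg (by simpa using hk)]
    exact h2.tsum_eq_add_tsum_ite 0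
  have hle : ∀ k, ‖if k = 0 then 0 else c k * conj (d k)‖ ≤
      η ^ 2 * ((w k * ‖c k‖) * (w k * ‖d k‖)) := by
    intro k
    split_ifs with h
    · have := hw k
      simp only [norm_zero]; positivity
    · have h2 : 1 ≤ η * w k :=
        (Real.one_le_rpow (one_le_bracket k) (by linarith)).trans (h1 k h)
      rw [norm_mul, RCLike.norm_conj]
      have h3 : 1 ≤ (η * w k) ^ 2 := one_le_pow₀ h2
      nlinarith [mul_le_mul_of_nonneg_right h3 (mul_nonneg (norm_nonneg (c k)) (norm_nonneg (d k)))]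
  have hcs := summable_mul_and_tsum_mul_le (a := fun k => w k * ‖c k‖)
    (b := fun k => w k * ‖d k‖) (fun k => mul_nonneg (hw k) (norm_nonneg _))
    (fun k => mul_nonneg (hw k) (norm_nonneg _)) hc hd
  have hs := Summable.of_nonneg_of_le (fun k => norm_nonneg _) hle (hcs.1.mul_left (η ^ 2))
  have hcd : ‖∑' k, (if k = 0 then 0 else c k * conj (d k))‖ ≤ η ^ 2 * (P * Q) :=
    calc ‖∑' k, (if k = 0 then 0 else c k * conj (d k))‖
        ≤ ∑' k, ‖if k = 0 then 0 else c k * conj (d k)‖ := norm_tsum_le_tsum_norm hs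
      _ ≤ ∑' k, η ^ 2 * ((w k * ‖c k‖) * (w k * ‖d k‖)) :=
          hs.tsum_le_tsum hle (hcs.1.mul_left _)
      _ = η ^ 2 * ∑' k, ((w k * ‖c k‖) * (w k * ‖d k‖)) := tsum_mul_left
      _ ≤ η ^ 2 * (P * Q) := mul_le_mul_of_nonneg_left hcs.2 (sq_nonneg _)
  rw [split c hc1, split d hd1, split (fun k => c k * conj (d k)) hs, hZ2]
  set c' := ∑' k, (if k = 0 then 0 else c k)
  set d' := ∑' k, (if k = 0 then 0 else d k)
  set q := ∑' k, (if k = 0 then 0 else c k * conj (d k))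
  -- The main terms `c 0 * conj (d 0)` cancel, and every remaining term contains an aliased part,
  -- hence at least one factor η.
  have e : (c 0 + c') * conj (d 0 + d') - (c 0 * conj (d 0) + q)
      = c 0 * conj d' + c' * conj (d 0) + c' * conj d' - q := by
    rw [map_add]; ring
  rw [e]
  have t1 : ‖c 0 * conj d'‖ ≤ P * (Z * η * Q) := by
    rw [norm_mul, RCLike.norm_conj]; gcongr
  have t2 : ‖c' * conj (d 0)‖ ≤ (Z * η * P) * Q := by
    rw [norm_mul, RCLike.norm_conj]; gcongr
  have t3 : ‖c' * conj d'‖ ≤ (Z * η * P) * (Z * η * Q) := by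
    rw [norm_mul, RCLike.norm_conj]; gcongr
  calc ‖c 0 * conj d' + c' * conj (d 0) + c' * conj d' - q‖
      ≤ ‖c 0 * conj d'‖ + ‖c' * conj (d 0)‖ + ‖c' * conj d'‖ + ‖q‖ := by
        refine (norm_sub_le _ _).trans (add_le_add ?_ le_rfl)
        exact norm_add₃_le
    _ ≤ P * (Z * η * Q) + (Z * η * P) * Q + (Z * η * P) * (Z * η * Q) + η ^ 2 * (P * Q) := by
        gcongr
    _ = _ := by ring

/-- The integers, sorted by their (nearly centred) residues modulo `M`. -/
def residueEquiv (M : ℕ) [NeZero M] : Fin M × ℤ ≃ ℤ :=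
  (Equiv.prodComm _ _).trans ((Int.divModEquiv M).symm.trans (Equiv.subRight ((M / 2 : ℕ) : ℤ)))

theorem residueEquiv_apply (M : ℕ) [NeZero M] (r : Fin M) (k : ℤ) :
    residueEquiv M (r, k) = k * M + ((r : ℕ) - (M / 2 : ℕ)) := by
  simp [residueEquiv, Int.divModEquiv]
  ring

theorem tsum_eq_sum_residues {X : Type*} [NormedAddCommGroup X] [CompleteSpace X] (M : ℕ)
    [NeZero M] {f : ℤ → X} (hf : Summable f) :
    ∑' m, f m = ∑ r : Fin M, ∑' k, f (residueEquiv M (r, k)) := by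
  rw [← (residueEquiv M).tsum_eq f]
  rw [Summable.tsum_prod (f := fun p => f (residueEquiv M p))
    ((residueEquiv M).summable_iff.2 hf), tsum_fintype]

theorem summable_residue {X : Type*} [NormedAddCommGroup X] [CompleteSpace X] (M : ℕ)
    [NeZero M] {f : ℤ → X} (hf : Summable f) (r : Fin M) :
    Summable fun k => f (residueEquiv M (r, k)) :=
  ((residueEquiv M).summable_iff.2 hf).prod_factor r

/-- The shift by `M / 2` centres the residues, so the representative with k = 0 has modulus at most
M/2. For k ≠ 0 the frequency then has modulus at least (|k| - 1/2) M ≥ |k| M / 2. -/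
theorem le_bracket_residueEquiv (M : ℕ) [NeZero M] (r : Fin M) {k : ℤ} (hk : k ≠ 0) :
    bracket k * (M / 2) ≤ bracket (residueEquiv M (r, k)) := by
  have hr := r.2
  have h1 : |((r : ℕ) : ℤ) - (M / 2 : ℕ)| * 2 ≤ M := by
    rcases abs_cases (((r : ℕ) : ℤ) - (M / 2 : ℕ)) with h | h <;> rw [h.1] <;> omega
  have h2 : 1 ≤ |k| := Int.one_le_abs hk
  have h3 : |k| * (M : ℤ) ≤ 2 * |residueEquiv M (r, k)| := by
    rw [residueEquiv_apply]
    have h4 := abs_sub_abs_le_abs_sub (k * (M : ℤ)) (-(((r : ℕ) : ℤ) - (M / 2 : ℕ)))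
    rw [abs_neg, sub_neg_eq_add, abs_mul, Nat.abs_cast] at h4
    nlinarith
  have h5 : |(k : ℝ)| * M ≤ 2 * |((residueEquiv M (r, k) : ℤ) : ℝ)| := by exact_mod_cast h3
  have h6 : bracket k = |(k : ℝ)| := max_eq_right (by exact_mod_cast h2)
  rw [h6]
  refine le_trans ?_ (le_max_right _ _)
  linarith

/-- The discrete inner product of the traces at the collocation points. -/
noncomputable def discreteInner (M : ℕ) (x₀ : ℝ) (F G : PeriodicDistribution) : ℂ :=
  (1 / M : ℂ) * ∑ j : Fin M, pointValue F (equispaced M x₀ ((j : ℕ) + 1)) *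
    conj (pointValue G (equispaced M x₀ ((j : ℕ) + 1)))

/-- Aliasing: on the grid, frequencies in one residue class modulo M agree up to a phase. The phase
comes from the first point `x₀ + 1 / M`, as the points are numbered from 1, and is absorbed into the
coefficients. -/
theorem pointValue_equispaced {σ : ℝ} (hσ : 1 / 2 < σ) {F : PeriodicDistribution}
    (hF : F ∈ sobolev σ) (M : ℕ) [NeZero M] (x₀ : ℝ) (j : Fin M) :
    pointValue F (equispaced M x₀ ((j : ℕ) + 1)) =
      ∑ r : Fin M, (∑' k, coeff F (residueEquiv M (r, k)) *
        character (residueEquiv M (r, k)) (x₀ + 1 / M)) *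
          character ((r : ℕ) - (M / 2 : ℕ)) ((j : ℕ) / M) := by
  have hM : (M : ℝ) ≠ 0 := by exact_mod_cast NeZero.ne M
  have hs : Summable fun m => coeff F m * character m (equispaced M x₀ ((j : ℕ) + 1)) :=
    summable_pointValue hσ hF _
  rw [pointValue_eq, tsum_eq_sum_residues M hs]
  refine Finset.sum_congr rfl fun r _ => ?_
  rw [← tsum_mul_right]
  refine tsum_congr fun k => ?_
  have e1 : equispaced M x₀ ((j : ℕ) + 1) = (x₀ + 1 / M) + (j : ℕ) / M := by
    rw [equispaced]; push_cast; ring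
  have e2 : character (residueEquiv M (r, k)) ((j : ℕ) / M)
      = character ((r : ℕ) - (M / 2 : ℕ)) ((j : ℕ) / M) := by
    rw [residueEquiv_apply, character_add_left]
    have : character (k * M) ((j : ℕ) / M) = 1 := by
      have h := character_int k (j : ℕ)
      rw [character] at h ⊢
      rw [← h]
      congr 1
      have hMc : (M : ℂ) ≠ 0 := by exact_mod_cast hM
      push_cast
      field_simp
    rw [this, one_mul]
  rw [e1, character_add_right, e2, mul_assoc]

/-- The equispaced rectangle rule for products of `H^σ` functions, `σ > 1/2`, is of order `σ`. -/
theorem exists_quadrature_bound {σ : ℝ} (hσ : 1 / 2 < σ) :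
    ∃ C : ℝ, 0 ≤ C ∧ ∀ (M : ℕ), 0 < M → ∀ (x₀ : ℝ), ∀ F ∈ sobolev σ, ∀ G ∈ sobolev σ,
      ‖discreteInner M x₀ F G - ∑' m, coeff F m * conj (coeff G m)‖ ≤
        C * (M : ℝ) ^ (-σ) * (sobolevNorm σ F * sobolevNorm σ G) := by
  set Z := Real.sqrt (∑' m : ℤ, (bracket m ^ (-σ)) ^ 2) with hZ
  have hZ2 : ∑' m : ℤ, (bracket m ^ (-σ)) ^ 2 = Z ^ 2 :=
    (Real.sq_sqrt (tsum_nonneg fun m => sq_nonneg _)).symm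
  have hZ0 : 0 ≤ Z := Real.sqrt_nonneg _
  refine ⟨(2 * Z + (Z ^ 2 + 1) * 2 ^ σ) * 2 ^ σ, by positivity, ?_⟩
  intro M hM x₀ F hF G hG
  have : NeZero M := ⟨hM.ne'⟩
  have hM1 : (1 : ℝ) ≤ M := by exact_mod_cast hM
  set c : PeriodicDistribution → Fin M → ℤ → ℂ := fun F r k =>
    coeff F (residueEquiv M (r, k)) * character (residueEquiv M (r, k)) (x₀ + 1 / M) with hc
  set w : Fin M → ℤ → ℝ := fun r k => bracket (residueEquiv M (r, k)) ^ σ with hw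
  set η : ℝ := ((M : ℝ) / 2) ^ (-σ) with hη
  have hη0 : 0 ≤ η := by positivity
  have hcn : ∀ (F : PeriodicDistribution) r k,
      (w r k * ‖c F r k‖) ^ 2 = bracket (residueEquiv M (r, k)) ^ (2 * σ) *
        ‖coeff F (residueEquiv M (r, k))‖ ^ 2 := fun F r k => by
    rw [weighted_sq, hc, norm_mul, norm_character_eq_one, mul_one]
  have hP : ∀ F ∈ sobolev σ, (∀ r, Summable fun k => (w r k * ‖c F r k‖) ^ 2) ∧
      sobolevNorm σ F ^ 2 = ∑ r, Real.sqrt (∑' k, (w r k * ‖c F r k‖) ^ 2) ^ 2 := by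
    intro F hF
    refine ⟨fun r => ?_, ?_⟩
    · simp only [hcn]
      exact summable_residue M (mem_sobolev_iff.1 hF) r
    · rw [sobolevNorm_sq, tsum_eq_sum_residues M (mem_sobolev_iff.1 hF)]
      refine Finset.sum_congr rfl fun r _ => ?_
      rw [Real.sq_sqrt (tsum_nonneg fun k => sq_nonneg _)]
      simp only [hcn]
  obtain ⟨hF1, hF2⟩ := hP F hF
  obtain ⟨hG1, hG2⟩ := hP G hG
  -- In each residue class the discrete product yields a product of sums and the exact product
  -- yields a sum of products.
  have hmain : ∀ r, ‖(∑' k, c F r k) * conj (∑' k, c G r k) - ∑' k, c F r k * conj (c G r k)‖ ≤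
      (2 * Z * η + (Z ^ 2 + 1) * η ^ 2) * (Real.sqrt (∑' k, (w r k * ‖c F r k‖) ^ 2) *
        Real.sqrt (∑' k, (w r k * ‖c G r k‖) ^ 2)) := by
    intro r
    rw [← hZ2]
    refine norm_tsum_mul_conj_tsum_sub_le hσ ?_ ?_ hη0 ?_ (hF1 r) (hG1 r)
    · exact Real.one_le_rpow (one_le_bracket _) (by linarith)
    · exact fun k => Real.rpow_nonneg (bracket_pos _).le _
    · intro k hk
      have h1 := Real.rpow_le_rpow (by have := bracket_pos k; positivity)
        (le_bracket_residueEquiv M r hk) (by linarith : 0 ≤ σ)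
      rw [Real.mul_rpow (bracket_pos k).le (by positivity)] at h1
      have h2 : η * ((M : ℝ) / 2) ^ σ = 1 := by
        rw [hη, ← Real.rpow_add (by positivity)]; simp
      calc bracket k ^ σ = η * (bracket k ^ σ * ((M : ℝ) / 2) ^ σ) := by
            linear_combination (-(bracket k ^ σ)) * h2
        _ ≤ _ := mul_le_mul_of_nonneg_left h1 hη0
  have hinner : ∑' m, coeff F m * conj (coeff G m) = ∑ r, ∑' k, c F r k * conj (c G r k) := by
    have hs : Summable fun m => coeff F m * conj (coeff G m) := by
      refine Summable.of_norm ((summable_and_tsum_norm_mul_le (s := σ)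
        (sobolev_mono (by linarith) hF) hG).1.congr fun m => ?_)
      rw [norm_mul, RCLike.norm_conj]
    rw [tsum_eq_sum_residues M hs]
    refine Finset.sum_congr rfl fun r _ => tsum_congr fun k => ?_
    rw [hc, map_mul]
    linear_combination (-(coeff F (residueEquiv M (r, k)) *
      conj (coeff G (residueEquiv M (r, k))))) *
      character_mul_conj (residueEquiv M (r, k)) (x₀ + 1 / M)
  have hdisc : discreteInner M x₀ F G = ∑ r, (∑' k, c F r k) * conj (∑' k, c G r k) := by
    rw [← discrete_parseval hM (M / 2 : ℕ) (fun r => ∑' k, c F r k) (fun r => ∑' k, c G r k),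
      discreteInner]
    simp only [pointValue_equispaced hσ hF, pointValue_equispaced hσ hG, hc]
  have hη2 : η = 2 ^ σ * (M : ℝ) ^ (-σ) := by
    rw [hη, Real.div_rpow (by positivity) (by norm_num), Real.rpow_neg (by norm_num : (0:ℝ) ≤ 2)]
    field_simp
  have hMle : (M : ℝ) ^ (-σ) ≤ 1 := Real.rpow_le_one_of_one_le_of_nonpos hM1 (by linarith)
  have hM0 : 0 ≤ (M : ℝ) ^ (-σ) := by positivity
  have hsum : ∑ r, Real.sqrt (∑' k, (w r k * ‖c F r k‖) ^ 2) *
        Real.sqrt (∑' k, (w r k * ‖c G r k‖) ^ 2) ≤ sobolevNorm σ F * sobolevNorm σ G := by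
    refine (Real.sum_mul_le_sqrt_mul_sqrt _ _ _).trans (le_of_eq ?_)
    rw [← hF2, ← hG2, Real.sqrt_sq (sobolevNorm_nonneg _ _), Real.sqrt_sq (sobolevNorm_nonneg _ _)]
  have hN := mul_nonneg (sobolevNorm_nonneg σ F) (sobolevNorm_nonneg σ G)
  rw [hdisc, hinner, ← Finset.sum_sub_distrib]
  calc _ ≤ ∑ r, ‖(∑' k, c F r k) * conj (∑' k, c G r k) - ∑' k, c F r k * conj (c G r k)‖ :=
        norm_sum_le _ _
    _ ≤ ∑ r, (2 * Z * η + (Z ^ 2 + 1) * η ^ 2) * (Real.sqrt (∑' k, (w r k * ‖c F r k‖) ^ 2) *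
        Real.sqrt (∑' k, (w r k * ‖c G r k‖) ^ 2)) := Finset.sum_le_sum fun r _ => hmain r
    _ ≤ (2 * Z * η + (Z ^ 2 + 1) * η ^ 2) * (sobolevNorm σ F * sobolevNorm σ G) := by
        rw [← Finset.mul_sum]
        exact mul_le_mul_of_nonneg_left hsum (by positivity)
    _ ≤ _ := by
        refine mul_le_mul_of_nonneg_right ?_ hN
        have h2 : (0 : ℝ) < 2 ^ σ := by positivity
        -- The quadratic aliasing term is even of order M^{-2σ}; one factor is discarded because M ≥
        -- 1.
        have h3 : η ^ 2 ≤ 2 ^ σ * 2 ^ σ * (M : ℝ) ^ (-σ) := by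
          rw [hη2]
          have := mul_le_mul_of_nonneg_left hMle (mul_nonneg (mul_self_nonneg ((2 : ℝ) ^ σ)) hM0)
          nlinarith
        have h4 : 0 ≤ Z ^ 2 + 1 := by positivity
        have h5 := mul_le_mul_of_nonneg_left h3 h4
        rw [hη2] at h5 ⊢
        nlinarith

/-! ### Combs of point masses: Schur test and large sieve -/

/-- The Fourier coefficients of the measure `∑ j, J j • δ_{x j}`. -/
noncomputable def comb {N : ℕ} (x : Fin N → ℝ) (J : Fin N → ℂ) (m : ℤ) : ℂ :=
  ∑ j, J j * conj (character m (x j))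

/-- Points of the circle, listed in increasing order, with consecutive distances at least `δ`. -/
def IsSeparated {N : ℕ} (x : Fin N → ℝ) (δ : ℝ) : Prop :=
  ∀ j k : Fin N, j < k → δ * ((k : ℕ) - (j : ℕ) : ℝ) ≤ x k - x j ∧
    δ * (N - ((k : ℕ) - (j : ℕ) : ℝ)) ≤ 1 - (x k - x j)

/-- The geometric sum is at most 2 / |e^{2πiy} - 1|, and |e^{2πiy} - 1| = 2 sin πy ≥ 4 min(y, 1 - y)
by concavity of the sine. The maximum of the two reciprocals is relaxed to their sum. -/
theorem norm_sum_character_sq_le (n : ℕ) {y : ℝ} (h0 : 0 < y) (h1 : y < 1) :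
    ‖∑ l ∈ Finset.range n, character l y‖ ^ 2 ≤ 1 / 4 * (1 / y ^ 2 + 1 / (1 - y) ^ 2) := by
  have hsin : 2 * min y (1 - y) ≤ Real.sin (Real.pi * y) := by
    have hpi := Real.pi_pos
    rcases le_total y (1 / 2) with h | h
    · have h2 := Real.mul_le_sin (x := Real.pi * y) (by positivity) (by nlinarith)
      rw [min_eq_left (by linarith)]
      refine le_trans (le_of_eq ?_) h2
      field_simp
    · have h2 := Real.mul_le_sin (x := Real.pi * (1 - y))
        (mul_nonneg hpi.le (by linarith)) (by nlinarith)
      rw [min_eq_right (by linarith)]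
      have e : Real.sin (Real.pi * y) = Real.sin (Real.pi * (1 - y)) := by
        rw [← Real.sin_pi_sub]; congr 1; ring
      rw [e]
      refine le_trans (le_of_eq ?_) h2
      field_simp
  have hmin : 0 < min y (1 - y) := lt_min h0 (by linarith)
  have hnorm : ‖character 1 y - 1‖ = 2 * Real.sin (Real.pi * y) := by
    have e : character 1 y = Complex.exp (Complex.I * (2 * Real.pi * y : ℝ)) := by
      rw [character]; congr 1; push_cast; ring
    rw [e, Complex.norm_exp_I_mul_ofReal_sub_one]
    have : 2 * Real.pi * y / 2 = Real.pi * y := by ring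
    rw [this, Real.norm_eq_abs, abs_of_nonneg (by linarith)]
  have hgeom : (∑ l ∈ Finset.range n, character l y) * (character 1 y - 1)
      = character 1 y ^ n - 1 := by
    rw [← geom_sum_mul]
    congr 1
    refine Finset.sum_congr rfl fun l _ => ?_
    rw [← character_natCast_mul, character, character]
    congr 1; push_cast; ring
  have hle : ‖∑ l ∈ Finset.range n, character l y‖ * (4 * min y (1 - y)) ≤ 2 := by
    calc _ ≤ ‖∑ l ∈ Finset.range n, character l y‖ * ‖character 1 y - 1‖ := by
          rw [hnorm]; exact mul_le_mul_of_nonneg_left (by linarith) (norm_nonneg _)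
      _ = ‖character 1 y ^ n - 1‖ := by rw [← norm_mul, hgeom]
      _ ≤ ‖character 1 y ^ n‖ + ‖(1 : ℂ)‖ := norm_sub_le _ _
      _ = 2 := by rw [norm_pow]; simp; norm_num
  set D := ‖∑ l ∈ Finset.range n, character l y‖
  have hD : D ≤ 1 / (2 * min y (1 - y)) := by
    rw [le_div_iff₀ (by positivity)]; linarith
  have h3 : D ^ 2 ≤ (1 / (2 * min y (1 - y))) ^ 2 := pow_le_pow_left₀ (norm_nonneg _) hD 2
  refine h3.trans ?_
  have p1 : 0 < 1 / y ^ 2 := by positivity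
  have p2 : 0 < 1 / (1 - y) ^ 2 := by
    have : 0 < 1 - y := by linarith
    positivity
  rcases min_choice y (1 - y) with h | h <;> rw [h]
  · have : (1 / (2 * y)) ^ 2 = 1 / 4 * (1 / y ^ 2) := by field_simp; norm_num
    linarith
  · have : (1 / (2 * (1 - y))) ^ 2 = 1 / 4 * (1 / (1 - y) ^ 2) := by field_simp; norm_num
    linarith

theorem norm_sum_character_neg (n : ℕ) (y : ℝ) :
    ‖∑ l ∈ Finset.range n, character l (-y)‖ = ‖∑ l ∈ Finset.range n, character l y‖ := by
  simp only [character_neg_right, ← map_sum, RCLike.norm_conj]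

/-- The constant `¾ ∑_{i ≠ 0} i⁻²` of the Schur test for Fejér kernels. -/
noncomputable def schurConst : ℝ := 3 / 4 * ∑' i : ℤ, 1 / (i : ℝ) ^ 2

theorem schurConst_nonneg : 0 ≤ schurConst :=
  mul_nonneg (by norm_num) (tsum_nonneg fun i => by positivity)

theorem sum_one_div_sq_le {ι : Type*} (s : Finset ι) (f : ι → ℤ) (hf : Set.InjOn f s) :
    ∑ k ∈ s, 1 / (f k : ℝ) ^ 2 ≤ ∑' i : ℤ, 1 / (i : ℝ) ^ 2 := by
  classical
  have hs : Summable fun i : ℤ => 1 / (i : ℝ) ^ 2 :=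
    Real.summable_one_div_int_pow.2 (by norm_num)
  rw [← Finset.sum_image (f := fun i : ℤ => 1 / (i : ℝ) ^ 2) hf]
  exact hs.sum_le_tsum _ fun i _ => by positivity

/-- Separation bounds both arcs between the two points from below. Only one of the two wrap-around
terms is needed, depending on the order of j and k; keeping both makes the bound independent of that
order. -/
theorem norm_sum_character_sub_sq_le {N : ℕ} {x : Fin N → ℝ} {δ : ℝ} (hδ : 0 < δ)
    (hx : IsSeparated x δ) (n : ℕ) {j k : Fin N} (hjk : k ≠ j) :
    ‖∑ l ∈ Finset.range n, character l (x j - x k)‖ ^ 2 ≤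
      1 / 4 * (1 / δ ^ 2) * (1 / (((k : ℕ) - (j : ℕ) : ℤ) : ℝ) ^ 2 +
        (1 / ((N - (k : ℕ) + (j : ℕ) : ℤ) : ℝ) ^ 2 + 1 / ((N + (k : ℕ) - (j : ℕ) : ℤ) : ℝ) ^ 2)) := by
  have aux : ∀ j k : Fin N, j < k → ‖∑ l ∈ Finset.range n, character l (x k - x j)‖ ^ 2 ≤
      1 / 4 * (1 / δ ^ 2) * (1 / (((k : ℕ) - (j : ℕ) : ℤ) : ℝ) ^ 2 +
        1 / ((N - (k : ℕ) + (j : ℕ) : ℤ) : ℝ) ^ 2) := by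
    intro j k h
    obtain ⟨h1, h2⟩ := hx j k h
    have hk := k.2
    have p1 : (0 : ℝ) < (k : ℕ) - (j : ℕ) := by
      have : ((j : ℕ) : ℝ) < (k : ℕ) := by exact_mod_cast h
      linarith
    have p2 : (0 : ℝ) < N - ((k : ℕ) - (j : ℕ)) := by
      have : ((k : ℕ) : ℝ) < N := by exact_mod_cast hk
      have : (0 : ℝ) ≤ (j : ℕ) := by positivity
      linarith
    have q1 := mul_pos hδ p1
    have q2 := mul_pos hδ p2
    refine (norm_sum_character_sq_le n (y := x k - x j) (by linarith) (by linarith)).trans ?_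
    rw [mul_assoc]
    refine mul_le_mul_of_nonneg_left ?_ (by norm_num)
    rw [mul_add]
    refine add_le_add ?_ ?_
    · rw [one_div_mul_one_div, ← mul_pow]
      refine one_div_le_one_div_of_le (pow_pos (by push_cast; linarith) 2) ?_
      push_cast
      exact pow_le_pow_left₀ q1.le h1 2
    · rw [one_div_mul_one_div, ← mul_pow]
      refine one_div_le_one_div_of_le (pow_pos (by push_cast; linarith) 2) ?_
      refine pow_le_pow_left₀ (by push_cast; linarith) ?_ 2
      push_cast
      linarith
  have hnn : ∀ z : ℤ, 0 ≤ 1 / (z : ℝ) ^ 2 := fun z => by positivity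
  rcases lt_or_gt_of_ne hjk with h | h
  · refine (aux k j h).trans ?_
    refine mul_le_mul_of_nonneg_left ?_ (by positivity)
    have e1 : 1 / (((j : ℕ) - (k : ℕ) : ℤ) : ℝ) ^ 2 = 1 / (((k : ℕ) - (j : ℕ) : ℤ) : ℝ) ^ 2 := by
      congr 1; push_cast; ring
    have e2 : (N - (j : ℕ) + (k : ℕ) : ℤ) = N + (k : ℕ) - (j : ℕ) := by ring
    rw [e1, e2]
    have := hnn (N - (k : ℕ) + (j : ℕ))
    linarith
  · rw [← norm_sum_character_neg, neg_sub]
    refine (aux j k h).trans ?_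
    refine mul_le_mul_of_nonneg_left ?_ (by positivity)
    have := hnn (N + (k : ℕ) - (j : ℕ))
    linarith

/-- Row sums for the Schur test. Each of the three families of integers is injective in k, so each
is dominated by the whole series over ℤ, uniformly in N and n; this is the origin of the factor 3/4.
-/
theorem sum_norm_sum_character_sq_le {N : ℕ} {x : Fin N → ℝ} {δ : ℝ} (hδ : 0 < δ)
    (hx : IsSeparated x δ) (n : ℕ) (j : Fin N) :
    ∑ k ∈ Finset.univ.erase j, ‖∑ l ∈ Finset.range n, character l (x j - x k)‖ ^ 2 ≤
      schurConst / δ ^ 2 := by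
  refine (Finset.sum_le_sum fun k hk =>
    norm_sum_character_sub_sq_le hδ hx n (Finset.ne_of_mem_erase hk)).trans ?_
  rw [← Finset.mul_sum, Finset.sum_add_distrib, Finset.sum_add_distrib]
  have h1 := sum_one_div_sq_le (Finset.univ.erase j) (fun k : Fin N => ((k : ℕ) - (j : ℕ) : ℤ))
    (fun a _ b _ h => Fin.ext (by simp at h; omega))
  have h2 := sum_one_div_sq_le (Finset.univ.erase j)
    (fun k : Fin N => (N - (k : ℕ) + (j : ℕ) : ℤ))
    (fun a _ b _ h => Fin.ext (by simp at h; omega))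
  have h3 := sum_one_div_sq_le (Finset.univ.erase j)
    (fun k : Fin N => (N + (k : ℕ) - (j : ℕ) : ℤ))
    (fun a _ b _ h => Fin.ext (by simp at h; omega))
  calc _ ≤ 1 / 4 * (1 / δ ^ 2) * (3 * ∑' i : ℤ, 1 / (i : ℝ) ^ 2) :=
        mul_le_mul_of_nonneg_left (by linarith) (by positivity)
    _ = _ := by rw [schurConst]; ring

/-- Expanding |comb(m)|² as a double sum over masses and summing over m = l - l' first gives a
quadratic form in J whose kernel is the squared Dirichlet kernel, a multiple of Fejér's. -/
theorem sum_norm_comb_sub_sq_eq {N : ℕ} (x : Fin N → ℝ) (J : Fin N → ℂ) (n : ℕ) :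
    ∑ l ∈ Finset.range n, ∑ l' ∈ Finset.range n, ‖comb x J ((l : ℤ) - l')‖ ^ 2 =
      ∑ j, ∑ k, (J j * conj (J k)).re * ‖∑ l ∈ Finset.range n, character l (x j - x k)‖ ^ 2 := by
  have h1 : ∀ m : ℤ, ((‖comb x J m‖ ^ 2 : ℝ) : ℂ) =
      ∑ j, ∑ k, J j * conj (J k) * character m (x k - x j) := by
    intro m
    rw [← Complex.normSq_eq_norm_sq, ← Complex.mul_conj, comb, map_sum, Finset.sum_mul_sum]
    refine Finset.sum_congr rfl fun j _ => Finset.sum_congr rfl fun k _ => ?_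
    rw [sub_eq_add_neg, character_add_right, character_neg_right, map_mul, Complex.conj_conj]
    ring
  have h2 : ∀ y : ℝ, ((‖∑ l ∈ Finset.range n, character l y‖ ^ 2 : ℝ) : ℂ) =
      ∑ l ∈ Finset.range n, ∑ l' ∈ Finset.range n, character ((l : ℤ) - l') y := by
    intro y
    rw [← Complex.normSq_eq_norm_sq, ← Complex.mul_conj, map_sum, Finset.sum_mul_sum]
    refine Finset.sum_congr rfl fun j _ => Finset.sum_congr rfl fun k _ => ?_
    rw [sub_eq_add_neg, character_add_left, character_neg_left]
  have h3 : ((∑ l ∈ Finset.range n, ∑ l' ∈ Finset.range n, ‖comb x J ((l : ℤ) - l')‖ ^ 2 : ℝ) : ℂ) =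
      ∑ j, ∑ k, J j * conj (J k) *
        ((‖∑ l ∈ Finset.range n, character l (x j - x k)‖ ^ 2 : ℝ) : ℂ) := by
    rw [Complex.ofReal_sum]
    simp only [Complex.ofReal_sum, h1]
    have h2' : ∀ j k : Fin N,
        ((‖∑ l ∈ Finset.range n, character l (x j - x k)‖ ^ 2 : ℝ) : ℂ) =
        ∑ l ∈ Finset.range n, ∑ l' ∈ Finset.range n, character ((l : ℤ) - l') (x k - x j) :=
      fun j k => by rw [← norm_sum_character_neg, neg_sub, h2]
    simp only [h2', Finset.mul_sum]
    rw [Finset.sum_congr rfl fun l _ => Finset.sum_comm, Finset.sum_comm]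
    refine Finset.sum_congr rfl fun j _ => ?_
    rw [Finset.sum_congr rfl fun l _ => Finset.sum_comm, Finset.sum_comm]
  have h4 := congrArg Complex.re h3
  rw [Complex.ofReal_re] at h4
  rw [h4, Complex.re_sum]
  simp only [Complex.re_sum, Complex.re_mul_ofReal]

/-- The diagonal of the kernel is n². The rest is bounded by Schur's test: split |J_j J_k| into half
the sum of squares and use the symmetry of the kernel to reduce to row sums. -/
theorem abs_sum_norm_comb_sub_sq_sub_le {N : ℕ} {x : Fin N → ℝ} {δ : ℝ} (hδ : 0 < δ)
    (hx : IsSeparated x δ) (J : Fin N → ℂ) (n : ℕ) :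
    |∑ l ∈ Finset.range n, ∑ l' ∈ Finset.range n, ‖comb x J ((l : ℤ) - l')‖ ^ 2
      - (n : ℝ) ^ 2 * ∑ j, ‖J j‖ ^ 2| ≤ schurConst / δ ^ 2 * ∑ j, ‖J j‖ ^ 2 := by
  set A : Fin N → Fin N → ℝ := fun j k => ‖∑ l ∈ Finset.range n, character l (x j - x k)‖ ^ 2
    with hA
  have hsymm : ∀ j k, A j k = A k j := fun j k => by
    simp only [hA]; rw [← norm_sum_character_neg, neg_sub]
  have hdiag : ∀ j, A j j = (n : ℝ) ^ 2 := fun j => by simp [hA]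
  rw [sum_norm_comb_sub_sq_eq]
  have e : ∑ j, ∑ k, (J j * conj (J k)).re * A j k - (n : ℝ) ^ 2 * ∑ j, ‖J j‖ ^ 2
      = ∑ j, ∑ k ∈ Finset.univ.erase j, (J j * conj (J k)).re * A j k := by
    rw [Finset.mul_sum, ← Finset.sum_sub_distrib]
    refine Finset.sum_congr rfl fun j _ => ?_
    rw [← Finset.add_sum_erase _ _ (Finset.mem_univ j), hdiag, Complex.mul_conj,
      Complex.ofReal_re, Complex.normSq_eq_norm_sq]
    ring
  rw [e]
  have hterm : ∀ j k, |(J j * conj (J k)).re * A j k| ≤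
      1 / 2 * (‖J j‖ ^ 2 * A j k) + 1 / 2 * (‖J k‖ ^ 2 * A j k) := by
    intro j k
    have hA0 : 0 ≤ A j k := sq_nonneg _
    rw [abs_mul, abs_of_nonneg hA0]
    have h1 : |(J j * conj (J k)).re| ≤ ‖J j‖ * ‖J k‖ := by
      refine (Complex.abs_re_le_norm _).trans ?_
      rw [norm_mul, RCLike.norm_conj]
    have h2 : |(J j * conj (J k)).re| ≤ 1 / 2 * ‖J j‖ ^ 2 + 1 / 2 * ‖J k‖ ^ 2 := by
      nlinarith [sq_nonneg (‖J j‖ - ‖J k‖)]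
    nlinarith [mul_le_mul_of_nonneg_right h2 hA0]
  have hrow : ∀ j, ∑ k ∈ Finset.univ.erase j, A j k ≤ schurConst / δ ^ 2 := fun j =>
    sum_norm_sum_character_sq_le hδ hx n j
  have hswap : ∑ j, ∑ k ∈ Finset.univ.erase j, ‖J k‖ ^ 2 * A j k
      = ∑ j, ∑ k ∈ Finset.univ.erase j, ‖J j‖ ^ 2 * A j k := by
    rw [Finset.sum_comm' (t' := Finset.univ) (s' := fun k => Finset.univ.erase k)
      (fun j k => by simp [ne_comm])]
    refine Finset.sum_congr rfl fun j _ => Finset.sum_congr rfl fun k _ => ?_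
    rw [hsymm]
  calc _ ≤ ∑ j, |∑ k ∈ Finset.univ.erase j, (J j * conj (J k)).re * A j k| :=
        Finset.abs_sum_le_sum_abs _ _
    _ ≤ ∑ j, ∑ k ∈ Finset.univ.erase j, |(J j * conj (J k)).re * A j k| :=
        Finset.sum_le_sum fun j _ => Finset.abs_sum_le_sum_abs _ _
    _ ≤ ∑ j, ∑ k ∈ Finset.univ.erase j,
          (1 / 2 * (‖J j‖ ^ 2 * A j k) + 1 / 2 * (‖J k‖ ^ 2 * A j k)) :=
        Finset.sum_le_sum fun j _ => Finset.sum_le_sum fun k _ => hterm j k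
    _ = ∑ j, ‖J j‖ ^ 2 * ∑ k ∈ Finset.univ.erase j, A j k := by
        simp only [Finset.sum_add_distrib, ← Finset.mul_sum]
        rw [hswap]
        simp only [← Finset.mul_sum]
        ring
    _ ≤ ∑ j, ‖J j‖ ^ 2 * (schurConst / δ ^ 2) :=
        Finset.sum_le_sum fun j _ => mul_le_mul_of_nonneg_left (hrow j) (sq_nonneg _)
    _ = _ := by rw [← Finset.sum_mul, mul_comm]

/-- The masses of a comb are controlled by its low frequencies. -/
theorem sum_norm_sq_le_sum_comb {N : ℕ} {x : Fin N → ℝ} {δ : ℝ} (hδ : 0 < δ)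
    (hx : IsSeparated x δ) (J : Fin N → ℂ) {n : ℕ} (hn : 2 * schurConst ≤ (n * δ) ^ 2)
    (hn0 : 0 < n) :
    ∑ j, ‖J j‖ ^ 2 ≤ 2 / n * ∑ m ∈ Finset.Ioo (-(n : ℤ)) n, ‖comb x J m‖ ^ 2 := by
  have h1 := (abs_le.1 (abs_sum_norm_comb_sub_sq_sub_le hδ hx J n)).1
  have hS : 0 ≤ ∑ j, ‖J j‖ ^ 2 := Finset.sum_nonneg fun j _ => sq_nonneg _
  -- The off-diagonal part is at most half of the diagonal.
  have h2 : schurConst / δ ^ 2 ≤ (n : ℝ) ^ 2 / 2 := by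
    rw [div_le_div_iff₀ (by positivity) (by norm_num)]
    nlinarith
  -- For fixed l the differences l - l' are distinct and lie in (-n, n), so each of the n rows is at
  -- most the full low-frequency sum.
  have h3 : ∑ l ∈ Finset.range n, ∑ l' ∈ Finset.range n, ‖comb x J ((l : ℤ) - l')‖ ^ 2 ≤
      ∑ l ∈ Finset.range n, ∑ m ∈ Finset.Ioo (-(n : ℤ)) n, ‖comb x J m‖ ^ 2 := by
    refine Finset.sum_le_sum fun l hl => ?_
    have hinj : Set.InjOn (fun l' : ℕ => (l : ℤ) - l') (Finset.range n) := fun a _ b _ h => by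
      simpa using h
    rw [← Finset.sum_image (f := fun m => ‖comb x J m‖ ^ 2) hinj]
    refine Finset.sum_le_sum_of_subset_of_nonneg ?_ fun _ _ _ => sq_nonneg _
    intro m hm
    obtain ⟨l', hl', rfl⟩ := Finset.mem_image.1 hm
    simp only [Finset.mem_range, Finset.mem_Ioo] at *
    omega
  rw [Finset.sum_const, Finset.card_range, nsmul_eq_mul] at h3
  have hn' : (0 : ℝ) < n := by exact_mod_cast hn0
  rw [div_mul_eq_mul_div, le_div_iff₀ hn']
  have h4 := mul_le_mul_of_nonneg_right h2 hS
  have h5 : (n : ℝ) * ((∑ j, ‖J j‖ ^ 2) * n) ≤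
      n * (2 * ∑ m ∈ Finset.Ioo (-(n : ℤ)) n, ‖comb x J m‖ ^ 2) := by nlinarith
  exact le_of_mul_le_mul_left h5 hn'

/-- A large sieve inequality. -/
theorem sum_range_norm_comb_sq_le {N : ℕ} {x : Fin N → ℝ} {δ : ℝ} (hδ : 0 < δ)
    (hx : IsSeparated x δ) (J : Fin N → ℂ) {p : ℕ} (hp : schurConst ≤ (p * δ) ^ 2)
    (hp0 : 0 < p) (a : ℤ) :
    ∑ i ∈ Finset.range p, ‖comb x J (a + i)‖ ^ 2 ≤ 8 * p * ∑ j, ‖J j‖ ^ 2 := by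
  -- Modulating the masses moves the block of frequencies so that it starts at 0, without changing
  -- their moduli.
  set J' : Fin N → ℂ := fun j => J j * conj (character a (x j)) with hJ'
  have hc : ∀ i : ℤ, comb x J (a + i) = comb x J' i := fun i => by
    simp only [comb, hJ', character_add_left, map_mul, mul_assoc]
  have hJn : ∑ j, ‖J j‖ ^ 2 = ∑ j, ‖J' j‖ ^ 2 := by simp [hJ']
  simp only [hc, hJn]
  have h1 := (abs_le.1 (abs_sum_norm_comb_sub_sq_sub_le hδ hx J' (2 * p))).2
  have hS : 0 ≤ ∑ j, ‖J' j‖ ^ 2 := Finset.sum_nonneg fun j _ => sq_nonneg _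
  have h2 : schurConst / δ ^ 2 ≤ (p : ℝ) ^ 2 := by
    rw [div_le_iff₀ (by positivity)]
    nlinarith
  -- With length 2p each i in [0, p) is a difference l - l' at least p times, namely for l' < p and
  -- l = i + l'.
  have h3 : ∑ l' ∈ Finset.range p, ∑ i ∈ Finset.range p, ‖comb x J' i‖ ^ 2 ≤
      ∑ l ∈ Finset.range (2 * p), ∑ l' ∈ Finset.range (2 * p), ‖comb x J' ((l : ℤ) - l')‖ ^ 2 := by
    rw [Finset.sum_comm (s := Finset.range (2 * p))]
    refine (Finset.sum_le_sum (g := fun l' : ℕ => ∑ l ∈ Finset.range (2 * p),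
      ‖comb x J' ((l : ℤ) - l')‖ ^ 2) fun l' hl' => ?_).trans
      (Finset.sum_le_sum_of_subset_of_nonneg (Finset.range_mono (by omega))
        fun _ _ _ => Finset.sum_nonneg fun _ _ => sq_nonneg _)
    have hinj : Set.InjOn (fun i : ℕ => i + l') (Finset.range p) := fun a _ b _ h => by
      simpa using h
    have e : ∑ i ∈ Finset.range p, ‖comb x J' i‖ ^ 2 =
        ∑ l ∈ (Finset.range p).image fun i => i + l', ‖comb x J' ((l : ℤ) - l')‖ ^ 2 := by
      rw [Finset.sum_image hinj]
      simp
    rw [e]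
    refine Finset.sum_le_sum_of_subset_of_nonneg ?_ fun _ _ _ => sq_nonneg _
    intro m hm
    obtain ⟨i, hi, rfl⟩ := Finset.mem_image.1 hm
    simp only [Finset.mem_range] at *
    omega
  rw [Finset.sum_const, Finset.card_range, nsmul_eq_mul] at h3
  have hp' : (0 : ℝ) < p := by exact_mod_cast hp0
  have h4 := mul_le_mul_of_nonneg_right h2 hS
  push_cast at h1
  refine le_of_mul_le_mul_left ?_ hp'
  nlinarith [mul_nonneg (sq_nonneg (p : ℝ)) hS]

/-! ### Quasi-uniform meshes -/

theorem sum_succ_sub_castSucc {G : Type*} [AddCommGroup G] {N : ℕ} (f : Fin (N + 1) → G) :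
    ∑ j : Fin N, (f j.succ - f j.castSucc) = f (Fin.last N) - f 0 := by
  induction N with
  | zero => simp
  | succ N ih =>
    rw [Fin.sum_univ_castSucc]
    have h := ih fun i => f i.castSucc
    simp only [Fin.succ_castSucc, Fin.castSucc_zero] at h ⊢
    rw [h]
    simp

namespace Mesh

variable {N : ℕ} (Δ : Mesh N)

/-- The knots of the mesh in `[0,1)`. -/
def node (j : Fin N) : ℝ := Δ.pts j.castSucc

theorem gap_pos (j : Fin N) : 0 < Δ.gap j := sub_pos.2 (Δ.strictMono j.castSucc_lt_succ)

theorem sum_gap : ∑ j, Δ.gap j = 1 := by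
  simp only [gap, sum_succ_sub_castSucc, Δ.pts_zero, Δ.pts_last, sub_zero]

theorem pos {N : ℕ} (Δ : Mesh N) : 0 < N := by
  rcases Nat.eq_zero_or_pos N with h | h
  · subst h
    have := Δ.sum_gap
    simp at this
  · exact h

variable {Δ} {ρ : ℝ}

theorem IsQuasiUniform.rho_pos (h : Δ.IsQuasiUniform ρ) : 0 < ρ := by
  have h1 := h ⟨0, Δ.pos⟩ ⟨0, Δ.pos⟩
  have h2 := Δ.gap_pos ⟨0, Δ.pos⟩
  nlinarith

theorem IsQuasiUniform.gap_le (h : Δ.IsQuasiUniform ρ) (j : Fin N) : Δ.gap j ≤ ρ / N := by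
  have hN : (0 : ℝ) < N := by exact_mod_cast Δ.pos
  rw [le_div_iff₀ hN]
  have h1 := Finset.sum_le_sum fun i (_ : i ∈ Finset.univ) => h j i
  rw [← Finset.mul_sum, Δ.sum_gap, Finset.sum_const, Finset.card_univ, Fintype.card_fin,
    nsmul_eq_mul] at h1
  linarith

theorem IsQuasiUniform.le_gap (h : Δ.IsQuasiUniform ρ) (j : Fin N) : 1 / (ρ * N) ≤ Δ.gap j := by
  have hN : (0 : ℝ) < N := by exact_mod_cast Δ.pos
  have hρ := h.rho_pos
  rw [div_le_iff₀ (by positivity)]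
  have h1 := Finset.sum_le_sum fun i (_ : i ∈ Finset.univ) => h i j
  rw [Δ.sum_gap, Finset.sum_const, Finset.card_univ, Fintype.card_fin, nsmul_eq_mul] at h1
  linarith

theorem IsQuasiUniform.isSeparated (h : Δ.IsQuasiUniform ρ) :
    IsSeparated Δ.node (1 / (ρ * N)) := by
  set δ := 1 / (ρ * N)
  -- Every gap is at least δ. Comparing this sequence at 0, j, k and N gives the separation along
  -- the direct arc and along the arc through the period.
  have hmono : Monotone fun i : Fin (N + 1) => Δ.pts i - δ * ((i : ℕ) : ℝ) := by
    refine Fin.monotone_iff_le_succ.2 fun i => ?_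
    have h1 := h.le_gap i
    rw [gap] at h1
    simp only [Fin.val_castSucc, Fin.val_succ]
    push_cast
    linarith
  intro j k hjk
  have h1 := hmono (show j.castSucc ≤ k.castSucc from hjk.le)
  have h2 := hmono (Fin.zero_le j.castSucc)
  have h3 := hmono (Fin.le_last k.castSucc)
  simp only [Fin.val_castSucc, Fin.val_last, Fin.val_zero, Δ.pts_zero, Δ.pts_last] at h1 h2 h3
  push_cast at h1 h2 h3
  simp only [node]
  constructor <;> linarith

end Mesh

/-- Both comb inequalities, for quasi-uniform meshes. -/
theorem exists_comb_bounds (ρ : ℝ) : ∃ K : ℕ, 0 < K ∧ ∀ (N : ℕ) (Δ : Mesh N),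
    Δ.IsQuasiUniform ρ → ∀ (J : Fin N → ℂ) (n : ℕ), K * N ≤ n →
      (∑ j, ‖J j‖ ^ 2 ≤ 2 / n * ∑ m ∈ Finset.Ioo (-(n : ℤ)) n, ‖comb Δ.node J m‖ ^ 2) ∧
      ∀ a : ℤ, ∑ i ∈ Finset.range n, ‖comb Δ.node J (a + i)‖ ^ 2 ≤ 8 * n * ∑ j, ‖J j‖ ^ 2 := by
  -- For n ≥ K N and δ = 1 / (ρN) this gives nδ ≥ 2 `schurConst` + 1, whose square exceeds 2
  -- `schurConst`. The final 1 keeps K positive for every ρ.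
  refine ⟨⌈ρ * (2 * schurConst + 1)⌉₊ + 1, by omega, ?_⟩
  intro N Δ hΔ J n hn
  have hN : (0 : ℝ) < N := by exact_mod_cast Δ.pos
  have hρ := hΔ.rho_pos
  have hS := schurConst_nonneg
  have hn0 : 0 < n := lt_of_lt_of_le (by have := Δ.pos; positivity) hn
  have h1 : 2 * schurConst + 1 ≤ n * (1 / (ρ * N)) := by
    have h2 := Nat.le_ceil (ρ * (2 * schurConst + 1))
    have h3 : ((⌈ρ * (2 * schurConst + 1)⌉₊ : ℝ) + 1) * N ≤ n := by exact_mod_cast hn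
    rw [mul_one_div, le_div_iff₀ (by positivity)]
    nlinarith
  have h2 : 2 * schurConst ≤ (n * (1 / (ρ * N))) ^ 2 := by nlinarith
  exact ⟨sum_norm_sq_le_sum_comb (by positivity) hΔ.isSeparated J h2 hn0,
    fun a => sum_range_norm_comb_sq_le (by positivity) hΔ.isSeparated J (by linarith) hn0 a⟩

/-! ### Negative Sobolev norms of combs and their inverse estimate -/

/-- Splitting a series over `ℤ` into low and high frequencies. -/
theorem summable_and_tsum_eq_low_add_high {f : ℤ → ℝ} (n : ℕ)
    (hf : Summable fun m => if (n : ℤ) ≤ |m| then f m else 0) :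
    Summable f ∧ ∑' m, f m = ∑ m ∈ Finset.Ioo (-(n : ℤ)) n, f m +
      ∑' m, if (n : ℤ) ≤ |m| then f m else 0 := by
  have h1 : HasSum (fun m => if m ∈ Finset.Ioo (-(n : ℤ)) n then f m else 0)
      (∑ m ∈ Finset.Ioo (-(n : ℤ)) n, f m) := by
    have h := hasSum_sum_of_ne_finset_zero (L := .unconditional ℤ)
      (f := fun m => if m ∈ Finset.Ioo (-(n : ℤ)) n then f m else 0)
      (s := Finset.Ioo (-(n : ℤ)) n) (fun m hm => if_neg hm)
    rwa [Finset.sum_congr rfl fun m hm => if_pos hm] at h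
  have h2 := h1.add hf.hasSum
  have e : (fun m => (if m ∈ Finset.Ioo (-(n : ℤ)) n then f m else 0) +
      if (n : ℤ) ≤ |m| then f m else 0) = f := by
    funext m
    have h3 : m ∈ Finset.Ioo (-(n : ℤ)) n ↔ ¬ (n : ℤ) ≤ |m| := by
      rw [Finset.mem_Ioo, not_le, abs_lt]
    by_cases h4 : (n : ℤ) ≤ |m| <;> simp [h3, h4]
  rw [e] at h2
  exact ⟨h2.summable, h2.tsum_eq⟩

theorem summable_high {f : ℤ → ℝ} (hf : Summable f) (n : ℕ) :
    Summable fun m => if (n : ℤ) ≤ |m| then f m else 0 := by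
  refine (hf.indicator {m | (n : ℤ) ≤ |m|}).congr fun m => ?_
  simp [Set.indicator_apply]

/-- High frequencies of a sequence with bounded blocks of length `n`. -/
theorem tsum_high_le {t : ℝ} (ht : t < -1 / 2) {n : ℕ} (hn : 0 < n) {c : ℤ → ℂ} {B : ℝ}
    (hB : ∀ a : ℤ, ∑ i ∈ Finset.range n, ‖c (a + i)‖ ^ 2 ≤ B) :
    (Summable fun m : ℤ => if (n : ℤ) ≤ |m| then bracket m ^ (2 * t) * ‖c m‖ ^ 2 else 0) ∧
      ∑' m : ℤ, (if (n : ℤ) ≤ |m| then bracket m ^ (2 * t) * ‖c m‖ ^ 2 else 0) ≤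
        (2 ^ (-(2 * t)) * ∑' k : ℤ, bracket k ^ (2 * t)) * B * (n : ℝ) ^ (2 * t) := by
  have : NeZero n := ⟨hn.ne'⟩
  have hn' : (0 : ℝ) < n := by exact_mod_cast hn
  set f : ℤ → ℝ := fun m => if (n : ℤ) ≤ |m| then bracket m ^ (2 * t) * ‖c m‖ ^ 2 else 0 with hf
  have hf0 : ∀ m, 0 ≤ f m := fun m => by
    simp only [hf]
    split_ifs
    · exact weighted_sq_nonneg _ _ _
    · exact le_rfl
  set E := (Int.divModEquiv n).symm
  have hE : ∀ (k : ℤ) (i : Fin n), E (k, i) = k * n + (i : ℕ) := fun k i => rfl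
  have hle : ∀ (k : ℤ) (i : Fin n), f (E (k, i)) ≤
      (2 ^ (-(2 * t)) * (n : ℝ) ^ (2 * t)) * bracket k ^ (2 * t) * ‖c (k * n + (i : ℕ))‖ ^ 2 := by
    intro k i
    simp only [hf, hE]
    have hbk := bracket_pos k
    split_ifs with h
    · refine mul_le_mul_of_nonneg_right ?_ (sq_nonneg _)
      -- The cutoff enters here: i < n ≤ |kn + i|, so |k| n ≤ |kn + i| + i ≤ 2 |kn + i|.
      have h1 : bracket k * (n / 2) ≤ bracket (k * n + (i : ℕ)) := by
        have hi := i.2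
        have h2 : |k| * (n : ℤ) ≤ 2 * |k * n + (i : ℕ)| := by
          have h3 := abs_sub_abs_le_abs_sub (k * (n : ℤ)) (-((i : ℕ) : ℤ))
          rw [abs_neg, sub_neg_eq_add, abs_mul, Nat.abs_cast, Nat.abs_cast] at h3
          have : ((i : ℕ) : ℤ) < n := by exact_mod_cast hi
          linarith
        have h3 : |(k : ℝ)| * n ≤ 2 * |((k * n + (i : ℕ) : ℤ) : ℝ)| := by exact_mod_cast h2
        have h4 : (n : ℝ) ≤ |((k * n + (i : ℕ) : ℤ) : ℝ)| := by exact_mod_cast h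
        have h5 : bracket (k * n + (i : ℕ)) ≥ |((k * n + (i : ℕ) : ℤ) : ℝ)| := le_max_right _ _
        rcases max_choice 1 |(k : ℝ)| with h6 | h6 <;> rw [bracket, h6] <;> linarith
      have h2 := Real.rpow_le_rpow_of_nonpos (by positivity) h1 (by linarith : 2 * t ≤ 0)
      refine h2.trans (le_of_eq ?_)
      rw [Real.mul_rpow hbk.le (by positivity), Real.div_rpow hn'.le (by norm_num),
        Real.rpow_neg (by norm_num)]
      field_simp
    · have := Real.rpow_nonneg hbk.le (2 * t)
      positivity
  have hrow : ∀ k : ℤ, ∑' i : Fin n, f (E (k, i)) ≤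
      (2 ^ (-(2 * t)) * (n : ℝ) ^ (2 * t)) * B * bracket k ^ (2 * t) := by
    intro k
    have hbk := Real.rpow_nonneg (bracket_pos k).le (2 * t)
    rw [tsum_fintype]
    refine (Finset.sum_le_sum fun i _ => hle k i).trans ?_
    rw [← Finset.mul_sum]
    have h1 := hB (k * n)
    rw [← Fin.sum_univ_eq_sum_range (fun i => ‖c (k * n + (i : ℕ))‖ ^ 2) n] at h1
    calc _ ≤ (2 ^ (-(2 * t)) * (n : ℝ) ^ (2 * t)) * bracket k ^ (2 * t) * B :=
          mul_le_mul_of_nonneg_left h1 (by positivity)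
      _ = _ := by ring
  -- The block weights are summable because 2t < -1.
  have hsum : Summable fun k : ℤ => bracket k ^ (2 * t) := by
    simpa using summable_abs_int_rpow (s := -(2 * t)) (by linarith)
  have hs1 : Summable fun k : ℤ => ∑' i : Fin n, f (E (k, i)) :=
    Summable.of_nonneg_of_le (fun k => tsum_nonneg fun i => hf0 _) hrow (hsum.mul_left _)
  have hs : Summable fun p : ℤ × Fin n => f (E p) :=
    (summable_prod_of_nonneg fun p => hf0 _).2 ⟨fun k => Summable.of_finite, hs1⟩
  refine ⟨E.summable_iff.1 hs, ?_⟩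
  calc ∑' m, f m = ∑' k : ℤ, ∑' i : Fin n, f (E (k, i)) := by
        rw [← E.tsum_eq f]
        exact hs.tsum_prod
    _ ≤ ∑' k : ℤ, (2 ^ (-(2 * t)) * (n : ℝ) ^ (2 * t)) * B * bracket k ^ (2 * t) :=
        hs1.tsum_le_tsum hrow (hsum.mul_left _)
    _ = _ := by rw [tsum_mul_left]; ring

/-- The measure `∑ j, J j • δ_{x j}`. -/
noncomputable def combDist {N : ℕ} (x : Fin N → ℝ) (J : Fin N → ℂ) : PeriodicDistribution :=
  ⟨comb x J, 0, ∑ j, ‖J j‖, fun m => by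
    rw [pow_zero, mul_one]
    refine (norm_sum_le _ _).trans (Finset.sum_le_sum fun j _ => ?_)
    rw [norm_mul, RCLike.norm_conj, norm_character_eq_one, mul_one]⟩

@[simp] theorem coeff_combDist {N : ℕ} (x : Fin N → ℝ) (J : Fin N → ℂ) (m : ℤ) :
    coeff (combDist x J) m = comb x J m := rfl

theorem rpow_sq {x : ℝ} (hx : 0 ≤ x) (s : ℝ) : (x ^ s) ^ 2 = x ^ (2 * s) := by
  rw [← Real.rpow_natCast, ← Real.rpow_mul hx, mul_comm]
  simp

theorem bracket_le_of_mem_Ioo {n : ℕ} (hn : 0 < n) {m : ℤ} (hm : m ∈ Finset.Ioo (-(n : ℤ)) n) :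
    bracket m ≤ n := by
  rw [Finset.mem_Ioo, ← abs_lt] at hm
  exact max_le (by exact_mod_cast hn) (by exact_mod_cast hm.le)

/-- Comparison of weights at low frequencies. -/
theorem sum_low_le {r t : ℝ} (hrt : r ≤ t) {n : ℕ} (hn : 0 < n) {c : ℤ → ℂ}
    (hc : Summable fun m : ℤ => bracket m ^ (2 * r) * ‖c m‖ ^ 2) :
    ∑ m ∈ Finset.Ioo (-(n : ℤ)) n, bracket m ^ (2 * t) * ‖c m‖ ^ 2 ≤
      (n : ℝ) ^ (2 * t - 2 * r) * ∑' m : ℤ, bracket m ^ (2 * r) * ‖c m‖ ^ 2 := by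
  have hn' : (0 : ℝ) < n := by exact_mod_cast hn
  refine le_trans ?_ (mul_le_mul_of_nonneg_left (hc.sum_le_tsum (Finset.Ioo (-(n : ℤ)) n)
    fun m _ => weighted_sq_nonneg _ _ _) (by positivity))
  rw [Finset.mul_sum]
  refine Finset.sum_le_sum fun m hm => ?_
  have hb := bracket_pos m
  have h1 : bracket m ^ (2 * t) = bracket m ^ (2 * t - 2 * r) * bracket m ^ (2 * r) := by
    rw [← Real.rpow_add hb]; congr 1; ring
  rw [h1, mul_assoc]
  refine mul_le_mul_of_nonneg_right ?_ (weighted_sq_nonneg _ _ _)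
  exact Real.rpow_le_rpow hb.le (bracket_le_of_mem_Ioo hn hm) (by linarith)

/-- Combs on quasi-uniform meshes belong to `H^t`, `t < -1/2`. -/
theorem exists_sobolevNorm_combDist_le (ρ : ℝ) {t : ℝ} (ht : t < -1 / 2) :
    ∃ (K : ℕ) (C : ℝ), 0 < K ∧ 0 ≤ C ∧ ∀ (N : ℕ) (Δ : Mesh N), Δ.IsQuasiUniform ρ →
      ∀ (J : Fin N → ℂ), combDist Δ.node J ∈ sobolev t ∧
        (∑' m : ℤ, (if ((K * N : ℕ) : ℤ) ≤ |m| then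
          bracket m ^ (2 * t) * ‖comb Δ.node J m‖ ^ 2 else 0) ≤
            C * (K * N : ℝ) ^ (2 * t + 1) * ∑ j, ‖J j‖ ^ 2) ∧
        ∑ j, ‖J j‖ ^ 2 ≤ 2 / (K * N : ℝ) *
          ∑ m ∈ Finset.Ioo (-((K * N : ℕ) : ℤ)) (K * N : ℕ), ‖comb Δ.node J m‖ ^ 2 := by
  obtain ⟨K, hK, h⟩ := exists_comb_bounds ρ
  refine ⟨K, (2 ^ (-(2 * t)) * ∑' k : ℤ, bracket k ^ (2 * t)) * 8, hK, ?_, ?_⟩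
  · have : 0 ≤ ∑' k : ℤ, bracket k ^ (2 * t) :=
      tsum_nonneg fun k => Real.rpow_nonneg (bracket_pos k).le _
    positivity
  · intro N Δ hΔ J
    have hN := Δ.pos
    obtain ⟨h1, h2⟩ := h N Δ hΔ J (K * N) le_rfl
    have hKN : (0 : ℝ) < K * N := by positivity
    obtain ⟨h3, h4⟩ := tsum_high_le ht (Nat.mul_pos hK hN) h2
    refine ⟨(summable_and_tsum_eq_low_add_high _ h3).1, ?_, by exact_mod_cast h1⟩
    refine h4.trans (le_of_eq ?_)
    push_cast
    rw [Real.rpow_add hKN, Real.rpow_one]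
    ring

/-- The inverse estimate for combs. -/
theorem exists_inverse_estimate_combDist (ρ : ℝ) {r t : ℝ} (ht : t < -1 / 2) (hrt : r ≤ t) :
    ∃ C : ℝ, 0 ≤ C ∧ ∀ (N : ℕ) (Δ : Mesh N), Δ.IsQuasiUniform ρ → ∀ (J : Fin N → ℂ),
      sobolevNorm t (combDist Δ.node J) ≤ C * (N : ℝ) ^ (t - r) *
        sobolevNorm r (combDist Δ.node J) := by
  obtain ⟨K, C, hK, hC, h⟩ := exists_sobolevNorm_combDist_le ρ ht
  refine ⟨Real.sqrt (1 + 2 * C) * (K : ℝ) ^ (t - r), by positivity, ?_⟩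
  intro N Δ hΔ J
  obtain ⟨h1, h2, h3⟩ := h N Δ hΔ J
  have hN := Δ.pos
  have hn := Nat.mul_pos hK hN
  have hn' : (0 : ℝ) < K * N := by positivity
  have hr := mem_sobolev_iff.1 (sobolev_mono hrt h1)
  have hlow := sum_low_le hrt hn hr
  have hlow0 := sum_low_le (t := 0) (by linarith : r ≤ 0) hn hr
  simp only [mul_zero, Real.rpow_zero, one_mul, zero_sub] at hlow0
  obtain ⟨-, hsplit⟩ := summable_and_tsum_eq_low_add_high (K * N)
    (summable_high (mem_sobolev_iff.1 h1) (K * N))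
  rw [← sobolevNorm_sq] at hsplit
  rw [← sobolevNorm_sq] at hlow hlow0
  set S := sobolevNorm r (combDist Δ.node J) with hS
  have hcast : ((K * N : ℕ) : ℝ) = K * N := Nat.cast_mul K N
  simp only [hcast] at hlow hlow0
  -- High frequencies are controlled by the masses, and the masses by the low frequencies, where
  -- weights can be exchanged at the cost of a power of KN. So the `r`-norm controls both ranges.
  have h4 : ∑ j, ‖J j‖ ^ 2 ≤ 2 / (K * N : ℝ) * ((K * N : ℝ) ^ (-(2 * r)) * S ^ 2) :=
    h3.trans (mul_le_mul_of_nonneg_left hlow0 (by positivity))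
  have h5 : C * (K * N : ℝ) ^ (2 * t + 1) * ∑ j, ‖J j‖ ^ 2 ≤
      2 * C * (K * N : ℝ) ^ (2 * t - 2 * r) * S ^ 2 := by
    refine (mul_le_mul_of_nonneg_left h4 (by positivity)).trans (le_of_eq ?_)
    have e : (2 * t - 2 * r) = (2 * t) + (-(2 * r)) := by ring
    rw [e, Real.rpow_add hn', Real.rpow_add hn', Real.rpow_one]
    field_simp
  have h6 : sobolevNorm t (combDist Δ.node J) ^ 2 ≤
      (1 + 2 * C) * (K * N : ℝ) ^ (2 * t - 2 * r) * S ^ 2 := by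
    rw [hsplit]
    simp only [coeff_combDist] at hlow ⊢
    linarith
  have h7 : (1 + 2 * C) * (K * N : ℝ) ^ (2 * t - 2 * r) * S ^ 2 =
      (Real.sqrt (1 + 2 * C) * (K : ℝ) ^ (t - r) * (N : ℝ) ^ (t - r) * S) ^ 2 := by
    rw [mul_assoc (Real.sqrt (1 + 2 * C)), ← Real.mul_rpow (by positivity) (by positivity),
      mul_pow, mul_pow, Real.sq_sqrt (by positivity), rpow_sq hn'.le, mul_sub]
  have hS0 : 0 ≤ S := sobolevNorm_nonneg _ _
  rw [h7] at h6
  exact (pow_le_pow_iff_left₀ (sobolevNorm_nonneg _ _) (by positivity) two_ne_zero).1 h6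

/-! ### Sampling inequalities on the mesh -/

theorem hasDerivAt_character (m : ℤ) (t : ℝ) :
    HasDerivAt (character m) (2 * Real.pi * Complex.I * m * character m t) t := by
  have h1 : HasDerivAt (fun t : ℝ => 2 * Real.pi * Complex.I * m * (t : ℂ))
      (2 * Real.pi * Complex.I * m * 1) t :=
    (Complex.ofRealCLM.hasDerivAt (x := t)).const_mul _
  have h2 := h1.cexp
  exact h2.congr_deriv (by rw [character]; ring)

theorem continuous_character (m : ℤ) : Continuous (character m) :=
  continuous_iff_continuousAt.2 fun t => (hasDerivAt_character m t).continuousAt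

theorem integral_character (m : ℤ) :
    ∫ t in (0 : ℝ)..1, character m t = if m = 0 then 1 else 0 := by
  split_ifs with h
  · simp [h]
  · have hc : 2 * Real.pi * Complex.I * m ≠ 0 :=
      mul_ne_zero Complex.two_pi_I_ne_zero (by exact_mod_cast h)
    have h1 := integral_exp_mul_complex (a := 0) (b := 1) hc
    simp only [character]
    rw [h1]
    have h2 := character_int m 1
    simp only [character] at h2
    rw [div_eq_zero_iff]
    left
    rw [Complex.ofReal_zero, mul_zero, Complex.exp_zero, sub_eq_zero]
    simpa using h2

/-- Parseval's identity for trigonometric polynomials. -/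
theorem integral_norm_sq_trigonometric (s : Finset ℤ) (c : ℤ → ℂ) :
    ∫ t in (0 : ℝ)..1, ‖∑ m ∈ s, c m * character m t‖ ^ 2 = ∑ m ∈ s, ‖c m‖ ^ 2 := by
  have h1 : ∀ t : ℝ, ((‖∑ m ∈ s, c m * character m t‖ ^ 2 : ℝ) : ℂ) =
      ∑ m ∈ s, ∑ n ∈ s, c m * conj (c n) * character (m - n) t := by
    intro t
    rw [← Complex.normSq_eq_norm_sq, ← Complex.mul_conj, map_sum, Finset.sum_mul_sum]
    refine Finset.sum_congr rfl fun m _ => Finset.sum_congr rfl fun n _ => ?_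
    rw [sub_eq_add_neg, character_add_left, character_neg_left, map_mul]
    ring
  have hc := continuous_character
  have h2 : ((∫ t in (0 : ℝ)..1, ‖∑ m ∈ s, c m * character m t‖ ^ 2 : ℝ) : ℂ) =
      ∑ m ∈ s, ((‖c m‖ ^ 2 : ℝ) : ℂ) := by
    rw [← intervalIntegral.integral_ofReal]
    simp only [h1]
    have hi : ∀ m n, IntervalIntegrable (fun t => c m * conj (c n) * character (m - n) t)
        MeasureTheory.volume 0 1 := fun m n =>
      (continuous_const.mul (hc (m - n))).intervalIntegrable _ _
    have hj : ∀ m, IntervalIntegrable (fun t => ∑ n ∈ s, c m * conj (c n) * character (m - n) t)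
        MeasureTheory.volume 0 1 := fun m =>
      (continuous_finsetSum s fun n _ =>
        continuous_const.mul (hc (m - n))).intervalIntegrable _ _
    rw [intervalIntegral.integral_finsetSum fun m _ => hj m]
    refine Finset.sum_congr rfl fun m hm => ?_
    rw [intervalIntegral.integral_finsetSum fun n _ => hi m n]
    simp only [intervalIntegral.integral_const_mul, integral_character]
    rw [Finset.sum_eq_single m]
    · rw [sub_self, if_pos rfl, mul_one, Complex.mul_conj, Complex.normSq_eq_norm_sq]
    · intro n _ hn
      rw [if_neg (sub_ne_zero.2 hn.symm), mul_zero]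
    · exact fun h => absurd hm h
  rw [← Complex.ofReal_sum] at h2
  exact_mod_cast h2

/-- Expand the non-negative integral of ((b - a) f - ∫f)². -/
theorem sq_integral_le {f : ℝ → ℝ} (hf : Continuous f) {a b : ℝ} (hab : a ≤ b) :
    (∫ t in a..b, f t) ^ 2 ≤ (b - a) * ∫ t in a..b, f t ^ 2 := by
  rcases hab.eq_or_lt with rfl | hlt
  · simp
  set I := ∫ t in a..b, f t with hI
  have hba : 0 < b - a := by linarith
  have h0 : 0 ≤ ∫ t in a..b, ((b - a) * f t - I) ^ 2 :=
    intervalIntegral.integral_nonneg hab fun t _ => sq_nonneg _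
  have e : ∀ t, ((b - a) * f t - I) ^ 2 =
      (b - a) ^ 2 * f t ^ 2 - 2 * (b - a) * I * f t + I ^ 2 := fun t => by ring
  have i1 : IntervalIntegrable (fun t => (b - a) ^ 2 * f t ^ 2) MeasureTheory.volume a b :=
    (by fun_prop : Continuous fun t => (b - a) ^ 2 * f t ^ 2).intervalIntegrable _ _
  have i2 : IntervalIntegrable (fun t => 2 * (b - a) * I * f t) MeasureTheory.volume a b :=
    (by fun_prop : Continuous fun t => 2 * (b - a) * I * f t).intervalIntegrable _ _
  simp only [e] at h0
  rw [intervalIntegral.integral_add (i1.sub i2) intervalIntegrable_const,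
    intervalIntegral.integral_sub i1 i2, intervalIntegral.integral_const_mul,
    intervalIntegral.integral_const_mul, intervalIntegral.integral_const, ← hI, smul_eq_mul] at h0
  refine le_of_mul_le_mul_left ?_ hba
  nlinarith

/-- Write P(t) = P(a) + ∫ P' and apply Cauchy–Schwarz: on a short interval a function is controlled
by its left endpoint value and a small multiple of its derivative. -/
theorem integral_norm_sq_le {P P' : ℝ → ℂ} (hP : ∀ t, HasDerivAt P (P' t) t) (hP' : Continuous P')
    {a b : ℝ} (hab : a ≤ b) :
    ∫ t in a..b, ‖P t‖ ^ 2 ≤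
      2 * (b - a) * ‖P a‖ ^ 2 + 2 * (b - a) ^ 2 * ∫ t in a..b, ‖P' t‖ ^ 2 := by
  have hPc : Continuous P := continuous_iff_continuousAt.2 fun t => (hP t).continuousAt
  set I := ∫ t in a..b, ‖P' t‖ ^ 2 with hI
  have hpt : ∀ t ∈ Set.Icc a b, ‖P t‖ ^ 2 ≤ 2 * ‖P a‖ ^ 2 + 2 * ((b - a) * I) := by
    intro t ht
    have h1 : ∫ s in a..t, P' s = P t - P a :=
      intervalIntegral.integral_eq_sub_of_hasDerivAt (fun s _ => hP s)
        (hP'.intervalIntegrable _ _)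
    have h2 : ‖P t - P a‖ ≤ ∫ s in a..b, ‖P' s‖ := by
      rw [← h1]
      refine (intervalIntegral.norm_integral_le_integral_norm ht.1).trans ?_
      exact intervalIntegral.integral_mono_interval (μ := MeasureTheory.volume) le_rfl ht.1 ht.2
        (Filter.Eventually.of_forall fun s => norm_nonneg _) (hP'.norm.intervalIntegrable _ _)
    have h3 : ‖P t - P a‖ ^ 2 ≤ (b - a) * I :=
      (pow_le_pow_left₀ (norm_nonneg _) h2 2).trans (sq_integral_le hP'.norm hab)
    have h4 : ‖P t‖ ≤ ‖P a‖ + ‖P t - P a‖ := by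
      have := norm_add_le (P a) (P t - P a)
      rwa [add_sub_cancel] at this
    nlinarith [norm_nonneg (P t), sq_nonneg (‖P a‖ - ‖P t - P a‖)]
  have h5 := intervalIntegral.integral_mono_on (μ := MeasureTheory.volume) hab
    ((hPc.norm.pow 2).intervalIntegrable a b)
    intervalIntegrable_const hpt
  rw [intervalIntegral.integral_const, smul_eq_mul] at h5
  refine h5.trans (le_of_eq ?_)
  ring

theorem Mesh.sum_integral {N : ℕ} (Δ : Mesh N) {f : ℝ → ℝ} (hf : Continuous f) :
    ∑ j : Fin N, ∫ t in Δ.pts j.castSucc..Δ.pts j.succ, f t = ∫ t in (0 : ℝ)..1, f t := by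
  have h := sum_succ_sub_castSucc fun i => ∫ t in (0 : ℝ)..Δ.pts i, f t
  rw [Δ.pts_zero, Δ.pts_last, intervalIntegral.integral_same, sub_zero] at h
  rw [← h]
  refine Finset.sum_congr rfl fun j _ => ?_
  rw [intervalIntegral.integral_interval_sub_left (hf.intervalIntegrable _ _)
    (hf.intervalIntegrable _ _)]

/-- A Marcinkiewicz–Zygmund inequality. -/
theorem sum_norm_sq_le_sum_samples {N : ℕ} (Δ : Mesh N) {h L : ℝ} (hgap : ∀ j, Δ.gap j ≤ h)
    (hhL : 2 * h ^ 2 * (2 * Real.pi * L) ^ 2 ≤ 1 / 2) (s : Finset ℤ)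
    (hs : ∀ m ∈ s, |(m : ℝ)| ≤ L) (c : ℤ → ℂ) :
    ∑ m ∈ s, ‖c m‖ ^ 2 ≤ 4 * h * ∑ j, ‖∑ m ∈ s, c m * character m (Δ.node j)‖ ^ 2 := by
  set P : ℝ → ℂ := fun t => ∑ m ∈ s, c m * character m t with hP
  set P' : ℝ → ℂ := fun t => ∑ m ∈ s, (c m * (2 * Real.pi * Complex.I * m)) * character m t
    with hP'
  have hd : ∀ t, HasDerivAt P (P' t) t := fun t => by
    simp only [hP']
    refine HasDerivAt.fun_sum fun m _ => ?_
    rw [mul_assoc]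
    exact (hasDerivAt_character m t).const_mul _
  have hc := continuous_character
  have hPc : Continuous P := by fun_prop
  have hPc' : Continuous P' := by fun_prop
  have h1 : ∫ t in (0 : ℝ)..1, ‖P t‖ ^ 2 = ∑ m ∈ s, ‖c m‖ ^ 2 :=
    integral_norm_sq_trigonometric s c
  -- Bernstein's inequality, read off from Parseval's identity; `hhL` later lets half of the
  -- left-hand side absorb the derivative term.
  have h2 : ∫ t in (0 : ℝ)..1, ‖P' t‖ ^ 2 ≤ (2 * Real.pi * L) ^ 2 * ∑ m ∈ s, ‖c m‖ ^ 2 := by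
    simp only [hP']
    rw [integral_norm_sq_trigonometric, Finset.mul_sum]
    refine Finset.sum_le_sum fun m hm => ?_
    rw [norm_mul, mul_pow, mul_comm]
    refine mul_le_mul_of_nonneg_right (pow_le_pow_left₀ (norm_nonneg _) ?_ 2) (sq_nonneg _)
    have := hs m hm
    have hpi := Real.pi_pos
    simp only [norm_mul, Complex.norm_I, Complex.norm_ofNat, Complex.norm_real, Complex.norm_intCast,
      Real.norm_eq_abs, abs_of_pos hpi, mul_one]
    gcongr
  have hgap0 : ∀ j, 0 ≤ Δ.gap j := fun j => (Δ.gap_pos j).le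
  have hh : 0 ≤ h := (hgap0 ⟨0, Δ.pos⟩).trans (hgap _)
  have h3 : ∫ t in (0 : ℝ)..1, ‖P t‖ ^ 2 ≤
      2 * h * ∑ j, ‖P (Δ.node j)‖ ^ 2 + 2 * h ^ 2 * ∫ t in (0 : ℝ)..1, ‖P' t‖ ^ 2 := by
    rw [← Δ.sum_integral (f := fun t => ‖P t‖ ^ 2) (hPc.norm.pow 2),
      ← Δ.sum_integral (f := fun t => ‖P' t‖ ^ 2) (hPc'.norm.pow 2), Finset.mul_sum,
      Finset.mul_sum, ← Finset.sum_add_distrib]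
    refine Finset.sum_le_sum fun j _ => ?_
    have hle : Δ.pts j.castSucc ≤ Δ.pts j.succ := by
      have := hgap0 j
      rw [Mesh.gap] at this
      linarith
    refine (integral_norm_sq_le hd hPc' hle).trans ?_
    have hI : 0 ≤ ∫ t in Δ.pts j.castSucc..Δ.pts j.succ, ‖P' t‖ ^ 2 :=
      intervalIntegral.integral_nonneg hle fun t _ => sq_nonneg _
    have := hgap j
    have := hgap0 j
    change 2 * Δ.gap j * ‖P (Δ.node j)‖ ^ 2 + 2 * Δ.gap j ^ 2 * _ ≤ _
    gcongr
  have h4 : 0 ≤ ∑ m ∈ s, ‖c m‖ ^ 2 := Finset.sum_nonneg fun _ _ => sq_nonneg _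
  rw [h1] at h3
  have h5 := mul_le_mul_of_nonneg_left h2 (by positivity : 0 ≤ 2 * h ^ 2)
  have h6 := mul_le_mul_of_nonneg_right hhL h4
  change _ ≤ 4 * h * ∑ j, ‖P (Δ.node j)‖ ^ 2
  nlinarith

/-- The frequencies of modulus at least `n`. -/
noncomputable def highPart (n : ℕ) (g : PeriodicDistribution) : PeriodicDistribution :=
  ⟨fun m => if (n : ℤ) ≤ |m| then coeff g m else 0, by
    obtain ⟨k, C, h⟩ := g.2
    refine ⟨k, |C|, fun m => ?_⟩
    have h0 : 0 ≤ bracket m ^ k := pow_nonneg (bracket_pos m).le _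
    beta_reduce
    split_ifs
    · exact (h m).trans (mul_le_mul_of_nonneg_right (le_abs_self C) h0)
    · simp only [norm_zero]
      positivity⟩

theorem coeff_highPart (n : ℕ) (g : PeriodicDistribution) (m : ℤ) :
    coeff (highPart n g) m = if (n : ℤ) ≤ |m| then coeff g m else 0 := rfl

theorem highPart_mem_sobolev (n : ℕ) {s : ℝ} {g : PeriodicDistribution} (hg : g ∈ sobolev s) :
    highPart n g ∈ sobolev s := by
  rw [mem_sobolev_iff] at hg ⊢
  refine (summable_high hg n).congr fun m => ?_
  rw [coeff_highPart]
  split_ifs <;> simp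

theorem sobolevNorm_highPart_sq (n : ℕ) (s : ℝ) (g : PeriodicDistribution) :
    sobolevNorm s (highPart n g) ^ 2 =
      ∑' m : ℤ, if (n : ℤ) ≤ |m| then bracket m ^ (2 * s) * ‖coeff g m‖ ^ 2 else 0 := by
  rw [sobolevNorm_sq]
  refine tsum_congr fun m => ?_
  rw [coeff_highPart]
  split_ifs <;> simp

theorem sobolevNorm_highPart_le {n : ℕ} (hn : 0 < n) {s t : ℝ} (hst : s ≤ t)
    {g : PeriodicDistribution} (hg : g ∈ sobolev t) :
    sobolevNorm s (highPart n g) ^ 2 ≤ (n : ℝ) ^ (2 * s - 2 * t) * sobolevNorm t g ^ 2 := by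
  have hn' : (0 : ℝ) < n := by exact_mod_cast hn
  have h0 := mem_sobolev_iff.1 (sobolev_mono hst hg)
  rw [sobolevNorm_highPart_sq, sobolevNorm_sq, ← tsum_mul_left]
  refine (summable_high h0 n).tsum_le_tsum (fun m => ?_) ((mem_sobolev_iff.1 hg).mul_left _)
  split_ifs with h
  · have hb := bracket_pos m
    have h1 : bracket m ^ (2 * s) = bracket m ^ (2 * s - 2 * t) * bracket m ^ (2 * t) := by
      rw [← Real.rpow_add hb]; congr 1; ring
    rw [h1, mul_assoc]
    refine mul_le_mul_of_nonneg_right ?_ (weighted_sq_nonneg _ _ _)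
    refine Real.rpow_le_rpow_of_nonpos hn' ?_ (by linarith)
    refine le_trans ?_ (le_max_right _ _)
    exact_mod_cast h
  · exact mul_nonneg (by positivity) (weighted_sq_nonneg _ _ _)

theorem pointValue_eq_low_add_high {s : ℝ} (hs : 1 / 2 < s) {g : PeriodicDistribution}
    (hg : g ∈ sobolev s) (n : ℕ) (x : ℝ) :
    pointValue g x = ∑ m ∈ Finset.Ioo (-(n : ℤ)) n, coeff g m * character m x +
      pointValue (highPart n g) x := by
  have h1 : HasSum (fun m => if m ∈ Finset.Ioo (-(n : ℤ)) n then coeff g m * character m x else 0)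
      (∑ m ∈ Finset.Ioo (-(n : ℤ)) n, coeff g m * character m x) := by
    have h := hasSum_sum_of_ne_finset_zero (L := .unconditional ℤ)
      (f := fun m => if m ∈ Finset.Ioo (-(n : ℤ)) n then coeff g m * character m x else 0)
      (s := Finset.Ioo (-(n : ℤ)) n) (fun m hm => if_neg hm)
    rwa [Finset.sum_congr rfl fun m hm => if_pos hm] at h
  have h2 := h1.add (summable_pointValue hs (highPart_mem_sobolev n hg) x).hasSum
  rw [pointValue_eq, pointValue, ← h2.tsum_eq]
  refine tsum_congr fun m => ?_
  have h3 : m ∈ Finset.Ioo (-(n : ℤ)) n ↔ ¬ (n : ℤ) ≤ |m| := by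
    rw [Finset.mem_Ioo, not_le, abs_lt]
  rw [coeff_highPart]
  by_cases h4 : (n : ℤ) ≤ |m| <;> simp [h3, h4, character]

/-- The pairing of a comb with a continuous function. -/
theorem sum_conj_mul_pointValue {N : ℕ} (x : Fin N → ℝ) (J : Fin N → ℂ) {s : ℝ} (hs : 1 / 2 < s)
    {g : PeriodicDistribution} (hg : g ∈ sobolev s) :
    ∑ j, conj (J j) * pointValue g (x j) = ∑' m, coeff g m * conj (comb x J m) := by
  have h : ∀ j, Summable fun m : ℤ => conj (J j) * (coeff g m * character m (x j)) := fun j =>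
    (summable_pointValue hs hg (x j)).mul_left _
  simp only [pointValue_eq, ← tsum_mul_left]
  rw [← Summable.tsum_finsetSum fun j _ => h j]
  refine tsum_congr fun m => ?_
  rw [comb, map_sum, Finset.mul_sum]
  refine Finset.sum_congr rfl fun j _ => ?_
  rw [map_mul, Complex.conj_conj]
  ring

theorem one_le_rho {ρ : ℝ} {N : ℕ} {Δ : Mesh N} (h : Δ.IsQuasiUniform ρ) : 1 ≤ ρ := by
  have h1 := h ⟨0, Δ.pos⟩ ⟨0, Δ.pos⟩
  have h2 := Δ.gap_pos ⟨0, Δ.pos⟩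
  exact le_of_mul_le_mul_right (by linarith) h2

/-- Samples of high-frequency functions. -/
theorem exists_sum_samples_highPart_le (ρ : ℝ) {γ : ℝ} (hγ : 1 / 2 < γ) :
    ∃ C : ℝ, 0 ≤ C ∧ ∀ (N : ℕ) (Δ : Mesh N), Δ.IsQuasiUniform ρ → ∀ n : ℕ, 0 < n → n ≤ N →
      ∀ g ∈ sobolev γ, ∑ j, ‖pointValue (highPart n g) (Δ.node j)‖ ^ 2 ≤
        C * N * (n : ℝ) ^ (-(2 * γ)) * sobolevNorm γ g ^ 2 := by
  obtain ⟨K, hK, hcomb⟩ := exists_comb_bounds ρ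
  set Z := 2 ^ (-(2 * (-γ))) * ∑' k : ℤ, bracket k ^ (2 * (-γ)) with hZ
  have hZ0 : 0 ≤ Z := by
    have : 0 ≤ ∑' k : ℤ, bracket k ^ (2 * (-γ)) :=
      tsum_nonneg fun k => Real.rpow_nonneg (bracket_pos k).le _
    positivity
  refine ⟨Z * (8 * K), by positivity, ?_⟩
  intro N Δ hΔ n hn hnN g hg
  -- The samples themselves are used as masses, so that the pairing of this comb with the high part
  -- of g is the sum T of their squares. The large sieve bounds the dual norm of the comb by a
  -- multiple of √T, and dividing by √T bounds T.
  set R : Fin N → ℂ := fun j => pointValue (highPart n g) (Δ.node j) with hR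
  set T := ∑ j, ‖R j‖ ^ 2 with hT
  have hT0 : 0 ≤ T := Finset.sum_nonneg fun _ _ => sq_nonneg _
  have hblock : ∀ a : ℤ, ∑ i ∈ Finset.range n, ‖comb Δ.node R (a + i)‖ ^ 2 ≤ 8 * (K * N) * T := by
    intro a
    have h := (hcomb N Δ hΔ R (K * N) le_rfl).2 a
    push_cast at h
    -- A block of length n ≤ N sits inside one of length K N, where the large sieve applies.
    refine le_trans (Finset.sum_le_sum_of_subset_of_nonneg (Finset.range_mono ?_)
      fun _ _ _ => sq_nonneg _) h
    exact hnN.trans (Nat.le_mul_of_pos_left N hK)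
  obtain ⟨hs, hle⟩ := tsum_high_le (t := -γ) (by linarith) hn hblock
  set H := sobolevNorm γ (highPart n g) with hH
  have hgh := highPart_mem_sobolev n hg
  -- duality
  have hTc : (T : ℂ) = ∑' m, coeff (highPart n g) m * conj (comb Δ.node R m) := by
    rw [← sum_conj_mul_pointValue _ _ hγ hgh, hT, Complex.ofReal_sum]
    refine Finset.sum_congr rfl fun j _ => ?_
    rw [mul_comm, Complex.mul_conj, Complex.normSq_eq_norm_sq]
  set b : ℤ → ℝ := fun m => if (n : ℤ) ≤ |m| then bracket m ^ (-γ) * ‖comb Δ.node R m‖ else 0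
    with hb
  have hb2 : ∀ m, b m ^ 2 =
      if (n : ℤ) ≤ |m| then bracket m ^ (2 * (-γ)) * ‖comb Δ.node R m‖ ^ 2 else 0 := fun m => by
    simp only [hb]
    split_ifs
    · rw [weighted_sq]
    · simp
  have hb0 : ∀ m, 0 ≤ b m := fun m => by
    simp only [hb]
    split_ifs
    · exact mul_nonneg (Real.rpow_nonneg (bracket_pos m).le _) (norm_nonneg _)
    · exact le_rfl
  have hcs := summable_mul_and_tsum_mul_le
    (a := fun m => bracket m ^ γ * ‖coeff (highPart n g) m‖) (b := b)
    (fun m => mul_nonneg (Real.rpow_nonneg (bracket_pos m).le _) (norm_nonneg _)) hb0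
    ((mem_sobolev_iff.1 hgh).congr fun m => weighted_sq _ _ _)
    (hs.congr fun m => (hb2 m).symm)
  simp only [hb2, ← weighted_sq] at hcs
  have hterm : ∀ m, ‖coeff (highPart n g) m * conj (comb Δ.node R m)‖ =
      bracket m ^ γ * ‖coeff (highPart n g) m‖ * b m := by
    intro m
    simp only [hb, coeff_highPart, norm_mul, RCLike.norm_conj]
    split_ifs
    · have := rpow_neg_mul_rpow γ m
      linear_combination (-(‖coeff g m‖ * ‖comb Δ.node R m‖)) * this
    · simp
  have h1 : T ≤ H * Real.sqrt (Z * (8 * (K * N) * T) * (n : ℝ) ^ (2 * (-γ))) := by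
    have h2 : ‖(T : ℂ)‖ ≤ ∑' m, bracket m ^ γ * ‖coeff (highPart n g) m‖ * b m := by
      rw [hTc]
      refine (norm_tsum_le_tsum_norm ?_).trans (le_of_eq (tsum_congr hterm))
      exact hcs.1.congr fun m => (hterm m).symm
    rw [Complex.norm_real, Real.norm_of_nonneg hT0] at h2
    refine h2.trans (hcs.2.trans ?_)
    exact mul_le_mul_of_nonneg_left (Real.sqrt_le_sqrt hle) (Real.sqrt_nonneg _)
  have hH0 : 0 ≤ H := sobolevNorm_nonneg _ _
  have hX : 0 ≤ Z * (8 * (K * N) * T) * (n : ℝ) ^ (2 * (-γ)) := by positivity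
  have h2 : T ^ 2 ≤ H ^ 2 * (Z * (8 * (K * N) * T) * (n : ℝ) ^ (2 * (-γ))) := by
    have h3 := pow_le_pow_left₀ hT0 h1 2
    rwa [mul_pow, Real.sq_sqrt hX] at h3
  have hHle : H ^ 2 ≤ sobolevNorm γ g ^ 2 := by
    have := sobolevNorm_highPart_le hn le_rfl hg
    simpa using this
  have e : (2 * (-γ)) = -(2 * γ) := by ring
  rw [e] at h2
  have h4 : T ≤ H ^ 2 * (Z * (8 * K) * N * (n : ℝ) ^ (-(2 * γ))) := by
    rcases hT0.eq_or_lt with h0 | hpos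
    · rw [← h0]; positivity
    · refine le_of_mul_le_mul_right ?_ hpos
      nlinarith
  calc T ≤ H ^ 2 * (Z * (8 * K) * N * (n : ℝ) ^ (-(2 * γ))) := h4
    _ ≤ sobolevNorm γ g ^ 2 * (Z * (8 * K) * N * (n : ℝ) ^ (-(2 * γ))) :=
        mul_le_mul_of_nonneg_right hHle (by positivity)
    _ = _ := by ring

/-- A sampling inequality: functions which are constant on the mesh are almost constant. -/
theorem exists_sampling_inequality (ρ : ℝ) {γ : ℝ} (hγ : 1 / 2 < γ) :
    ∃ C : ℝ, 0 ≤ C ∧ ∀ (N : ℕ) (Δ : Mesh N), Δ.IsQuasiUniform ρ → ∀ g ∈ sobolev γ, ∀ κ : ℂ,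
      (∀ j, pointValue g (Δ.node j) = κ) →
        ∑' m : ℤ, (if m = 0 then 0 else ‖coeff g m‖ ^ 2) ≤
          C * (N : ℝ) ^ (-(2 * γ)) * sobolevNorm γ g ^ 2 := by
  obtain ⟨C, hC, h⟩ := exists_sum_samples_highPart_le ρ hγ
  -- With gaps at most ρ/N and frequencies at most cN, the smallness condition of the
  -- Marcinkiewicz–Zygmund inequality holds with equality.
  set c : ℝ := 1 / (4 * Real.pi * ρ) with hc
  -- Absolute values make the constant non-negative before a mesh is at hand to force ρ ≥ 1.
  refine ⟨(4 * |ρ| * C + 1) * |c| ^ (-(2 * γ)), by positivity, ?_⟩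
  intro N Δ hΔ g hg κ hκ
  have hN : (0 : ℝ) < N := by exact_mod_cast Δ.pos
  have hρ := one_le_rho hΔ
  have hpi := Real.pi_gt_three
  have hc0 : 0 < c := by rw [hc]; positivity
  have hc1 : c < 1 := by
    rw [hc, div_lt_one (by positivity)]
    nlinarith
  rw [abs_of_pos hc0, abs_of_pos (by linarith : 0 < ρ)]
  -- Frequencies strictly below n are at most cN, while n itself is at least cN and, since c < 1, at
  -- most N.
  set n : ℕ := ⌊c * N⌋₊ + 1 with hn
  have hn0 : 0 < n := by omega
  have hnN : n ≤ N := by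
    have h1 : c * N < N := by nlinarith
    have h2 : ⌊c * N⌋₊ < N := (Nat.floor_lt (by positivity)).2 h1
    omega
  have hnc : c * N ≤ n := by
    rw [hn]
    push_cast
    exact (Nat.lt_floor_add_one (c * N)).le
  have hpow : (n : ℝ) ^ (-(2 * γ)) ≤ c ^ (-(2 * γ)) * (N : ℝ) ^ (-(2 * γ)) := by
    rw [← Real.mul_rpow hc0.le hN.le]
    exact Real.rpow_le_rpow_of_nonpos (by positivity) hnc (by linarith)
  -- Once κ is removed from the mean, the low part equals minus the high part at every knot, and the
  -- high part has small samples.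
  set a : ℤ → ℂ := fun m => coeff g m - if m = 0 then κ else 0 with ha
  have hlowsum : ∀ j, ∑ m ∈ Finset.Ioo (-(n : ℤ)) n, a m * character m (Δ.node j) =
      -pointValue (highPart n g) (Δ.node j) := by
    intro j
    have h1 := pointValue_eq_low_add_high hγ hg n (Δ.node j)
    rw [hκ j] at h1
    simp only [ha, sub_mul, Finset.sum_sub_distrib, ite_mul, zero_mul]
    have h0 : (0 : ℤ) ∈ Finset.Ioo (-(n : ℤ)) n := by rw [Finset.mem_Ioo]; omega
    rw [Finset.sum_ite_eq' (Finset.Ioo (-(n : ℤ)) n) (0 : ℤ), if_pos h0, character_zero_left]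
    linear_combination -h1
  have hlow : ∑ m ∈ Finset.Ioo (-(n : ℤ)) n, ‖a m‖ ^ 2 ≤
      4 * (ρ / N) * (C * N * (n : ℝ) ^ (-(2 * γ)) * sobolevNorm γ g ^ 2) := by
    have h1 := sum_norm_sq_le_sum_samples Δ (h := ρ / N) (L := c * N) (fun j => hΔ.gap_le j)
      (by
        rw [hc]
        apply le_of_eq
        field_simp
        norm_num) (Finset.Ioo (-(n : ℤ)) n) (fun m hm => by
        rw [Finset.mem_Ioo, ← abs_lt] at hm
        have h2 : |m| ≤ (⌊c * N⌋₊ : ℤ) := by omega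
        have h3 : |(m : ℝ)| ≤ (⌊c * N⌋₊ : ℝ) := by exact_mod_cast h2
        exact h3.trans (Nat.floor_le (by positivity))) a
    simp only [hlowsum, norm_neg] at h1
    exact h1.trans (mul_le_mul_of_nonneg_left (h N Δ hΔ n hn0 hnN g hg) (by positivity))
  have hhigh := sobolevNorm_highPart_le hn0 (by linarith : 0 ≤ γ) hg
  rw [sobolevNorm_highPart_sq] at hhigh
  simp only [mul_zero, Real.rpow_zero, one_mul, zero_sub] at hhigh
  have hg0 : Summable fun m => ‖coeff g m‖ ^ 2 := by
    have := mem_sobolev_iff.1 (sobolev_mono (by linarith : 0 ≤ γ) hg)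
    simpa using this
  have hs1 : Summable fun m : ℤ => if m = 0 then 0 else ‖coeff g m‖ ^ 2 :=
    Summable.of_nonneg_of_le (fun m => by split_ifs <;> positivity)
      (fun m => by split_ifs <;> [positivity; exact le_rfl]) hg0
  obtain ⟨-, hsplit⟩ := summable_and_tsum_eq_low_add_high n (summable_high hs1 n)
  rw [hsplit]
  have h5 : ∑ m ∈ Finset.Ioo (-(n : ℤ)) n, (if m = 0 then 0 else ‖coeff g m‖ ^ 2) ≤
      ∑ m ∈ Finset.Ioo (-(n : ℤ)) n, ‖a m‖ ^ 2 := by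
    refine Finset.sum_le_sum fun m _ => ?_
    by_cases hm : m = 0
    · rw [if_pos hm]; positivity
    · simp [ha, hm]
  have h6 : ∑' m : ℤ, (if (n : ℤ) ≤ |m| then (if m = 0 then 0 else ‖coeff g m‖ ^ 2) else 0) ≤
      ∑' m : ℤ, (if (n : ℤ) ≤ |m| then ‖coeff g m‖ ^ 2 else 0) := by
    refine (summable_high hs1 n).tsum_le_tsum (fun m => ?_) (summable_high hg0 n)
    split_ifs <;> first | exact le_rfl | positivity
  have hS := sq_nonneg (sobolevNorm γ g)
  calc _ ≤ 4 * (ρ / N) * (C * N * (n : ℝ) ^ (-(2 * γ)) * sobolevNorm γ g ^ 2) +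
        (n : ℝ) ^ (-(2 * γ)) * sobolevNorm γ g ^ 2 :=
        add_le_add (h5.trans hlow) (h6.trans hhigh)
    _ = (4 * ρ * C + 1) * (n : ℝ) ^ (-(2 * γ)) * sobolevNorm γ g ^ 2 := by
        field_simp
    _ ≤ (4 * ρ * C + 1) * (c ^ (-(2 * γ)) * (N : ℝ) ^ (-(2 * γ))) * sobolevNorm γ g ^ 2 := by
        have : 0 ≤ 4 * ρ * C + 1 := by
          have : 0 ≤ ρ := by linarith
          positivity
        gcongr
    _ = _ := by ring

/-! ### Approximation by combs through duality -/

/-- The Bessel potential, multiplication of the Fourier coefficients by `[m]^t`. -/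
noncomputable def bessel (t : ℝ) (g : PeriodicDistribution) : PeriodicDistribution :=
  ⟨fun m => ((bracket m ^ t : ℝ) : ℂ) * coeff g m, by
    obtain ⟨k, C, h⟩ := g.2
    refine ⟨k + ⌈|t|⌉₊, C, fun m => ?_⟩
    have hb := bracket_pos m
    have h1 : bracket m ^ t ≤ bracket m ^ ⌈|t|⌉₊ := by
      rw [← Real.rpow_natCast]
      exact Real.rpow_le_rpow_of_exponent_le (one_le_bracket m)
        ((le_abs_self t).trans (Nat.le_ceil _))
    rw [norm_mul, Complex.norm_real, Real.norm_of_nonneg (Real.rpow_nonneg hb.le _)]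
    calc bracket m ^ t * ‖coeff g m‖ ≤ bracket m ^ ⌈|t|⌉₊ * (C * bracket m ^ k) :=
          mul_le_mul h1 (h m) (norm_nonneg _) (by positivity)
      _ = _ := by rw [pow_add]; ring⟩

theorem coeff_bessel (t : ℝ) (g : PeriodicDistribution) (m : ℤ) :
    coeff (bessel t g) m = ((bracket m ^ t : ℝ) : ℂ) * coeff g m := rfl

theorem weighted_bessel (s t : ℝ) (g : PeriodicDistribution) (m : ℤ) :
    bracket m ^ (2 * s) * ‖coeff (bessel t g) m‖ ^ 2 =
      bracket m ^ (2 * (s + t)) * ‖coeff g m‖ ^ 2 := by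
  have hb := bracket_pos m
  rw [coeff_bessel, norm_mul, Complex.norm_real, Real.norm_of_nonneg (Real.rpow_nonneg hb.le _),
    mul_pow, rpow_sq hb.le, ← mul_assoc, ← Real.rpow_add hb, mul_add]

theorem bessel_mem_sobolev_iff {s t : ℝ} {g : PeriodicDistribution} :
    bessel t g ∈ sobolev s ↔ g ∈ sobolev (s + t) := by
  simp only [mem_sobolev_iff, weighted_bessel]

theorem sobolevNorm_bessel (s t : ℝ) (g : PeriodicDistribution) :
    sobolevNorm s (bessel t g) = sobolevNorm (s + t) g := by
  simp only [sobolevNorm, weighted_bessel]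

/-- The Riesz representative of g for the L² pairing. With s = -γ it supplies the dual function in
both duality arguments. -/
theorem tsum_mul_conj_bessel {s : ℝ} {g : PeriodicDistribution} :
    ∑' m, coeff g m * conj (coeff (bessel (2 * s) g) m) =
      ((sobolevNorm s g ^ 2 : ℝ) : ℂ) := by
  rw [sobolevNorm_sq, Complex.ofReal_tsum]
  refine tsum_congr fun m => ?_
  rw [coeff_bessel, map_mul, Complex.conj_ofReal, mul_left_comm, Complex.mul_conj,
    Complex.normSq_eq_norm_sq]
  push_cast
  ring

theorem comb_add {N : ℕ} (x : Fin N → ℝ) (J J' : Fin N → ℂ) (m : ℤ) :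
    comb x (J + J') m = comb x J m + comb x J' m := by
  simp [comb, add_mul, Finset.sum_add_distrib]

theorem comb_smul {N : ℕ} (x : Fin N → ℝ) (z : ℂ) (J : Fin N → ℂ) (m : ℤ) :
    comb x (z • J) m = z * comb x J m := by
  simp [comb, mul_assoc, Finset.mul_sum]

theorem comb_zero_right {N : ℕ} (x : Fin N → ℝ) (J : Fin N → ℂ) : comb x J 0 = ∑ j, J j := by
  simp [comb]

/-- The best approximation of `g` in `H^{-γ}` by combs without mean. -/
theorem exists_best_comb {N : ℕ} (x : Fin N → ℝ) {γ : ℝ}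
    (hcomb : ∀ J, combDist x J ∈ sobolev (-γ)) {g : PeriodicDistribution} (hg : g ∈ sobolev (-γ)) :
    ∃ J : Fin N → ℂ, ∑ j, J j = 0 ∧ ∀ J' : Fin N → ℂ, ∑ j, J' j = 0 →
      ∑' m, coeff (bessel (2 * (-γ)) (g - combDist x J)) m * conj (comb x J' m) = 0 := by
  let L : (Fin N → ℂ) →ₗ[ℂ] sobolev (-γ) :=
    { toFun := fun J => ⟨combDist x J, hcomb J⟩
      map_add' := fun J J' => Subtype.ext (ext_coeff fun m => comb_add x J J' m)
      map_smul' := fun z J => Subtype.ext (ext_coeff fun m => comb_smul x z J m) }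
  let Λ : (Fin N → ℂ) →ₗ[ℂ] ℂ := ∑ j, LinearMap.proj j
  have hΛ : ∀ J, Λ J = ∑ j, J j := fun J => by simp [Λ]
  -- In ℓ² the image of the zero-sum combs is finite-dimensional, so the orthogonal projection
  -- exists.
  let K : Submodule ℂ (lp (fun _ : ℤ => ℂ) 2) := (LinearMap.ker Λ).map ((toEllTwo (-γ)).comp L)
  obtain ⟨J, hJ, hJv⟩ := Submodule.mem_map.1
    (K.starProjection_apply_mem (toEllTwo (-γ) ⟨g, hg⟩))
  refine ⟨J, by rw [← hΛ]; exact hJ, fun J' hJ' => ?_⟩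
  have horth := K.sub_starProjection_mem_orthogonal (toEllTwo (-γ) ⟨g, hg⟩)
  have h1 := (Submodule.mem_orthogonal K _).1 horth (toEllTwo (-γ) (L J'))
    (Submodule.mem_map.2 ⟨J', by rw [LinearMap.mem_ker, hΛ]; exact hJ', rfl⟩)
  rw [← hJv, LinearMap.comp_apply, ← map_sub, lp.inner_eq_tsum] at h1
  rw [← h1]
  refine tsum_congr fun m => ?_
  have e : bracket m ^ (2 * (-γ)) = bracket m ^ (-γ) * bracket m ^ (-γ) := by
    rw [← sq, rpow_sq (bracket_pos m).le]
  rw [coeff_bessel, e]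
  change _ = (((bracket m ^ (-γ) : ℝ) : ℂ) * coeff (g - combDist x J) m) *
    conj (((bracket m ^ (-γ) : ℝ) : ℂ) * comb x J' m)
  rw [map_mul, Complex.conj_ofReal]
  push_cast
  ring

/-- Let e be the error of the best zero-sum comb in H^{-γ} and φ its Riesz representative in H^γ.
Orthogonality to zero-sum combs makes φ constant on the knots, so the sampling inequality bounds its
non-constant part by a multiple of N^{-γ} ‖e‖_{-γ}. Now ‖e‖_{-γ}² is the pairing of g with φ, and
only the non-constant part of φ enters because g has no mean. -/
theorem exists_comb_approximation_aux (ρ : ℝ) {γ : ℝ} (hγ : 1 / 2 < γ) :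
    ∃ C : ℝ, 0 ≤ C ∧ ∀ (N : ℕ) (Δ : Mesh N), Δ.IsQuasiUniform ρ →
      ∀ g ∈ sobolev 0, coeff g 0 = 0 → ∃ J : Fin N → ℂ, ∑ j, J j = 0 ∧
        sobolevNorm (-γ) (g - combDist Δ.node J) ≤ C * (N : ℝ) ^ (-γ) * sobolevNorm 0 g := by
  obtain ⟨C, hC, hsamp⟩ := exists_sampling_inequality ρ hγ
  obtain ⟨_, _, _, _, hcomb⟩ := exists_sobolevNorm_combDist_le ρ (t := -γ) (by linarith)
  refine ⟨Real.sqrt C, Real.sqrt_nonneg _, ?_⟩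
  intro N Δ hΔ g hg hg0
  have hN : (0 : ℝ) < N := by exact_mod_cast Δ.pos
  have hgγ := sobolev_mono (by linarith : -γ ≤ 0) hg
  obtain ⟨J, hJ, horth⟩ := exists_best_comb Δ.node (fun J => (hcomb N Δ hΔ J).1) hgγ
  refine ⟨J, hJ, ?_⟩
  set e := g - combDist Δ.node J with he
  have hem : e ∈ sobolev (-γ) := Submodule.sub_mem _ hgγ (hcomb N Δ hΔ J).1
  set φ := bessel (2 * (-γ)) e with hφ
  have hφm : φ ∈ sobolev γ := by
    rw [hφ, bessel_mem_sobolev_iff]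
    convert hem using 2
    ring
  have hφn : sobolevNorm γ φ = sobolevNorm (-γ) e := by
    rw [hφ, sobolevNorm_bessel]
    congr 1
    ring
  -- the residual is constant on the mesh
  have hconst : ∀ j, pointValue φ (Δ.node j) = pointValue φ (Δ.node ⟨0, Δ.pos⟩) := by
    intro j
    -- The difference of two unit masses is a comb without mean.
    have h1 := horth (Pi.single j 1 - Pi.single ⟨0, Δ.pos⟩ 1) (by simp)
    rw [← sum_conj_mul_pointValue Δ.node _ hγ hφm] at h1
    simp only [Pi.sub_apply, map_sub, sub_mul, Finset.sum_sub_distrib, Pi.single_apply,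
      apply_ite conj, map_one, map_zero, ite_mul, one_mul, zero_mul] at h1
    rw [Finset.sum_ite_eq' , Finset.sum_ite_eq'] at h1
    simpa [sub_eq_zero] using h1
  have hs := hsamp N Δ hΔ φ hφm _ hconst
  have hgφ : Summable fun m => coeff g m * conj (coeff φ m) := by
    refine Summable.of_norm ((summable_and_tsum_norm_mul_le (s := 0)
      (by simpa using hg) (sobolev_mono (by linarith) hφm)).1.congr fun m => ?_)
    rw [norm_mul, RCLike.norm_conj]
  have hcφ : Summable fun m => comb Δ.node J m * conj (coeff φ m) := by
    refine Summable.of_norm ((summable_and_tsum_norm_mul_le (s := γ)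
      (hcomb N Δ hΔ J).1 hφm).1.congr fun m => ?_)
    rw [norm_mul, RCLike.norm_conj, coeff_combDist]
  -- The comb part of e drops out by orthogonality.
  have hsq : ((sobolevNorm (-γ) e ^ 2 : ℝ) : ℂ) = ∑' m, coeff g m * conj (coeff φ m) := by
    rw [← tsum_mul_conj_bessel, ← hφ]
    have h0 : ∑' m, comb Δ.node J m * conj (coeff φ m) = 0 := by
      have h1 := congrArg conj (horth J hJ)
      rw [map_zero, Complex.conj_tsum] at h1
      rw [← h1]
      refine tsum_congr fun m => ?_
      rw [map_mul, Complex.conj_conj, mul_comm]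
    have h2 : ∀ m, coeff e m * conj (coeff φ m) =
        coeff g m * conj (coeff φ m) - comb Δ.node J m * conj (coeff φ m) := fun m => by
      rw [he, coeff_sub, coeff_combDist]; ring
    simp only [h2]
    rw [hgφ.tsum_sub hcφ, h0, sub_zero]
  set b : ℤ → ℝ := fun m => if m = 0 then 0 else ‖coeff φ m‖ with hb
  have hb2 : ∀ m, b m ^ 2 = if m = 0 then 0 else ‖coeff φ m‖ ^ 2 := fun m => by
    simp only [hb]; split_ifs <;> simp
  have hφ0 : Summable fun m => ‖coeff φ m‖ ^ 2 := by
    have := mem_sobolev_iff.1 (sobolev_mono (by linarith : 0 ≤ γ) hφm)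
    simpa using this
  have hcs := summable_mul_and_tsum_mul_le (a := fun m => ‖coeff g m‖) (b := b)
    (fun m => norm_nonneg _) (fun m => by simp only [hb]; split_ifs <;> positivity)
    (by simpa using mem_sobolev_iff.1 hg)
    (Summable.of_nonneg_of_le (fun m => sq_nonneg _) (fun m => by
      rw [hb2]; split_ifs <;> [positivity; exact le_rfl]) hφ0)
  have hterm : ∀ m, ‖coeff g m * conj (coeff φ m)‖ = ‖coeff g m‖ * b m := fun m => by
    rw [norm_mul, RCLike.norm_conj]
    simp only [hb]
    split_ifs with h
    · rw [h, hg0]; simp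
    · rfl
  set S := sobolevNorm (-γ) e with hS
  have hS0 : 0 ≤ S := sobolevNorm_nonneg _ _
  have hg_norm : Real.sqrt (∑' m, ‖coeff g m‖ ^ 2) = sobolevNorm 0 g := by simp [sobolevNorm]
  have h3 : S ^ 2 ≤ sobolevNorm 0 g * Real.sqrt (C * (N : ℝ) ^ (-(2 * γ)) * S ^ 2) := by
    have h4 : ‖((S ^ 2 : ℝ) : ℂ)‖ ≤ ∑' m, ‖coeff g m‖ * b m := by
      rw [hsq]
      refine (norm_tsum_le_tsum_norm hgφ.norm).trans (le_of_eq (tsum_congr hterm))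
    rw [Complex.norm_real, Real.norm_of_nonneg (sq_nonneg _)] at h4
    refine h4.trans (hcs.2.trans ?_)
    rw [hg_norm]
    refine mul_le_mul_of_nonneg_left (Real.sqrt_le_sqrt ?_) (sobolevNorm_nonneg _ _)
    simp only [hb2]
    rw [hφn] at hs
    exact hs
  have h5 : Real.sqrt (C * (N : ℝ) ^ (-(2 * γ)) * S ^ 2) = Real.sqrt C * (N : ℝ) ^ (-γ) * S := by
    have : (-(2 * γ)) = 2 * (-γ) := by ring
    rw [this, ← rpow_sq hN.le, Real.sqrt_mul (by positivity), Real.sqrt_mul hC,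
      Real.sqrt_sq (by positivity), Real.sqrt_sq hS0]
  rw [h5] at h3
  rcases hS0.eq_or_lt with h0 | hpos
  · rw [← h0]
    have := sobolevNorm_nonneg 0 g
    positivity
  · refine le_of_mul_le_mul_right ?_ hpos
    linarith

/-- Approximation of functions without mean by combs without mean, simultaneously in `H^{-γ}`
and in `H^t`. -/
theorem exists_comb_approximation (ρ : ℝ) {γ t : ℝ} (hγt : -γ ≤ t) (ht : t < -1 / 2) :
    ∃ C : ℝ, 0 ≤ C ∧ ∀ (N : ℕ) (Δ : Mesh N), Δ.IsQuasiUniform ρ →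
      ∀ g ∈ sobolev 0, coeff g 0 = 0 → ∃ J : Fin N → ℂ, ∑ j, J j = 0 ∧
        sobolevNorm (-γ) (g - combDist Δ.node J) ≤ C * (N : ℝ) ^ (-γ) * sobolevNorm 0 g ∧
        sobolevNorm t (g - combDist Δ.node J) ≤ C * (N : ℝ) ^ t * sobolevNorm 0 g := by
  obtain ⟨A, hA, happ⟩ := exists_comb_approximation_aux ρ (γ := γ) (by linarith)
  obtain ⟨K, C, hK, hC, hcomb⟩ := exists_sobolevNorm_combDist_le ρ ht
  have hK' : (0 : ℝ) < K := by exact_mod_cast hK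
  set D := (K : ℝ) ^ (2 * t + 2 * γ) * A ^ 2 + (2 * (K : ℝ) ^ (2 * t) +
      2 * (C * (K : ℝ) ^ (2 * t) * (4 * (1 + (K : ℝ) ^ (2 * γ) * A ^ 2)))) with hD
  have hD0 : 0 ≤ D := by positivity
  refine ⟨A + Real.sqrt D, by positivity, ?_⟩
  intro N Δ hΔ g hg hg0
  have hN : (0 : ℝ) < N := by exact_mod_cast Δ.pos
  obtain ⟨J, hJ, hJle⟩ := happ N Δ hΔ g hg hg0
  have hG := sobolevNorm_nonneg 0 g
  refine ⟨J, hJ, hJle.trans ?_, ?_⟩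
  · have := Real.sqrt_nonneg D
    gcongr
    linarith
  obtain ⟨h1, h2, h3⟩ := hcomb N Δ hΔ J
  have hgt := sobolev_mono (by linarith : t ≤ 0) hg
  set e := g - combDist Δ.node J with he
  have het : e ∈ sobolev t := Submodule.sub_mem _ hgt h1
  have heγ := sobolev_mono hγt het
  set n := K * N with hn
  have hn0 : 0 < n := Nat.mul_pos hK Δ.pos
  have hncast : ((n : ℕ) : ℝ) = K * N := by rw [hn]; push_cast; rfl
  have hKN : (0 : ℝ) < K * N := by positivity
  have hlow0 := sum_low_le (t := 0) (by linarith : -γ ≤ 0) hn0 (mem_sobolev_iff.1 heγ)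
  have hlowt := sum_low_le hγt hn0 (mem_sobolev_iff.1 heγ)
  simp only [mul_zero, Real.rpow_zero, one_mul, zero_sub] at hlow0
  rw [← sobolevNorm_sq, hncast] at hlow0 hlowt
  set G := sobolevNorm 0 g with hGdef
  have hS : sobolevNorm (-γ) e ^ 2 ≤ A ^ 2 * (N : ℝ) ^ (-(2 * γ)) * G ^ 2 := by
    have h := pow_le_pow_left₀ (sobolevNorm_nonneg _ _) hJle 2
    rwa [mul_pow, mul_pow, rpow_sq hN.le, mul_neg] at h
  have hsplitpow : ∀ p : ℝ, (K * N : ℝ) ^ p = (K : ℝ) ^ p * (N : ℝ) ^ p := fun p =>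
    Real.mul_rpow hK'.le hN.le
  have hG2 : 0 ≤ G ^ 2 := sq_nonneg G
  -- the masses
  have hlowg : ∑ m ∈ Finset.Ioo (-(n : ℤ)) n, ‖coeff g m‖ ^ 2 ≤ G ^ 2 := by
    have h := mem_sobolev_iff.1 hg
    rw [hGdef, sobolevNorm_sq]
    simp only [mul_zero, Real.rpow_zero, one_mul] at h ⊢
    exact h.sum_le_tsum _ fun m _ => sq_nonneg _
  have hlowe : ∑ m ∈ Finset.Ioo (-(n : ℤ)) n, ‖coeff e m‖ ^ 2 ≤
      (K : ℝ) ^ (2 * γ) * A ^ 2 * G ^ 2 := by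
    refine hlow0.trans ?_
    have e1 : -(2 * -γ) = 2 * γ := by ring
    rw [e1]
    refine (mul_le_mul_of_nonneg_left hS (by positivity)).trans (le_of_eq ?_)
    rw [hsplitpow, Real.rpow_neg hN.le]
    field_simp
  -- The comb was chosen for H^{-γ} only. Its masses are still controlled, since at low frequencies
  -- it is the difference of g and e, both bounded there; the masses then bound its high frequencies
  -- in the stronger norm.
  have hmass : ∑ j, ‖J j‖ ^ 2 ≤ 4 / (K * N : ℝ) * ((1 + (K : ℝ) ^ (2 * γ) * A ^ 2) * G ^ 2) := by
    refine h3.trans ?_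
    have h4 : ∀ m, ‖comb Δ.node J m‖ ^ 2 ≤ 2 * ‖coeff g m‖ ^ 2 + 2 * ‖coeff e m‖ ^ 2 := by
      intro m
      have h5 : comb Δ.node J m = coeff g m - coeff e m := by
        rw [he, coeff_sub, coeff_combDist]; ring
      rw [h5]
      have := norm_sub_le (coeff g m) (coeff e m)
      nlinarith [norm_nonneg (coeff g m - coeff e m), sq_nonneg (‖coeff g m‖ - ‖coeff e m‖)]
    have h6 := Finset.sum_le_sum fun m (_ : m ∈ Finset.Ioo (-(n : ℤ)) n) => h4 m
    rw [Finset.sum_add_distrib, ← Finset.mul_sum, ← Finset.mul_sum] at h6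
    calc _ ≤ 2 / (K * N : ℝ) * (2 * G ^ 2 + 2 * ((K : ℝ) ^ (2 * γ) * A ^ 2 * G ^ 2)) :=
          mul_le_mul_of_nonneg_left (by linarith) (by positivity)
      _ = _ := by ring
  have hpoint : ∀ m, bracket m ^ (2 * t) * ‖coeff e m‖ ^ 2 ≤
      2 * (bracket m ^ (2 * t) * ‖coeff g m‖ ^ 2) +
        2 * (bracket m ^ (2 * t) * ‖comb Δ.node J m‖ ^ 2) := by
    intro m
    have h5 : coeff e m = coeff g m - comb Δ.node J m := by rw [he, coeff_sub, coeff_combDist]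
    have h6 : ‖coeff e m‖ ^ 2 ≤ 2 * ‖coeff g m‖ ^ 2 + 2 * ‖comb Δ.node J m‖ ^ 2 := by
      rw [h5]
      have := norm_sub_le (coeff g m) (comb Δ.node J m)
      nlinarith [norm_nonneg (coeff g m - comb Δ.node J m),
        sq_nonneg (‖coeff g m‖ - ‖comb Δ.node J m‖)]
    have := mul_le_mul_of_nonneg_left h6 (Real.rpow_nonneg (bracket_pos m).le (2 * t))
    linarith
  have hsg := summable_high (mem_sobolev_iff.1 hgt) n
  have hsc := summable_high (mem_sobolev_iff.1 h1) n
  simp only [coeff_combDist] at hsc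
  have hse := summable_high (mem_sobolev_iff.1 het) n
  have hhigh : ∑' m : ℤ, (if (n : ℤ) ≤ |m| then bracket m ^ (2 * t) * ‖coeff e m‖ ^ 2 else 0) ≤
      2 * ((K * N : ℝ) ^ (2 * t) * G ^ 2) +
        2 * (C * (K * N : ℝ) ^ (2 * t + 1) * ∑ j, ‖J j‖ ^ 2) := by
    have h7 := sobolevNorm_highPart_le hn0 (by linarith : t ≤ 0) hg
    rw [sobolevNorm_highPart_sq, hncast, mul_zero, sub_zero] at h7
    refine le_trans ?_ (add_le_add (mul_le_mul_of_nonneg_left h7 zero_le_two)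
      (mul_le_mul_of_nonneg_left h2 zero_le_two))
    rw [← tsum_mul_left, ← tsum_mul_left, ← (hsg.mul_left 2).tsum_add (hsc.mul_left 2)]
    refine hse.tsum_le_tsum (fun m => ?_) ((hsg.mul_left 2).add (hsc.mul_left 2))
    split_ifs
    · exact hpoint m
    · simp
  obtain ⟨-, hsplit⟩ := summable_and_tsum_eq_low_add_high n hse
  rw [← sobolevNorm_sq] at hsplit
  have hlowt2 : ∑ m ∈ Finset.Ioo (-(n : ℤ)) n, bracket m ^ (2 * t) * ‖coeff e m‖ ^ 2 ≤
      (K : ℝ) ^ (2 * t + 2 * γ) * A ^ 2 * ((N : ℝ) ^ (2 * t) * G ^ 2) := by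
    refine hlowt.trans ?_
    have e1 : 2 * t - 2 * -γ = 2 * t + 2 * γ := by ring
    rw [e1]
    refine (mul_le_mul_of_nonneg_left hS (by positivity)).trans (le_of_eq ?_)
    rw [hsplitpow, Real.rpow_add hN (2 * t), Real.rpow_neg hN.le]
    field_simp
  have hhigh2 : 2 * ((K * N : ℝ) ^ (2 * t) * G ^ 2) +
        2 * (C * (K * N : ℝ) ^ (2 * t + 1) * ∑ j, ‖J j‖ ^ 2) ≤
      (2 * (K : ℝ) ^ (2 * t) + 2 * (C * (K : ℝ) ^ (2 * t) *
        (4 * (1 + (K : ℝ) ^ (2 * γ) * A ^ 2)))) * ((N : ℝ) ^ (2 * t) * G ^ 2) := by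
    have h8 := mul_le_mul_of_nonneg_left hmass
      (by positivity : 0 ≤ 2 * (C * (K * N : ℝ) ^ (2 * t + 1)))
    have h9 : 2 * (C * (K * N : ℝ) ^ (2 * t + 1)) *
        (4 / (K * N : ℝ) * ((1 + (K : ℝ) ^ (2 * γ) * A ^ 2) * G ^ 2)) =
        2 * (C * (K : ℝ) ^ (2 * t) * (4 * (1 + (K : ℝ) ^ (2 * γ) * A ^ 2))) *
          ((N : ℝ) ^ (2 * t) * G ^ 2) := by
      rw [Real.rpow_add hKN, Real.rpow_one, hsplitpow]
      field_simp
    rw [h9] at h8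
    rw [hsplitpow (2 * t)] at *
    linarith
  have hfin : sobolevNorm t e ^ 2 ≤ (Real.sqrt D * (N : ℝ) ^ t * G) ^ 2 := by
    rw [mul_pow, mul_pow, Real.sq_sqrt hD0, rpow_sq hN.le, hsplit]
    calc _ ≤ _ := add_le_add hlowt2 (hhigh.trans hhigh2)
      _ = _ := by rw [hD]; ring
  have h10 := (pow_le_pow_iff_left₀ (sobolevNorm_nonneg _ _) (by positivity) two_ne_zero).1 hfin
  refine h10.trans ?_
  gcongr
  linarith

end OversampledCollocation

/-! ### Splines and the jumps of their derivatives -/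

namespace OversampledCollocation
open ComplexConjugate MeasureTheory

theorem coeff_ofFunction (f : ℝ → ℂ) (m : ℤ) :
    coeff (ofFunction f) m = ∫ t in (0 : ℝ)..1, conj (character m t) * f t := by
  have h : ∀ t : ℝ, conj (character m t) = Complex.exp (-(2 * Real.pi * Complex.I * m * t)) := by
    intro t
    rw [← character_neg_left, character]
    congr 1; push_cast; ring
  simp only [h]
  rfl

theorem Mesh.exists_mem_Ico {N : ℕ} (Δ : Mesh N) {t : ℝ} (ht : t ∈ Set.Ico (0 : ℝ) 1) :
    ∃ j : Fin N, t ∈ Set.Ico (Δ.pts j.castSucc) (Δ.pts j.succ) := by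
  by_contra hcon
  push Not at hcon
  have h : ∀ i : Fin (N + 1), Δ.pts i ≤ t := by
    intro i
    induction i using Fin.induction with
    | zero => rw [Δ.pts_zero]; exact ht.1
    | succ j ih =>
      by_contra hlt
      exact hcon j ⟨ih, not_le.1 hlt⟩
  have := h (Fin.last N)
  rw [Δ.pts_last] at this
  linarith [ht.2]

theorem Mesh.pts_mem_Icc {N : ℕ} (Δ : Mesh N) (i : Fin (N + 1)) : Δ.pts i ∈ Set.Icc (0 : ℝ) 1 := by
  rw [← Δ.pts_zero, ← Δ.pts_last]
  exact ⟨Δ.strictMono.monotone (Fin.zero_le i), Δ.strictMono.monotone (Fin.le_last i)⟩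

theorem memLp_of_mem_splineSpace {d N : ℕ} {Δ : Mesh N} {f : ℝ → ℂ} (hf : f ∈ splineSpace d Δ) :
    MemLp f 2 (volume.restrict (Set.Ioc (0 : ℝ) 1)) := by
  obtain ⟨-, hp, -⟩ := hf
  choose p _ hp using hp
  have hpc : ∀ j, Continuous fun t : ℝ => (p j).eval (t : ℂ) := fun j =>
    (p j).continuous.comp Complex.continuous_ofReal
  have hb : ∀ j, ∃ B : ℝ, ∀ t ∈ Set.Icc (0 : ℝ) 1, ‖(p j).eval (t : ℂ)‖ ≤ B := fun j =>
    isCompact_Icc.exists_bound_of_continuousOn (hpc j).continuousOn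
  choose B hB using hb
  have hsub : Set.Ico (0 : ℝ) 1 ⊆ ⋃ j : Fin N, Set.Ico (Δ.pts j.castSucc) (Δ.pts j.succ) :=
    fun t ht => Set.mem_iUnion.2 (Δ.exists_mem_Ico ht)
  rw [← Measure.restrict_congr_set (Ico_ae_eq_Ioc (μ := volume))]
  refine MemLp.of_bound ?_ (∑ j, |B j|) ?_
  · refine AEStronglyMeasurable.mono_measure ?_ (Measure.restrict_mono_set _ hsub)
    refine aestronglyMeasurable_iUnion_iff.2 fun j => ?_
    refine ((hpc j).aestronglyMeasurable.restrict).congr ?_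
    exact ae_restrict_of_forall_mem measurableSet_Ico fun t ht => (hp j t ht).symm
  · refine ae_restrict_of_forall_mem measurableSet_Ico fun t ht => ?_
    obtain ⟨j, hj⟩ := Δ.exists_mem_Ico ht
    rw [hp j t hj]
    refine (hB j t (Set.Ico_subset_Icc_self ht)).trans ((le_abs_self _).trans ?_)
    exact Finset.single_le_sum (f := fun j => |B j|) (fun _ _ => abs_nonneg _) (Finset.mem_univ j)

theorem intervalIntegrable_of_mem_splineSpace {d N : ℕ} {Δ : Mesh N} {f : ℝ → ℂ}
    (hf : f ∈ splineSpace d Δ) : IntervalIntegrable f volume 0 1 := by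
  rw [intervalIntegrable_iff, Set.uIoc_of_le zero_le_one]
  exact (memLp_of_mem_splineSpace hf).integrable one_le_two

theorem sum_integral_mesh {N : ℕ} (Δ : Mesh N) {f : ℝ → ℂ} (hf : IntervalIntegrable f volume 0 1) :
    ∑ j : Fin N, ∫ t in Δ.pts j.castSucc..Δ.pts j.succ, f t = ∫ t in (0 : ℝ)..1, f t := by
  have h := sum_succ_sub_castSucc fun i => ∫ t in (0 : ℝ)..Δ.pts i, f t
  rw [Δ.pts_zero, Δ.pts_last, intervalIntegral.integral_same, sub_zero] at h
  rw [← h]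
  have hi : ∀ i, IntervalIntegrable f volume 0 (Δ.pts i) := fun i => by
    refine hf.mono_set ?_
    rw [Set.uIcc_of_le zero_le_one, Set.uIcc_of_le (Δ.pts_mem_Icc i).1]
    exact Set.Icc_subset_Icc_right (Δ.pts_mem_Icc i).2
  refine Finset.sum_congr rfl fun j _ => ?_
  rw [intervalIntegral.integral_interval_sub_left (hi _) (hi _)]

theorem Mesh.pts_castSucc_le_succ {N : ℕ} (Δ : Mesh N) (j : Fin N) :
    Δ.pts j.castSucc ≤ Δ.pts j.succ := (Δ.strictMono j.castSucc_lt_succ).le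

theorem hasDerivAt_conj_character (m : ℤ) (t : ℝ) :
    HasDerivAt (fun t => conj (character m t))
      (-(2 * Real.pi * Complex.I * m) * conj (character m t)) t := by
  have h := hasDerivAt_character (-m) t
  simp only [character_neg_left] at h
  have e : character (-m) = fun t => conj (character m t) := funext fun t => character_neg_left m t
  rw [e] at h
  refine h.congr_deriv ?_
  push_cast; ring

theorem hasDerivAt_eval_ofReal (p : ℂ[X]) (t : ℝ) :
    HasDerivAt (fun t : ℝ => p.eval (t : ℂ)) (p.derivative.eval (t : ℂ)) t :=
  (p.hasDerivAt (t : ℂ)).comp_ofReal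

theorem iteratedDeriv_eval_ofReal (k : ℕ) (p : ℂ[X]) :
    iteratedDeriv k (fun t : ℝ => p.eval (t : ℂ)) =
      fun t : ℝ => (Polynomial.derivative^[k] p).eval (t : ℂ) := by
  induction k generalizing p with
  | zero => simp
  | succ k ih =>
    rw [iteratedDeriv_succ', Function.iterate_succ_apply, ← ih]
    congr 1
    funext t
    exact (hasDerivAt_eval_ofReal p t).deriv

/-- Repeated integration by parts. -/
theorem integral_conj_character_mul_eval {m : ℤ} (hm : m ≠ 0) {d : ℕ} {p : ℂ[X]}
    (hp : p.natDegree ≤ d) (a b : ℝ) :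
    ∫ t in a..b, conj (character m t) * p.eval (t : ℂ) =
      ∑ k ∈ Finset.range (d + 1), (2 * Real.pi * Complex.I * m)⁻¹ ^ (k + 1) *
        (conj (character m a) * (Polynomial.derivative^[k] p).eval (a : ℂ) -
          conj (character m b) * (Polynomial.derivative^[k] p).eval (b : ℂ)) := by
  set w : ℂ := 2 * Real.pi * Complex.I * m with hw
  have hw0 : w ≠ 0 := mul_ne_zero Complex.two_pi_I_ne_zero (by exact_mod_cast hm)
  set q : ℕ → ℝ → ℂ := fun k t => (Polynomial.derivative^[k] p).eval (t : ℂ) with hq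
  -- An explicit antiderivative. Its derivative telescopes, and the last term vanishes because the
  -- derivative of order d + 1 of p is zero.
  have hder : ∀ t : ℝ, HasDerivAt (fun t => ∑ k ∈ Finset.range (d + 1),
      w⁻¹ ^ (k + 1) * (-(conj (character m t) * q k t))) (conj (character m t) * p.eval (t : ℂ)) t := by
    intro t
    have h1 : ∀ k, HasDerivAt (fun t => w⁻¹ ^ (k + 1) * (-(conj (character m t) * q k t)))
        (w⁻¹ ^ k * (conj (character m t) * q k t) -
          w⁻¹ ^ (k + 1) * (conj (character m t) * q (k + 1) t)) t := by
      intro k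
      have h2 : HasDerivAt (q k) (q (k + 1) t) t := by
        simp only [hq, Function.iterate_succ_apply']
        exact hasDerivAt_eval_ofReal _ t
      refine (((hasDerivAt_conj_character m t).mul h2).neg.const_mul (w⁻¹ ^ (k + 1))).congr_deriv ?_
      rw [← hw, pow_succ]
      field_simp
      ring
    have h3 := HasDerivAt.fun_sum fun k (_ : k ∈ Finset.range (d + 1)) => h1 k
    refine h3.congr_deriv ?_
    rw [Finset.sum_range_sub' (fun k => w⁻¹ ^ k * (conj (character m t) * q k t))]
    have h4 : q (d + 1) t = 0 := by
      simp only [hq]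
      rw [Polynomial.iterate_derivative_eq_zero (by omega), Polynomial.eval_zero]
    rw [h4]
    simp [hq]
  have hc : Continuous fun t => conj (character m t) := by
    have := continuous_character m
    fun_prop
  rw [intervalIntegral.integral_eq_sub_of_hasDerivAt (fun t _ => hder t)
    ((hc.mul (p.continuous.comp Complex.continuous_ofReal)).intervalIntegrable _ _),
    ← Finset.sum_sub_distrib]
  refine Finset.sum_congr rfl fun k _ => ?_
  ring

/-- Inside the interval the two functions agree near every point. Continuity of both derivatives
extends this to the endpoints, including the right one, where f need not be given by p. -/
theorem eval_iterate_derivative_eq {f : ℝ → ℂ} {k : ℕ} (hf : ContDiff ℝ k f) {p : ℂ[X]} {a b : ℝ}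
    (hab : a < b) (h : ∀ t ∈ Set.Ico a b, f t = p.eval (t : ℂ)) {t : ℝ} (ht : t ∈ Set.Icc a b) :
    (Polynomial.derivative^[k] p).eval (t : ℂ) = iteratedDeriv k f t := by
  have h1 : Set.EqOn (fun t : ℝ => (Polynomial.derivative^[k] p).eval (t : ℂ)) (iteratedDeriv k f)
      (Set.Ioo a b) := by
    intro s hs
    have h2 : f =ᶠ[nhds s] fun t : ℝ => p.eval (t : ℂ) := by
      filter_upwards [Ioo_mem_nhds hs.1 hs.2] with r hr using h r (Set.Ioo_subset_Ico_self hr)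
    rw [h2.iteratedDeriv_eq, iteratedDeriv_eval_ofReal]
  have h3 := h1.closure ((Polynomial.continuous _).comp Complex.continuous_ofReal)
    (hf.continuous_iteratedDeriv' k)
  rw [closure_Ioo hab.ne] at h3
  exact h3 ht

theorem iteratedDeriv_one_eq_zero {f : ℝ → ℂ} (hf : Function.Periodic f 1) (k : ℕ) :
    iteratedDeriv k f 1 = iteratedDeriv k f 0 := by
  have h := congrFun (iteratedDeriv_comp_add_const k f 1) 0
  have e : (fun z => f (z + 1)) = f := funext hf
  rw [e, zero_add] at h
  exact h.symm

/-- The right endpoints of the mesh intervals are the knots shifted cyclically by one; the last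
endpoint 1 becomes the knot 0, where all characters agree. -/
theorem exists_rotation {N : ℕ} (Δ : Mesh N) : ∃ π : Equiv.Perm (Fin N), ∀ (m : ℤ) (j : Fin N),
    character m (Δ.pts j.succ) = character m (Δ.node (π j)) := by
  obtain ⟨n, rfl⟩ : ∃ n, N = n + 1 := ⟨N - 1, by have := Δ.pos; omega⟩
  refine ⟨finRotate (n + 1), fun m j => ?_⟩
  induction j using Fin.lastCases with
  | last =>
    have h := character_int m 1
    rw [Int.cast_one] at h
    rw [finRotate_last, Mesh.node, Fin.castSucc_zero, Δ.pts_zero, Fin.succ_last, Δ.pts_last,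
      character_zero_right, h]
  | cast i =>
    rw [finRotate_apply, Mesh.node]
    congr 2
    ext
    simp

/-- The Fourier coefficients of a spline. -/
theorem exists_coeff_of_mem_splineSpace {d N : ℕ} {Δ : Mesh N} {f : ℝ → ℂ}
    (hf : f ∈ splineSpace d Δ) : ∃ J : Fin N → ℂ, ∑ j, J j = 0 ∧ ∀ m : ℤ, m ≠ 0 →
      coeff (ofFunction f) m =
        (2 * Real.pi * Complex.I * m)⁻¹ ^ (d + 1) * comb Δ.node J m := by
  have hint := intervalIntegrable_of_mem_splineSpace hf
  obtain ⟨hper, hp, hsmooth⟩ := hf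
  choose p hdeg hp using hp
  obtain ⟨π, hπ⟩ := exists_rotation Δ
  set A : Fin N → ℂ := fun j => (Polynomial.derivative^[d] (p j)).eval 0 with hA
  have hconst : ∀ j (t : ℂ), (Polynomial.derivative^[d] (p j)).eval t = A j := by
    intro j t
    have h1 : (Polynomial.derivative^[d] (p j)).natDegree = 0 := by
      have := Polynomial.natDegree_iterate_derivative (p j) d
      have := hdeg j
      omega
    simp only [hA]
    rw [Polynomial.eq_C_of_natDegree_eq_zero h1, Polynomial.eval_C, Polynomial.eval_C]
  -- The masses are the jumps of the derivative of order d across the knots, cyclically, so they sum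
  -- to zero.
  refine ⟨fun j => A j - A (π.symm j), ?_, fun m hm => ?_⟩
  · rw [Finset.sum_sub_distrib, Equiv.sum_comp, sub_self]
  have hc : Continuous fun t => conj (character m t) := by
    have := continuous_character m
    fun_prop
  rw [coeff_ofFunction, ← sum_integral_mesh Δ (hint.continuousOn_mul hc.continuousOn)]
  have h1 : ∀ j : Fin N, ∫ t in Δ.pts j.castSucc..Δ.pts j.succ, conj (character m t) * f t =
      ∑ k ∈ Finset.range (d + 1), (2 * Real.pi * Complex.I * m)⁻¹ ^ (k + 1) *
        (conj (character m (Δ.pts j.castSucc)) *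
            (Polynomial.derivative^[k] (p j)).eval ((Δ.pts j.castSucc : ℝ) : ℂ) -
          conj (character m (Δ.pts j.succ)) *
            (Polynomial.derivative^[k] (p j)).eval ((Δ.pts j.succ : ℝ) : ℂ)) := by
    intro j
    rw [← integral_conj_character_mul_eval hm (hdeg j)]
    refine intervalIntegral.integral_congr_Ioo_of_le (Δ.pts_castSucc_le_succ j) fun t ht => ?_
    rw [hp j t (Set.Ioo_subset_Ico_self ht)]
  simp only [h1]
  -- Boundary terms of order k < d telescope to zero, because those derivatives are continuous and
  -- periodic. Only order d leaves jumps.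
  rw [Finset.sum_comm, Finset.sum_range_succ, Finset.sum_eq_zero, zero_add]
  · rw [← Finset.mul_sum]
    congr 1
    simp only [hconst, hπ]
    rw [Finset.sum_sub_distrib, comb]
    simp only [sub_mul, Finset.sum_sub_distrib]
    congr 1
    · exact Finset.sum_congr rfl fun j _ => mul_comm _ _
    · rw [← Equiv.sum_comp π fun j => A (π.symm j) * conj (character m (Δ.node j))]
      simp only [Equiv.symm_apply_apply]
      exact Finset.sum_congr rfl fun j _ => mul_comm _ _
  · intro k hk
    have hkd : k < d := Finset.mem_range.1 hk
    rw [← Finset.mul_sum]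
    have h2 : ∀ j : Fin N, (conj (character m (Δ.pts j.castSucc)) *
            (Polynomial.derivative^[k] (p j)).eval ((Δ.pts j.castSucc : ℝ) : ℂ) -
          conj (character m (Δ.pts j.succ)) *
            (Polynomial.derivative^[k] (p j)).eval ((Δ.pts j.succ : ℝ) : ℂ)) =
        -(conj (character m (Δ.pts j.succ)) * iteratedDeriv k f (Δ.pts j.succ) -
          conj (character m (Δ.pts j.castSucc)) * iteratedDeriv k f (Δ.pts j.castSucc)) := by
      intro j
      have hlt := Δ.strictMono j.castSucc_lt_succ
      rw [eval_iterate_derivative_eq (hsmooth k hkd) hlt (hp j) (Set.left_mem_Icc.2 hlt.le),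
        eval_iterate_derivative_eq (hsmooth k hkd) hlt (hp j) (Set.right_mem_Icc.2 hlt.le)]
      ring
    simp only [h2, Finset.sum_neg_distrib]
    rw [sum_succ_sub_castSucc fun i => conj (character m (Δ.pts i)) * iteratedDeriv k f (Δ.pts i),
      Δ.pts_zero, Δ.pts_last, iteratedDeriv_one_eq_zero hper]
    have h := character_int m 1
    rw [Int.cast_one] at h
    rw [h, character_zero_right, sub_self, neg_zero, mul_zero]

/-- A spline is determined by its Fourier coefficients. -/
theorem eq_zero_of_ofFunction_eq_zero {d N : ℕ} {Δ : Mesh N} {f : ℝ → ℂ}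
    (hf : f ∈ splineSpace d Δ) (h : ofFunction f = 0) : f = 0 := by
  have hL := memLp_of_mem_splineSpace hf
  have hsum := hasSum_sq_fourierCoeffOn zero_lt_one hL
  have hcoef : ∀ m : ℤ, fourierCoeffOn zero_lt_one f m = 0 := by
    intro m
    have h1 : coeff (ofFunction f) m = 0 := by rw [h]; rfl
    rw [coeff_ofFunction] at h1
    have h2 : ∫ t in (0 : ℝ)..1, fourier (-m) (t : AddCircle ((1 : ℝ) - 0)) • f t = 0 := by
      rw [← h1]
      refine intervalIntegral.integral_congr fun t _ => ?_
      simp only [smul_eq_mul, fourier_coe_apply]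
      congr 1
      rw [← character_neg_left, character]
      congr 1
      push_cast
      ring
    rw [fourierCoeffOn_eq_integral, h2, smul_zero]
  simp only [hcoef, norm_zero, ne_eq, OfNat.ofNat_ne_zero, not_false_eq_true, zero_pow,
    sub_zero, inv_one, one_smul] at hsum
  have hint0 : ∫ t in (0 : ℝ)..1, ‖f t‖ ^ 2 = 0 := hsum.unique hasSum_zero
  rw [intervalIntegral.integral_of_le zero_le_one,
    integral_eq_zero_iff_of_nonneg (fun t => sq_nonneg _)
      ((memLp_two_iff_integrable_sq_norm hL.1).1 hL)] at hint0
  obtain ⟨hper, hp, -⟩ := hf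
  have hico : ∀ t ∈ Set.Ico (0 : ℝ) 1, f t = 0 := by
    intro t ht
    obtain ⟨j, hj⟩ := Δ.exists_mem_Ico ht
    obtain ⟨p, -, hp⟩ := hp j
    have hlt := Δ.strictMono j.castSucc_lt_succ
    have hsub : Set.Ioo (Δ.pts j.castSucc) (Δ.pts j.succ) ⊆ Set.Ioc 0 1 := fun s hs =>
      ⟨(Δ.pts_mem_Icc _).1.trans_lt hs.1, hs.2.le.trans (Δ.pts_mem_Icc _).2⟩
    have hae : ∀ᵐ s : ℝ ∂(volume.restrict (Set.Ioo (Δ.pts j.castSucc) (Δ.pts j.succ))),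
        p.eval (s : ℂ) = 0 := by
      have h1 : ∀ᵐ s ∂(volume.restrict (Set.Ioo (Δ.pts j.castSucc) (Δ.pts j.succ))),
          (fun t => ‖f t‖ ^ 2) s = (0 : ℝ → ℝ) s :=
        ae_restrict_of_ae_restrict_of_subset hsub hint0
      filter_upwards [h1, ae_restrict_mem measurableSet_Ioo] with s hs hs2
      rw [← hp s (Set.Ioo_subset_Ico_self hs2)]
      simpa using hs
    have hEq : Set.EqOn (fun s : ℝ => p.eval (s : ℂ)) (fun _ => 0)
        (Set.Ioo (Δ.pts j.castSucc) (Δ.pts j.succ)) :=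
      Measure.eqOn_open_of_ae_eq hae isOpen_Ioo
        (p.continuous.comp Complex.continuous_ofReal).continuousOn continuousOn_const
    -- Taking the closure reaches the left knot, which belongs to the half-open piece.
    have hEq2 := hEq.closure (p.continuous.comp Complex.continuous_ofReal) continuous_const
    rw [closure_Ioo hlt.ne] at hEq2
    rw [hp t hj]
    exact hEq2 (Set.Ico_subset_Icc_self hj)
  funext t
  have h1 : f t = f (Int.fract t) := by
    have h2 := hper.sub_zsmul_eq ⌊t⌋ (x := t)
    rw [zsmul_one] at h2
    exact h2.symm
  rw [h1, hico _ ⟨Int.fract_nonneg t, Int.fract_lt_one t⟩]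
  rfl

/-! ### Periodic Bernoulli functions and splines with prescribed jumps -/

theorem bernoulliFun_fract_eq (n : ℕ) {s : ℝ} (hs : s ∈ Set.Ioo (-1 : ℝ) 1) :
    bernoulliFun n (Int.fract s) = if 0 ≤ s then bernoulliFun n s else bernoulliFun n (s + 1) := by
  split_ifs with h
  · rw [Int.fract_eq_self.2 ⟨h, hs.2⟩]
  · have h1 : Int.fract s = s + 1 := by
      rw [Int.fract_eq_iff]
      exact ⟨by linarith [hs.1], by linarith [not_le.1 h], -1, by push_cast; ring⟩
    rw [h1]

theorem continuous_bernoulliFun_ite {n : ℕ} (hn : n ≠ 1) :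
    Continuous fun s : ℝ => if 0 ≤ s then bernoulliFun n s else bernoulliFun n (s + 1) := by
  refine Continuous.if_le (continuous_bernoulliFun n) ?_ continuous_const continuous_id ?_
  · exact (continuous_bernoulliFun n).comp (continuous_id.add continuous_const)
  · intro s hs
    have hs' : s = 0 := hs.symm
    rw [hs', zero_add, bernoulliFun_endpoints_eq_of_ne_one hn]

/-- Two polynomial branches glued at 0. Both the function and the candidate derivative are
continuous there, since the endpoint values of Bernoulli polynomials of degree other than 1 agree;
differentiability at 0 follows from that on the punctured line. This is where n ≥ 2 is needed. -/
theorem hasDerivAt_bernoulliFun_ite {n : ℕ} (hn : 2 ≤ n) (s : ℝ) :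
    HasDerivAt (fun s : ℝ => if 0 ≤ s then bernoulliFun (n + 1) s else bernoulliFun (n + 1) (s + 1))
      ((n + 1 : ℝ) * if 0 ≤ s then bernoulliFun n s else bernoulliFun n (s + 1)) s := by
  set F := fun s : ℝ => if 0 ≤ s then bernoulliFun (n + 1) s else bernoulliFun (n + 1) (s + 1)
  set G := fun s : ℝ => (n + 1 : ℝ) * if 0 ≤ s then bernoulliFun n s else bernoulliFun n (s + 1)
  have hne : ∀ y ≠ (0 : ℝ), HasDerivAt F (G y) y := by
    intro y hy
    rcases lt_or_gt_of_ne hy with h | h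
    · have h1 : F =ᶠ[nhds y] fun s => bernoulliFun (n + 1) (s + 1) := by
        filter_upwards [Iio_mem_nhds h] with s hs
        simp only [F]
        rw [if_neg (not_le.2 hs)]
      have h2 := (hasDerivAt_bernoulliFun (n + 1) (y + 1)).comp_add_const y 1
      refine (h2.congr_of_eventuallyEq h1).congr_deriv ?_
      simp only [G]
      rw [if_neg (not_le.2 h)]
      simp
    · have h1 : F =ᶠ[nhds y] bernoulliFun (n + 1) := by
        filter_upwards [Ioi_mem_nhds h] with s hs
        simp only [F]
        rw [if_pos (le_of_lt hs)]
      refine ((hasDerivAt_bernoulliFun (n + 1) y).congr_of_eventuallyEq h1).congr_deriv ?_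
      simp only [G]
      rw [if_pos h.le]
      simp
  rcases eq_or_ne s 0 with rfl | hs
  · exact hasDerivAt_of_hasDerivAt_of_ne hne
      (continuous_bernoulliFun_ite (by omega)).continuousAt
      (continuous_const.mul (continuous_bernoulliFun_ite (by omega))).continuousAt
  · exact hne s hs

theorem bernoulliFun_fract_eventuallyEq (n : ℕ) (t : ℝ) :
    (fun t => bernoulliFun n (Int.fract t)) =ᶠ[nhds t] fun t' =>
      (fun s : ℝ => if 0 ≤ s then bernoulliFun n s else bernoulliFun n (s + 1)) (t' - ⌊t⌋) := by
  have h1 := Int.fract_nonneg t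
  have h2 := Int.fract_lt_one t
  rw [Int.fract] at h1 h2
  filter_upwards [Ioo_mem_nhds (a := (⌊t⌋ : ℝ) - 1) (b := ⌊t⌋ + 1) (x := t) (by linarith)
    (by linarith)] with s hs
  rw [← bernoulliFun_fract_eq n ⟨by linarith [hs.1], by linarith [hs.2]⟩, Int.fract_sub_intCast]

theorem hasDerivAt_bernoulliFun_fract {n : ℕ} (hn : 2 ≤ n) (t : ℝ) :
    HasDerivAt (fun t => bernoulliFun (n + 1) (Int.fract t))
      ((n + 1 : ℝ) * bernoulliFun n (Int.fract t)) t := by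
  have h := (hasDerivAt_bernoulliFun_ite hn (t - ⌊t⌋)).comp_sub_const t ⌊t⌋
  refine (h.congr_of_eventuallyEq (bernoulliFun_fract_eventuallyEq (n + 1) t)).congr_deriv ?_
  rw [(bernoulliFun_fract_eventuallyEq n t).eq_of_nhds]

theorem continuous_bernoulliFun_fract {n : ℕ} (hn : n ≠ 1) :
    Continuous fun t => bernoulliFun n (Int.fract t) := by
  refine continuous_iff_continuousAt.2 fun t => ?_
  refine ContinuousAt.congr ?_ (bernoulliFun_fract_eventuallyEq n t).symm
  exact ((continuous_bernoulliFun_ite hn).comp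
    (continuous_id.sub continuous_const)).continuousAt

/-- The periodic Bernoulli function of degree `n` is of class `C^{n-2}`. -/
theorem contDiff_bernoulliFun_fract (k n : ℕ) (h : k + 2 ≤ n) :
    ContDiff ℝ k fun t => bernoulliFun n (Int.fract t) := by
  induction k generalizing n with
  | zero => exact contDiff_zero.2 (continuous_bernoulliFun_fract (by omega))
  | succ k ih =>
    obtain ⟨n, rfl⟩ : ∃ l, n = l + 1 := ⟨n - 1, by omega⟩
    have hd := fun t => hasDerivAt_bernoulliFun_fract (n := n) (by omega) t
    push_cast
    refine contDiff_succ_iff_deriv.2 ⟨fun t => (hd t).differentiableAt, by simp, ?_⟩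
    have e : deriv (fun t => bernoulliFun (n + 1) (Int.fract t)) =
        fun t => (n + 1 : ℝ) * bernoulliFun n (Int.fract t) := funext fun t => (hd t).deriv
    rw [e]
    exact contDiff_const.mul (ih n (by omega))

theorem intervalIntegrable_bernoulliFun_fract (n : ℕ) (x a b : ℝ) :
    IntervalIntegrable (fun t => ((bernoulliFun n (Int.fract (t - x)) : ℝ) : ℂ)) volume a b := by
  obtain ⟨B, hB⟩ := isCompact_Icc.exists_bound_of_continuousOn
    (s := Set.Icc (0 : ℝ) 1) (continuous_bernoulliFun n).continuousOn
  have hm : Measurable fun t : ℝ => ((bernoulliFun n (Int.fract (t - x)) : ℝ) : ℂ) :=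
    Complex.measurable_ofReal.comp ((continuous_bernoulliFun n).measurable.comp
      (measurable_fract.comp (measurable_id.sub measurable_const)))
  rw [intervalIntegrable_iff]
  have : IsFiniteMeasure (volume.restrict (Set.uIoc a b)) :=
    ⟨by rw [Measure.restrict_apply_univ, Set.uIoc]; exact measure_Ioc_lt_top⟩
  refine (MemLp.of_bound (p := 1) hm.aestronglyMeasurable B
    (Filter.Eventually.of_forall fun t => ?_)).integrable le_rfl
  rw [Complex.norm_real]
  exact hB _ ⟨Int.fract_nonneg _, (Int.fract_lt_one _).le⟩

/-- Translation by x produces the phase, and periodicity returns the integral to [0,1]. The formula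
includes m = 0: there 0⁻¹ = 0, and a Bernoulli polynomial of positive degree has mean zero. -/
theorem integral_conj_character_mul_bernoulliFun_fract (d : ℕ) (x : ℝ) (m : ℤ) :
    ∫ t in (0 : ℝ)..1, conj (character m t) * ((bernoulliFun (d + 1) (Int.fract (t - x)) : ℝ) : ℂ)
      = -((d + 1).factorial : ℂ) * (2 * Real.pi * Complex.I * m)⁻¹ ^ (d + 1) *
        conj (character m x) := by
  set g : ℝ → ℂ := fun s => conj (character m s) *
    ((bernoulliFun (d + 1) (Int.fract s) : ℝ) : ℂ) with hg
  have hper : Function.Periodic g 1 := by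
    intro s
    have h := character_int m 1
    rw [Int.cast_one] at h
    simp only [hg]
    rw [character_add_right, h, mul_one, Int.fract_add_one]
  have h1 : ∀ t, conj (character m t) * ((bernoulliFun (d + 1) (Int.fract (t - x)) : ℝ) : ℂ) =
      conj (character m x) * g (t - x) := by
    intro t
    simp only [hg]
    rw [← mul_assoc, ← map_mul, ← character_add_right, add_sub_cancel]
  simp only [h1]
  rw [intervalIntegral.integral_const_mul, intervalIntegral.integral_comp_sub_right g x]
  have h2 := hper.intervalIntegral_add_eq (0 - x) 0
  have e1 : 0 - x + 1 = 1 - x := by ring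
  rw [e1, zero_add] at h2
  rw [h2]
  have h3 : ∫ s in (0 : ℝ)..1, g s = bernoulliFourierCoeff (d + 1) m := by
    rw [bernoulliFourierCoeff, fourierCoeffOn_eq_integral, sub_zero, div_one, one_smul]
    refine intervalIntegral.integral_congr_Ioo_of_le zero_le_one fun t ht => ?_
    simp only [hg, smul_eq_mul, fourier_coe_apply]
    rw [Int.fract_eq_self.2 ⟨ht.1.le, ht.2⟩, ← character_neg_left, character]
    congr 2
    push_cast
    ring
  rw [h3, bernoulliFourierCoeff_eq (by omega : d + 1 ≠ 0), inv_pow, div_eq_mul_inv]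
  ring

/-- The spline with mean `c` whose derivative of order `d + 1` is the comb with masses `J`. -/
noncomputable def combSpline (d : ℕ) {N : ℕ} (x : Fin N → ℝ) (c : ℂ) (J : Fin N → ℂ) (t : ℝ) : ℂ :=
  c + ∑ j, (-(1 / ((d + 1).factorial : ℂ)) * J j) *
    ((bernoulliFun (d + 1) (Int.fract (t - x j)) : ℝ) : ℂ)

theorem coeff_ofFunction_combSpline (d : ℕ) {N : ℕ} (x : Fin N → ℝ) (c : ℂ) (J : Fin N → ℂ)
    (m : ℤ) : coeff (ofFunction (combSpline d x c J)) m = (if m = 0 then c else 0) +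
      (2 * Real.pi * Complex.I * m)⁻¹ ^ (d + 1) * comb x J m := by
  have hc : Continuous fun t => conj (character m t) := by
    have := continuous_character m
    fun_prop
  have hi : ∀ j, IntervalIntegrable (fun t => (-(1 / ((d + 1).factorial : ℂ)) * J j) *
      (conj (character m t) * ((bernoulliFun (d + 1) (Int.fract (t - x j)) : ℝ) : ℂ)))
      volume 0 1 := fun j =>
    ((intervalIntegrable_bernoulliFun_fract (d + 1) (x j) 0 1).continuousOn_mul
      hc.continuousOn).const_mul _
  have h1 : ∀ t, conj (character m t) * combSpline d x c J t = c * conj (character m t) +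
      ∑ j, (-(1 / ((d + 1).factorial : ℂ)) * J j) *
        (conj (character m t) * ((bernoulliFun (d + 1) (Int.fract (t - x j)) : ℝ) : ℂ)) := by
    intro t
    rw [combSpline, mul_add, Finset.mul_sum, mul_comm]
    congr 1
    exact Finset.sum_congr rfl fun j _ => by ring
  have hsum : IntervalIntegrable (fun t => ∑ j, (-(1 / ((d + 1).factorial : ℂ)) * J j) *
      (conj (character m t) * ((bernoulliFun (d + 1) (Int.fract (t - x j)) : ℝ) : ℂ)))
      volume 0 1 := by
    have e : (fun t => ∑ j, (-(1 / ((d + 1).factorial : ℂ)) * J j) *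
        (conj (character m t) * ((bernoulliFun (d + 1) (Int.fract (t - x j)) : ℝ) : ℂ))) =
        ∑ j, fun t => (-(1 / ((d + 1).factorial : ℂ)) * J j) *
        (conj (character m t) * ((bernoulliFun (d + 1) (Int.fract (t - x j)) : ℝ) : ℂ)) := by
      funext t
      rw [Finset.sum_apply]
    rw [e]
    exact IntervalIntegrable.sum _ fun j _ => hi j
  have hi0 : IntervalIntegrable (fun t => c * conj (character m t)) volume 0 1 :=
    (continuous_const.mul hc).intervalIntegrable _ _
  rw [coeff_ofFunction]
  simp only [h1]
  rw [intervalIntegral.integral_add hi0 hsum,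
    intervalIntegral.integral_finsetSum fun j _ => hi j]
  congr 1
  · rw [intervalIntegral.integral_const_mul]
    simp only [← character_neg_left, integral_character, neg_eq_zero]
    split_ifs <;> simp
  · rw [comb, Finset.mul_sum]
    refine Finset.sum_congr rfl fun j _ => ?_
    rw [intervalIntegral.integral_const_mul, integral_conj_character_mul_bernoulliFun_fract]
    have : ((d + 1).factorial : ℂ) ≠ 0 := by exact_mod_cast Nat.factorial_ne_zero _
    field_simp

theorem natDegree_bernoulli_le (n : ℕ) : (Polynomial.bernoulli n).natDegree ≤ n := by
  refine Polynomial.natDegree_le_iff_coeff_eq_zero.2 fun i hi => ?_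
  rw [Polynomial.coeff_bernoulli, if_neg (by omega)]

theorem coeff_bernoulli_self (n : ℕ) : (Polynomial.bernoulli n).coeff n = 1 := by
  rw [Polynomial.coeff_bernoulli, if_pos le_rfl]
  simp

/-- On a mesh interval each summand is a multiple of a shifted monic polynomial of degree d + 1. The
vanishing total mass cancels the top coefficient, which brings the degree down to d. -/
theorem combSpline_mem_splineSpace (d : ℕ) {N : ℕ} (Δ : Mesh N) (c : ℂ) {J : Fin N → ℂ}
    (hJ : ∑ j, J j = 0) : combSpline d Δ.node c J ∈ splineSpace d Δ := by
  refine ⟨fun t => ?_, fun i => ?_, fun k hk => ?_⟩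
  · simp only [combSpline]
    congr 1
    refine Finset.sum_congr rfl fun j _ => ?_
    rw [add_sub_right_comm, Int.fract_add_one]
  · set B : ℂ[X] := (Polynomial.bernoulli (d + 1)).map (algebraMap ℚ ℂ) with hB
    have hBdeg : B.natDegree = d + 1 := by
      rw [hB, Polynomial.natDegree_map]
      exact le_antisymm (natDegree_bernoulli_le _)
        (Polynomial.le_natDegree_of_ne_zero (by rw [coeff_bernoulli_self]; exact one_ne_zero))
    have hBlead : B.leadingCoeff = 1 := by
      rw [Polynomial.leadingCoeff, hBdeg, hB, Polynomial.coeff_map, coeff_bernoulli_self, map_one]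
    have hBeval : ∀ s : ℝ, B.eval (s : ℂ) = ((bernoulliFun (d + 1) s : ℝ) : ℂ) := by
      intro s
      rw [hB, bernoulliFun, Polynomial.eval_map, Polynomial.eval_map, Polynomial.eval₂_eq_sum_range,
        Polynomial.eval₂_eq_sum_range]
      push_cast
      simp
    -- For knots to the right of the interval the fractional part adds one period.
    set a : Fin N → ℂ := fun j => if j ≤ i then ((-Δ.node j : ℝ) : ℂ) else ((1 - Δ.node j : ℝ) : ℂ)
      with ha
    set Q : Fin N → ℂ[X] := fun j => B.comp (Polynomial.X + Polynomial.C (a j)) with hQ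
    have hQdeg : ∀ j, (Q j).natDegree = d + 1 := fun j => by
      rw [hQ, Polynomial.natDegree_comp, hBdeg, Polynomial.natDegree_X_add_C, mul_one]
    have hQcoeff : ∀ j, (Q j).coeff (d + 1) = 1 := fun j => by
      have h : (Q j).leadingCoeff = 1 := by
        simp only [hQ]
        rw [Polynomial.leadingCoeff_comp (by rw [Polynomial.natDegree_X_add_C]; exact one_ne_zero),
          hBlead, Polynomial.leadingCoeff_X_add_C, one_pow, mul_one]
      rwa [Polynomial.leadingCoeff, hQdeg] at h
    refine ⟨Polynomial.C c + ∑ j, Polynomial.C (-(1 / ((d + 1).factorial : ℂ)) * J j) * Q j, ?_, ?_⟩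
    · refine Polynomial.natDegree_le_iff_coeff_eq_zero.2 fun n hn => ?_
      rw [Polynomial.coeff_add, Polynomial.coeff_C_of_ne_zero (by omega), zero_add,
        Polynomial.finsetSum_coeff]
      simp only [Polynomial.coeff_C_mul]
      rcases eq_or_lt_of_le (Nat.succ_le_of_lt hn) with h | h
      · rw [← h]
        simp only [Nat.succ_eq_add_one, hQcoeff, mul_one, ← Finset.mul_sum, hJ, mul_zero]
      · refine Finset.sum_eq_zero fun j _ => ?_
        rw [Polynomial.coeff_eq_zero_of_natDegree_lt (by rw [hQdeg]; omega), mul_zero]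
    · intro t ht
      rw [combSpline, Polynomial.eval_add, Polynomial.eval_C, Polynomial.eval_finsetSum]
      congr 1
      refine Finset.sum_congr rfl fun j _ => ?_
      rw [Polynomial.eval_mul, Polynomial.eval_C]
      congr 1
      simp only [hQ, ha]
      rw [Polynomial.eval_comp, Polynomial.eval_add, Polynomial.eval_X, Polynomial.eval_C]
      have hj := Δ.pts_mem_Icc j.castSucc
      have ht1 := (Δ.pts_mem_Icc i.succ).2
      have ht0 := (Δ.pts_mem_Icc i.castSucc).1
      have htl := ht.1
      have htr := ht.2
      split_ifs with hji
      · have h1 : Δ.pts j.castSucc ≤ Δ.pts i.castSucc :=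
          Δ.strictMono.monotone (Fin.castSucc_le_castSucc_iff.2 hji)
        have h2 : Int.fract (t - Δ.node j) = t + -Δ.node j := by
          rw [← sub_eq_add_neg, Int.fract_eq_self]
          simp only [Mesh.node]
          exact ⟨by linarith, by linarith [hj.1]⟩
        rw [h2, ← hBeval]
        push_cast
        rfl
      · have h1 : Δ.pts i.succ ≤ Δ.pts j.castSucc :=
          Δ.strictMono.monotone (by
            rw [Fin.succ_le_castSucc_iff]
            exact not_le.1 hji)
        have hj1 : Δ.pts j.castSucc < 1 := by
          rw [← Δ.pts_last]
          exact Δ.strictMono (Fin.castSucc_lt_last j)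
        have h2 : Int.fract (t - Δ.node j) = t + (1 - Δ.node j) := by
          rw [Int.fract_eq_iff]
          simp only [Mesh.node]
          exact ⟨by linarith, by linarith, -1, by push_cast; ring⟩
        rw [h2, ← hBeval]
        push_cast
        rfl
  · have h : ∀ j, ContDiff ℝ k fun t =>
        ((bernoulliFun (d + 1) (Int.fract (t - Δ.node j)) : ℝ) : ℂ) := fun j =>
      Complex.ofRealCLM.contDiff.comp
        ((contDiff_bernoulliFun_fract k (d + 1) (by omega)).comp (contDiff_id.sub contDiff_const))
    exact contDiff_const.add (ContDiff.sum fun j _ => contDiff_const.mul (h j))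

/-! ### Inverse and approximation estimates for splines -/

/-- Sobolev norms of an `n`-fold primitive with mean `c` of a distribution without mean. -/
theorem sobolevNorm_primitive (n : ℕ) {f g : PeriodicDistribution} {c : ℂ} (hg : coeff g 0 = 0)
    (h : ∀ m, coeff f m = (if m = 0 then c else 0) +
      (2 * Real.pi * Complex.I * m)⁻¹ ^ n * coeff g m) (s : ℝ) :
    (g ∈ sobolev (s - n) → f ∈ sobolev s) ∧ (f ∈ sobolev s → g ∈ sobolev (s - n)) ∧
    (g ∈ sobolev (s - n) → sobolevNorm s f ^ 2 =
      ‖c‖ ^ 2 + (((2 * Real.pi) ^ n)⁻¹ * sobolevNorm (s - n) g) ^ 2) := by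
  set κ : ℝ := ((2 * Real.pi) ^ n)⁻¹ with hκ
  have hκ0 : κ ≠ 0 := by positivity
  have e : ∀ m : ℤ, bracket m ^ (2 * s) * ‖coeff f m‖ ^ 2 = (if m = 0 then ‖c‖ ^ 2 else 0) +
      κ ^ 2 * (bracket m ^ (2 * (s - n)) * ‖coeff g m‖ ^ 2) := by
    intro m
    rcases eq_or_ne m 0 with rfl | hm
    · rw [h, hg]
      simp [bracket]
    · have hb : bracket m = |(m : ℝ)| := max_eq_right (by exact_mod_cast Int.one_le_abs hm)
      have hb0 := bracket_pos m
      have h1 : ‖coeff f m‖ = κ * (bracket m ^ n)⁻¹ * ‖coeff g m‖ := by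
        rw [h, if_neg hm, zero_add, norm_mul, norm_pow, norm_inv, hκ]
        simp only [norm_mul, Complex.norm_real, Complex.norm_I, Complex.norm_intCast, hb]
        rw [Real.norm_of_nonneg Real.pi_pos.le, mul_one, inv_pow, mul_pow, mul_inv]
        simp
      have h2 : bracket m ^ (2 * (s - n)) = bracket m ^ (2 * s) * (bracket m ^ n)⁻¹ ^ 2 := by
        rw [mul_sub, Real.rpow_sub hb0, div_eq_mul_inv, ← rpow_sq hb0.le (n : ℝ),
          Real.rpow_natCast, inv_pow]
      rw [h1, h2, if_neg hm]
      ring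
  have hs0 : HasSum (fun m : ℤ => if m = 0 then ‖c‖ ^ 2 else 0) (‖c‖ ^ 2) :=
    hasSum_ite_eq 0 _
  refine ⟨fun hg' => ?_, fun hf' => ?_, fun hg' => ?_⟩
  · rw [mem_sobolev_iff] at hg' ⊢
    simp only [e]
    exact hs0.summable.add (hg'.mul_left _)
  · rw [mem_sobolev_iff] at hf' ⊢
    simp only [e] at hf'
    have h1 := (hf'.sub hs0.summable).mul_left (κ ^ 2)⁻¹
    refine h1.congr fun m => ?_
    field_simp
    ring
  · rw [mul_pow, sobolevNorm_sq, sobolevNorm_sq]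
    simp only [e]
    rw [hs0.summable.tsum_add ((mem_sobolev_iff.1 hg').mul_left _), hs0.tsum_eq, tsum_mul_left]

theorem ofFunction_add {f g : ℝ → ℂ} (hf : IntervalIntegrable f volume 0 1)
    (hg : IntervalIntegrable g volume 0 1) : ofFunction (f + g) = ofFunction f + ofFunction g := by
  refine ext_coeff fun m => ?_
  have hc : Continuous fun t => conj (character m t) := by
    have := continuous_character m
    fun_prop
  rw [coeff_add, coeff_ofFunction, coeff_ofFunction, coeff_ofFunction,
    ← intervalIntegral.integral_add (hf.continuousOn_mul hc.continuousOn)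
      (hg.continuousOn_mul hc.continuousOn)]
  simp only [Pi.add_apply, mul_add]

theorem ofFunction_smul (z : ℂ) (f : ℝ → ℂ) : ofFunction (z • f) = z • ofFunction f := by
  refine ext_coeff fun m => ?_
  rw [coeff_smul, coeff_ofFunction, coeff_ofFunction, ← intervalIntegral.integral_const_mul]
  simp only [Pi.smul_apply, smul_eq_mul, mul_left_comm]

/-- The distributions of the splines. -/
noncomputable def splineDist (d : ℕ) {N : ℕ} (Δ : Mesh N) :
    splineSpace d Δ →ₗ[ℂ] PeriodicDistribution where
  toFun f := ofFunction f
  map_add' f g := ofFunction_add (intervalIntegrable_of_mem_splineSpace f.2)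
    (intervalIntegrable_of_mem_splineSpace g.2)
  map_smul' z f := ofFunction_smul z f

@[simp] theorem splineDist_apply (d : ℕ) {N : ℕ} (Δ : Mesh N) (f : splineSpace d Δ) :
    splineDist d Δ f = ofFunction f := rfl

theorem splineDist_injective (d : ℕ) {N : ℕ} (Δ : Mesh N) :
    Function.Injective (splineDist d Δ) := by
  rw [injective_iff_map_eq_zero]
  exact fun f hf => Subtype.ext (eq_zero_of_ofFunction_eq_zero f.2 hf)

/-- The jumps and the mean of f define a Bernoulli spline with the same Fourier coefficients, and
these determine a spline. -/
theorem exists_eq_combSpline {d N : ℕ} {Δ : Mesh N} {f : ℝ → ℂ} (hf : f ∈ splineSpace d Δ) :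
    ∃ (c : ℂ) (J : Fin N → ℂ), ∑ j, J j = 0 ∧ f = combSpline d Δ.node c J := by
  obtain ⟨J, hJ, h⟩ := exists_coeff_of_mem_splineSpace hf
  refine ⟨coeff (ofFunction f) 0, J, hJ, ?_⟩
  have hg := combSpline_mem_splineSpace d Δ (coeff (ofFunction f) 0) hJ
  have h1 : (⟨f, hf⟩ : splineSpace d Δ) = ⟨_, hg⟩ := by
    refine splineDist_injective d Δ (ext_coeff fun m => ?_)
    rw [splineDist_apply, splineDist_apply, coeff_ofFunction_combSpline]
    rcases eq_or_ne m 0 with rfl | hm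
    · simp
    · rw [if_neg hm, zero_add, h m hm]
  exact congrArg Subtype.val h1

instance finiteDimensional_splineSpace (d : ℕ) {N : ℕ} (Δ : Mesh N) :
    FiniteDimensional ℂ (splineSpace d Δ) := by
  let L : (ℂ × (Fin N → ℂ)) →ₗ[ℂ] (ℝ → ℂ) :=
    { toFun := fun p => combSpline d Δ.node p.1 p.2
      map_add' := fun p q => by
        funext t
        simp only [combSpline, Prod.fst_add, Prod.snd_add, Pi.add_apply, mul_add, add_mul,
          Finset.sum_add_distrib]
        ring
      map_smul' := fun z p => by
        funext t
        simp only [combSpline, Prod.smul_fst, Prod.smul_snd, Pi.smul_apply, smul_eq_mul, mul_add,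
          Finset.mul_sum, RingHom.id_apply]
        congr 1
        exact Finset.sum_congr rfl fun j _ => by ring }
  refine Submodule.finiteDimensional_of_le (S₂ := LinearMap.range L) fun f hf => ?_
  obtain ⟨c, J, -, h⟩ := exists_eq_combSpline hf
  exact ⟨(c, J), h.symm⟩

theorem ofFunction_mem_sobolev {ρ s : ℝ} {d N : ℕ} {Δ : Mesh N} (hΔ : Δ.IsQuasiUniform ρ)
    (hs : s < d + 1 / 2) {f : ℝ → ℂ} (hf : f ∈ splineSpace d Δ) : ofFunction f ∈ sobolev s := by
  obtain ⟨c, J, hJ, rfl⟩ := exists_eq_combSpline hf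
  obtain ⟨K, C, -, -, h⟩ := exists_sobolevNorm_combDist_le ρ
    (t := s - (d + 1 : ℕ)) (by push_cast; linarith)
  exact (sobolevNorm_primitive (d + 1) (g := combDist Δ.node J) (c := c)
    (by rw [coeff_combDist, comb_zero_right, hJ])
    (fun m => coeff_ofFunction_combSpline d Δ.node c J m) s).1 (h N Δ hΔ J).1

/-- Inverse estimate for splines on quasi-uniform meshes. -/
theorem exists_inverse_estimate (d : ℕ) (ρ : ℝ) {r s : ℝ} (hrs : r ≤ s) (hs : s < d + 1 / 2) :
    ∃ C : ℝ, 0 ≤ C ∧ ∀ (N : ℕ) (Δ : Mesh N), Δ.IsQuasiUniform ρ → ∀ f ∈ splineSpace d Δ,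
      sobolevNorm s (ofFunction f) ≤ C * (N : ℝ) ^ (s - r) * sobolevNorm r (ofFunction f) := by
  have ht : s - (d + 1 : ℕ) < -1 / 2 := by push_cast; linarith
  obtain ⟨C, hC, h⟩ := exists_inverse_estimate_combDist ρ ht
    (sub_le_sub_right hrs ((d + 1 : ℕ) : ℝ))
  obtain ⟨K, C', -, -, h'⟩ := exists_sobolevNorm_combDist_le ρ ht
  refine ⟨1 + C, by positivity, fun N Δ hΔ f hf => ?_⟩
  obtain ⟨c, J, hJ, rfl⟩ := exists_eq_combSpline hf
  have hN : (1 : ℝ) ≤ N := by exact_mod_cast Δ.pos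
  have hP := sobolevNorm_primitive (d + 1) (g := combDist Δ.node J) (c := c)
    (by rw [coeff_combDist, comb_zero_right, hJ])
    (fun m => coeff_ofFunction_combSpline d Δ.node c J m)
  have hm := (h' N Δ hΔ J).1
  have h1 := (hP s).2.2 hm
  have h2 := (hP r).2.2 (sobolev_mono (by linarith) hm)
  have h3 := h N Δ hΔ J
  rw [sub_sub_sub_cancel_right] at h3
  have hP1 : 1 ≤ (N : ℝ) ^ (s - r) := Real.one_le_rpow hN (by linarith)
  refine (sq_le_sq₀ (sobolevNorm_nonneg _ _) ?_).1 ?_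
  rotate_left
  · rw [h1, mul_pow ((1 + C) * _), h2]
    set P := (N : ℝ) ^ (s - r)
    set κ : ℝ := ((2 * Real.pi) ^ (d + 1))⁻¹
    have hκ : 0 ≤ κ := by positivity
    set a := sobolevNorm (s - (d + 1 : ℕ)) (combDist Δ.node J)
    have ha : 0 ≤ a := sobolevNorm_nonneg _ _
    set b := sobolevNorm (r - (d + 1 : ℕ)) (combDist Δ.node J)
    have hb : 0 ≤ b := sobolevNorm_nonneg _ _
    have h4 : (κ * a) ^ 2 ≤ ((1 + C) * P * (κ * b)) ^ 2 := by
      refine pow_le_pow_left₀ (by positivity) ?_ 2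
      calc κ * a ≤ κ * (C * P * b) := mul_le_mul_of_nonneg_left h3 hκ
        _ = C * P * (κ * b) := by ring
        _ ≤ (1 + C) * P * (κ * b) := by gcongr; linarith
    have h5 : 1 ≤ ((1 + C) * P) ^ 2 := one_le_pow₀ (by nlinarith)
    -- The mean enters both norms alike; the constant `1 + C` instead of `C` and N ≥ 1 let it pass.
    have h6 : ‖c‖ ^ 2 ≤ ((1 + C) * P) ^ 2 * ‖c‖ ^ 2 := le_mul_of_one_le_left (sq_nonneg _) h5
    nlinarith
  · have := sobolevNorm_nonneg r (ofFunction (combSpline d Δ.node c J))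
    positivity

/-- The derivative of order `n`. -/
noncomputable def iteratedDerivDist (n : ℕ) (u : PeriodicDistribution) : PeriodicDistribution :=
  ⟨fun m => (2 * Real.pi * Complex.I * m) ^ n * coeff u m, by
    obtain ⟨k, C, h⟩ := u.2
    refine ⟨n + k, (2 * Real.pi) ^ n * C, fun m => ?_⟩
    have h1 : ‖(2 * Real.pi * Complex.I * m : ℂ)‖ ≤ 2 * Real.pi * bracket m := by
      simp only [norm_mul, Complex.norm_real, Complex.norm_I, Complex.norm_intCast]
      rw [Real.norm_of_nonneg Real.pi_pos.le, mul_one, Complex.norm_ofNat]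
      exact mul_le_mul_of_nonneg_left (le_max_right _ _) (by positivity)
    calc ‖(2 * Real.pi * Complex.I * m : ℂ) ^ n * coeff u m‖
        = ‖(2 * Real.pi * Complex.I * m : ℂ)‖ ^ n * ‖coeff u m‖ := by rw [norm_mul, norm_pow]
      _ ≤ (2 * Real.pi * bracket m) ^ n * (C * bracket m ^ k) := by
          have := bracket_pos m
          gcongr
          exact h m
      _ = (2 * Real.pi) ^ n * C * bracket m ^ (n + k) := by rw [mul_pow, pow_add]; ring⟩

theorem coeff_iteratedDerivDist (n : ℕ) (u : PeriodicDistribution) (m : ℤ) :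
    coeff (iteratedDerivDist n u) m = (2 * Real.pi * Complex.I * m) ^ n * coeff u m := rfl

/-- Simultaneous approximation by splines on quasi-uniform meshes. -/
theorem exists_spline_approximation (d : ℕ) (ρ : ℝ) {r s : ℝ} (hrs : r ≤ s)
    (hs : s < d + 1 / 2) :
    ∃ C : ℝ, 0 ≤ C ∧ ∀ (N : ℕ) (Δ : Mesh N), Δ.IsQuasiUniform ρ →
      ∀ u ∈ sobolev (d + 1), ∃ p ∈ splineSpace d Δ,
        sobolevNorm r (u - ofFunction p) ≤
          C * (N : ℝ) ^ (r - (d + 1)) * sobolevNorm (d + 1) u ∧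
        sobolevNorm s (u - ofFunction p) ≤
          C * (N : ℝ) ^ (s - (d + 1)) * sobolevNorm (d + 1) u := by
  have ht : s - (d + 1 : ℕ) < -1 / 2 := by push_cast; linarith
  -- Differentiating d + 1 times lowers the orders r and s by d + 1 and takes H^{d+1} to L².
  obtain ⟨C, hC, h⟩ := exists_comb_approximation ρ (γ := (d + 1 : ℕ) - r)
    (t := s - (d + 1 : ℕ)) (by linarith) ht
  obtain ⟨K, C', -, -, h'⟩ := exists_sobolevNorm_combDist_le ρ ht
  rw [neg_sub] at h
  refine ⟨C, hC, fun N Δ hΔ u hu => ?_⟩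
  set g := iteratedDerivDist (d + 1) u with hg
  have hg0 : coeff g 0 = 0 := by
    rw [hg, coeff_iteratedDerivDist]
    simp
  have hug : ∀ m, coeff u m = (if m = 0 then coeff u 0 else 0) +
      (2 * Real.pi * Complex.I * m)⁻¹ ^ (d + 1) * coeff g m := by
    intro m
    rcases eq_or_ne m 0 with rfl | hm
    · simp
    · have h1 : (2 * Real.pi * Complex.I * m : ℂ) ≠ 0 := by
        simp [Real.pi_ne_zero, Complex.I_ne_zero, hm]
      rw [hg, coeff_iteratedDerivDist, if_neg hm, zero_add, ← mul_assoc, ← mul_pow,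
        inv_mul_cancel₀ h1, one_pow, one_mul]
  have hu' : u ∈ sobolev ((d + 1 : ℕ) : ℝ) := by push_cast; exact hu
  have hgm : g ∈ sobolev 0 := by
    have := (sobolevNorm_primitive (d + 1) hg0 hug (d + 1 : ℕ)).2.1 hu'
    rwa [sub_self] at this
  have hgn : ((2 * Real.pi) ^ (d + 1))⁻¹ * sobolevNorm 0 g ≤ sobolevNorm (d + 1) u := by
    have := (sobolevNorm_primitive (d + 1) hg0 hug (d + 1 : ℕ)).2.2 (by rwa [sub_self])
    rw [sub_self] at this
    refine (sq_le_sq₀ (mul_nonneg (by positivity) (sobolevNorm_nonneg _ _))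
      (sobolevNorm_nonneg _ _)).1 ?_
    push_cast at this
    rw [this]
    exact le_add_of_nonneg_left (sq_nonneg _)
  obtain ⟨J, hJ, h1, h2⟩ := h N Δ hΔ g hgm hg0
  -- The approximating spline has the mean of u, and its jumps are the comb approximating the
  -- derivative of u, so the error is a primitive with mean zero.
  refine ⟨combSpline d Δ.node (coeff u 0) J, combSpline_mem_splineSpace d Δ _ hJ, ?_⟩
  have hdiff : ∀ m, coeff (u - ofFunction (combSpline d Δ.node (coeff u 0) J)) m =
      (if m = 0 then 0 else 0) +
      (2 * Real.pi * Complex.I * m)⁻¹ ^ (d + 1) * coeff (g - combDist Δ.node J) m := by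
    intro m
    rw [coeff_sub, coeff_sub, coeff_ofFunction_combSpline, hug m, coeff_combDist, ite_self]
    ring
  have hd0 : coeff (g - combDist Δ.node J) 0 = 0 := by
    rw [coeff_sub, hg0, coeff_combDist, comb_zero_right, hJ, sub_zero]
  have key : ∀ q : ℝ, q - (d + 1 : ℕ) ≤ s - (d + 1 : ℕ) →
      sobolevNorm (q - (d + 1 : ℕ)) (g - combDist Δ.node J) ≤
        C * (N : ℝ) ^ (q - (d + 1 : ℕ)) * sobolevNorm 0 g →
      sobolevNorm q (u - ofFunction (combSpline d Δ.node (coeff u 0) J)) ≤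
        C * (N : ℝ) ^ (q - (d + 1)) * sobolevNorm (d + 1) u := by
    intro q hq hb
    have hm : g - combDist Δ.node J ∈ sobolev (q - (d + 1 : ℕ)) :=
      Submodule.sub_mem _ (sobolev_mono (by linarith) hgm) (sobolev_mono hq (h' N Δ hΔ J).1)
    have h3 := (sobolevNorm_primitive (d + 1) hd0 hdiff q).2.2 hm
    rw [norm_zero, zero_pow two_ne_zero, zero_add] at h3
    have h4 := (sq_eq_sq₀ (sobolevNorm_nonneg _ _)
      (mul_nonneg (by positivity) (sobolevNorm_nonneg _ _))).1 h3
    rw [h4]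
    refine (mul_le_mul_of_nonneg_left hb (by positivity)).trans ?_
    push_cast
    calc _ = C * (N : ℝ) ^ (q - (d + 1)) * (((2 * Real.pi) ^ (d + 1))⁻¹ * sobolevNorm 0 g) := by
          ring
      _ ≤ _ := by gcongr
  exact ⟨key r (by linarith) h1, key s le_rfl h2⟩

/-! ### Discrete least squares and the doubled rate -/

theorem summable_mul_conj {F G : PeriodicDistribution} (hF : F ∈ sobolev 0) (hG : G ∈ sobolev 0) :
    Summable fun m => coeff F m * conj (coeff G m) := by
  refine Summable.of_norm ?_
  simp only [norm_mul, RCLike.norm_conj]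
  exact (summable_and_tsum_norm_mul_le (s := 0) (f := F) (by rwa [neg_zero]) hG).1

theorem norm_tsum_mul_conj_le {F G : PeriodicDistribution} (hF : F ∈ sobolev 0)
    (hG : G ∈ sobolev 0) :
    ‖∑' m, coeff F m * conj (coeff G m)‖ ≤ sobolevNorm 0 F * sobolevNorm 0 G := by
  have h := (summable_and_tsum_norm_mul_le (s := 0) (f := F) (by rwa [neg_zero]) hG).2
  rw [neg_zero] at h
  refine (norm_tsum_le_tsum_norm (summable_mul_conj hF hG).norm).trans ?_
  simpa only [norm_mul, RCLike.norm_conj] using h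

theorem discreteInner_add_left {σ : ℝ} (hσ : 1 / 2 < σ) (M : ℕ) (x₀ : ℝ)
    {F F' : PeriodicDistribution} (hF : F ∈ sobolev σ) (hF' : F' ∈ sobolev σ)
    (G : PeriodicDistribution) :
    discreteInner M x₀ (F + F') G = discreteInner M x₀ F G + discreteInner M x₀ F' G := by
  simp only [discreteInner, pointValue_add hσ hF hF', add_mul, Finset.sum_add_distrib, mul_add]

/-- Error analysis of discrete least squares in a space `X` with approximation order `γ` and an
inverse estimate. -/
theorem exists_discrete_least_squares_bound {σ τ γ β K : ℝ} (hσ : 1 / 2 < σ) (hτ : 0 < τ)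
    (hγ : γ = σ + τ) (hβ : 2 * σ + τ ≤ β * σ) (hK : 0 ≤ K) :
    ∃ (N₀ : ℕ) (C : ℝ), 0 ≤ C ∧ ∀ N : ℕ, N₀ ≤ N → 0 < N → ∀ M : ℕ, (N : ℝ) ^ β ≤ M → ∀ x₀ : ℝ,
      ∀ X : Submodule ℂ PeriodicDistribution, X ≤ sobolev σ →
      (∀ x ∈ X, sobolevNorm σ x ≤ K * (N : ℝ) ^ σ * sobolevNorm 0 x) →
      (∀ ψ ∈ sobolev γ, ∃ p ∈ X, sobolevNorm 0 (ψ - p) ≤ K * (N : ℝ) ^ (-γ) * sobolevNorm γ ψ ∧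
        sobolevNorm σ (ψ - p) ≤ K * (N : ℝ) ^ (-τ) * sobolevNorm γ ψ) →
      (∀ x ∈ X, discreteInner M x₀ x x = 0 → x = 0) ∧
      ∀ φ ∈ sobolev γ, ∀ x ∈ X, (∀ y ∈ X, discreteInner M x₀ (x - φ) y = 0) →
        sobolevNorm (-γ) (x - φ) ≤ C * (N : ℝ) ^ (-(2 * γ)) * sobolevNorm γ φ := by
  obtain ⟨Q, hQ, hquad⟩ := exists_quadrature_bound hσ
  -- The exponent is negative: βσ - 2σ ≥ τ > 0. The quantity is the relative quadrature defect on X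
  -- after the inverse estimate is used twice.
  obtain ⟨N₀, hN₀⟩ : ∃ N₀ : ℕ, ∀ N : ℕ, N₀ ≤ N → Q * K ^ 2 * (N : ℝ) ^ (-(β * σ - 2 * σ)) ≤ 1 / 2 := by
    have h1 : Filter.Tendsto (fun N : ℕ => Q * K ^ 2 * (N : ℝ) ^ (-(β * σ - 2 * σ))) Filter.atTop
        (nhds (Q * K ^ 2 * 0)) :=
      ((tendsto_rpow_neg_atTop (by linarith)).comp tendsto_natCast_atTop_atTop).const_mul _
    rw [mul_zero] at h1
    exact Filter.eventually_atTop.1 (h1.eventually (ge_mem_nhds (by norm_num)))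
  set C₁ := 2 * (K + Q * K ^ 2) with hC₁
  -- Large enough for both `C₁ + K` and `K * C₁ + K`, the constants of the L² and H^σ errors.
  set C₂ := (C₁ + K) * (1 + K) with hC₂
  have hC₁0 : 0 ≤ C₁ := by positivity
  have hC₂0 : 0 ≤ C₂ := by positivity
  refine ⟨N₀, C₂ * K + Q * C₂ * (1 + K), by positivity, ?_⟩
  intro N hN hNpos M hM x₀ X hXσ hinv happ
  have hN0 : (0 : ℝ) < N := by exact_mod_cast hNpos
  have hN1 : (1 : ℝ) ≤ N := by exact_mod_cast hNpos
  have hM0 : 0 < M := by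
    have : (0 : ℝ) < M := lt_of_lt_of_le (by positivity) hM
    exact_mod_cast this
  have hMσ : (M : ℝ) ^ (-σ) ≤ (N : ℝ) ^ (-(β * σ)) := by
    have h := Real.rpow_le_rpow_of_nonpos (z := -σ) (by positivity) hM (by linarith)
    rwa [← Real.rpow_mul hN0.le, mul_neg] at h
  have hσ0 : sobolev σ ≤ sobolev 0 := sobolev_mono (by linarith)
  have hγσ : sobolev γ ≤ sobolev σ := sobolev_mono (by linarith)
  have hq : ∀ F ∈ sobolev σ, ∀ G ∈ sobolev σ,
      ‖discreteInner M x₀ F G - ∑' m, coeff F m * conj (coeff G m)‖ ≤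
        Q * (N : ℝ) ^ (-(β * σ)) * (sobolevNorm σ F * sobolevNorm σ G) := by
    intro F hF G hG
    refine (hquad M hM0 x₀ F hF G hG).trans ?_
    have h1 := sobolevNorm_nonneg σ F
    have h2 := sobolevNorm_nonneg σ G
    gcongr
  have hstab : ∀ x ∈ X, sobolevNorm 0 x ^ 2 ≤ 2 * ‖discreteInner M x₀ x x‖ := by
    intro x hx
    have h1 := hq x (hXσ hx) x (hXσ hx)
    have h2 : ∑' m, coeff x m * conj (coeff x m) = ((sobolevNorm 0 x ^ 2 : ℝ) : ℂ) := by
      rw [sobolevNorm_sq, Complex.ofReal_tsum]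
      refine tsum_congr fun m => ?_
      rw [Complex.mul_conj, Complex.normSq_eq_norm_sq]
      simp
    have h3 : ‖((sobolevNorm 0 x ^ 2 : ℝ) : ℂ)‖ = sobolevNorm 0 x ^ 2 := by
      rw [Complex.norm_real, Real.norm_of_nonneg (sq_nonneg _)]
    have h4 : sobolevNorm 0 x ^ 2 ≤ ‖discreteInner M x₀ x x‖ +
        Q * (N : ℝ) ^ (-(β * σ)) * (sobolevNorm σ x * sobolevNorm σ x) := by
      rw [h2] at h1
      rw [← h3]
      have := norm_sub_norm_le ((sobolevNorm 0 x ^ 2 : ℝ) : ℂ) (discreteInner M x₀ x x)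
      rw [norm_sub_rev] at this
      linarith
    have h5 := hinv x hx
    have h6 := sobolevNorm_nonneg 0 x
    have h7 := sobolevNorm_nonneg σ x
    have h8 : Q * (N : ℝ) ^ (-(β * σ)) * (sobolevNorm σ x * sobolevNorm σ x) ≤
        1 / 2 * sobolevNorm 0 x ^ 2 := by
      calc _ ≤ Q * (N : ℝ) ^ (-(β * σ)) * ((K * (N : ℝ) ^ σ * sobolevNorm 0 x) *
            (K * (N : ℝ) ^ σ * sobolevNorm 0 x)) := by gcongr
        _ = Q * K ^ 2 * ((N : ℝ) ^ (-(β * σ)) * (N : ℝ) ^ σ * (N : ℝ) ^ σ) *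
            sobolevNorm 0 x ^ 2 := by ring
        _ = Q * K ^ 2 * (N : ℝ) ^ (-(β * σ - 2 * σ)) * sobolevNorm 0 x ^ 2 := by
            rw [← Real.rpow_add hN0, ← Real.rpow_add hN0]
            congr 3
            ring
        _ ≤ _ := mul_le_mul_of_nonneg_right (hN₀ N hN) (sq_nonneg _)
    linarith
  refine ⟨fun x hx h0 => ?_, fun φ hφ x hx horth => ?_⟩
  · have h1 := hstab x hx
    rw [h0, norm_zero, mul_zero] at h1
    exact eq_zero_of_sobolevNorm_eq_zero (hσ0 (hXσ hx))
      (pow_eq_zero_iff two_ne_zero |>.1 (le_antisymm h1 (sq_nonneg _)))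
  obtain ⟨p, hp, hp0, hpσ⟩ := happ φ hφ
  have hL := sobolevNorm_nonneg γ φ
  set L := sobolevNorm γ φ
  have hz : x - p ∈ X := X.sub_mem hx hp
  have hφσ := hγσ hφ
  have hφp : φ - p ∈ sobolev σ := Submodule.sub_mem _ hφσ (hXσ hp)
  have hE : x - φ ∈ sobolev σ := Submodule.sub_mem _ (hXσ hx) hφσ
  have hz0 : sobolevNorm 0 (x - p) ≤ C₁ * (N : ℝ) ^ (-γ) * L := by
    -- Discrete orthogonality lets φ replace x in the first argument, so coercivity turns the
    -- approximation error of p into a bound for x - p.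
    have h1 : discreteInner M x₀ (x - p) (x - p) = discreteInner M x₀ (φ - p) (x - p) := by
      have e : x - p = (x - φ) + (φ - p) := by abel
      have := discreteInner_add_left hσ M x₀ hE hφp (x - p)
      rw [← e, horth _ hz, zero_add] at this
      exact this
    have h2 := hstab _ hz
    rw [h1] at h2
    have h3 := hq _ hφp _ (hXσ hz)
    have h4 := norm_tsum_mul_conj_le (hσ0 hφp) (hσ0 (hXσ hz))
    have h5 := hinv _ hz
    have hzn := sobolevNorm_nonneg 0 (x - p)
    set Z := sobolevNorm 0 (x - p)
    have h6 : ‖discreteInner M x₀ (φ - p) (x - p)‖ ≤ (K + Q * K ^ 2) * (N : ℝ) ^ (-γ) * L * Z := by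
      have h7 := norm_le_norm_add_norm_sub'
        (discreteInner M x₀ (φ - p) (x - p)) (∑' m, coeff (φ - p) m * conj (coeff (x - p) m))
      have h8 : Q * (N : ℝ) ^ (-(β * σ)) * (sobolevNorm σ (φ - p) * sobolevNorm σ (x - p)) ≤
          Q * K ^ 2 * (N : ℝ) ^ (-γ) * L * Z := by
        have hn := sobolevNorm_nonneg σ (φ - p)
        have hn' := sobolevNorm_nonneg σ (x - p)
        calc _ ≤ Q * (N : ℝ) ^ (-(β * σ)) * ((K * (N : ℝ) ^ (-τ) * L) * (K * (N : ℝ) ^ σ * Z)) := by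
              gcongr
          _ = Q * K ^ 2 * ((N : ℝ) ^ (-(β * σ)) * (N : ℝ) ^ (-τ) * (N : ℝ) ^ σ) * L * Z := by ring
          _ = Q * K ^ 2 * (N : ℝ) ^ (-(β * σ) + -τ + σ) * L * Z := by
              rw [← Real.rpow_add hN0, ← Real.rpow_add hN0]
          _ ≤ _ := by
              gcongr
              linarith
      have h9 : sobolevNorm 0 (φ - p) * Z ≤ K * (N : ℝ) ^ (-γ) * L * Z := by gcongr
      calc _ ≤ _ := h7
        _ ≤ K * (N : ℝ) ^ (-γ) * L * Z + Q * K ^ 2 * (N : ℝ) ^ (-γ) * L * Z :=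
            add_le_add (h4.trans h9) (h3.trans h8)
        _ = _ := by ring
    rcases hzn.eq_or_lt with h0 | h0
    · rw [← h0]
      positivity
    · refine le_of_mul_le_mul_right ?_ h0
      calc Z * Z = Z ^ 2 := (sq Z).symm
        _ ≤ 2 * ((K + Q * K ^ 2) * (N : ℝ) ^ (-γ) * L * Z) := by linarith
        _ = _ := by rw [hC₁]; ring
  have hEeq : x - φ = (x - p) - (φ - p) := by abel
  have hE0 : sobolevNorm 0 (x - φ) ≤ C₂ * (N : ℝ) ^ (-γ) * L := by
    rw [hEeq]
    refine (sobolevNorm_sub_le (hσ0 (hXσ hz)) (hσ0 hφp)).trans ((add_le_add hz0 hp0).trans ?_)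
    rw [← add_mul, ← add_mul]
    gcongr
    nlinarith
  have hEσ : sobolevNorm σ (x - φ) ≤ C₂ * (N : ℝ) ^ (-τ) * L := by
    have h1 : sobolevNorm σ (x - p) ≤ K * C₁ * (N : ℝ) ^ (-τ) * L := by
      refine (hinv _ hz).trans ?_
      calc _ ≤ K * (N : ℝ) ^ σ * (C₁ * (N : ℝ) ^ (-γ) * L) := by gcongr
        _ = K * C₁ * ((N : ℝ) ^ σ * (N : ℝ) ^ (-γ)) * L := by ring
        _ = _ := by
            rw [← Real.rpow_add hN0, hγ]
            congr 3
            ring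
    rw [hEeq]
    refine (sobolevNorm_sub_le (hXσ hz) hφp).trans ((add_le_add h1 hpσ).trans ?_)
    rw [← add_mul, ← add_mul]
    gcongr
    nlinarith
  have hEγ : x - φ ∈ sobolev (-γ) := sobolev_mono (by linarith) hE
  set E := x - φ with hEdef
  -- The dual function: its pairing with E is ‖E‖² in H^{-γ}, and its H^γ norm equals the H^{-γ}
  -- norm of E.
  set ψ := bessel (2 * (-γ)) E with hψ
  have hψm : ψ ∈ sobolev γ := by
    rw [hψ, bessel_mem_sobolev_iff]
    convert hEγ using 2
    ring
  have hψn : sobolevNorm γ ψ = sobolevNorm (-γ) E := by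
    rw [hψ, sobolevNorm_bessel]
    congr 1
    ring
  obtain ⟨q, hqX, hq0, hqσ⟩ := happ ψ hψm
  rw [hψn] at hq0 hqσ
  have hRn := sobolevNorm_nonneg (-γ) E
  set R := sobolevNorm (-γ) E with hR
  have hψq : ψ - q ∈ sobolev σ := Submodule.sub_mem _ (hγσ hψm) (hXσ hqX)
  have hqn : sobolevNorm σ q ≤ (1 + K) * R := by
    have e : q = ψ - (ψ - q) := by abel
    rw [e]
    refine (sobolevNorm_sub_le (hγσ hψm) hψq).trans ?_
    have h1 : sobolevNorm σ ψ ≤ R := by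
      rw [← hψn]
      exact sobolevNorm_mono (by linarith) hψm
    have h2 : (N : ℝ) ^ (-τ) ≤ 1 := Real.rpow_le_one_of_one_le_of_nonpos hN1 (by linarith)
    have h3 : K * (N : ℝ) ^ (-τ) * R ≤ K * 1 * R := by gcongr
    linarith
  have hR2 : R ^ 2 ≤ (C₂ * K + Q * C₂ * (1 + K)) * (N : ℝ) ^ (-(2 * γ)) * L * R := by
    -- Since the discrete product of E and q vanishes, their L² pairing is only a quadrature error.
    have h1 : ((R ^ 2 : ℝ) : ℂ) = ∑' m, coeff E m * conj (coeff (ψ - q) m) -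
        (discreteInner M x₀ E q - ∑' m, coeff E m * conj (coeff q m)) := by
      rw [horth q hqX, zero_sub, sub_neg_eq_add, ← (summable_mul_conj (hσ0 hE) (hσ0 hψq)).tsum_add
        (summable_mul_conj (hσ0 hE) (hσ0 (hXσ hqX))), hR, ← tsum_mul_conj_bessel]
      refine tsum_congr fun m => ?_
      rw [← mul_add, ← map_add, coeff_sub ψ q, sub_add_cancel]
    have h2 : R ^ 2 = ‖((R ^ 2 : ℝ) : ℂ)‖ := by
      rw [Complex.norm_real, Real.norm_of_nonneg (sq_nonneg _)]
    have h3 := norm_tsum_mul_conj_le (hσ0 hE) (hσ0 hψq)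
    have h4 := hq E hE q (hXσ hqX)
    have hn1 := sobolevNorm_nonneg 0 E
    have hn2 := sobolevNorm_nonneg 0 (ψ - q)
    have hn3 := sobolevNorm_nonneg σ E
    have hn4 := sobolevNorm_nonneg σ q
    have h5 : sobolevNorm 0 E * sobolevNorm 0 (ψ - q) ≤ C₂ * K * (N : ℝ) ^ (-(2 * γ)) * L * R := by
      calc _ ≤ (C₂ * (N : ℝ) ^ (-γ) * L) * (K * (N : ℝ) ^ (-γ) * R) := by gcongr
        _ = C₂ * K * ((N : ℝ) ^ (-γ) * (N : ℝ) ^ (-γ)) * L * R := by ring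
        _ = _ := by
            rw [← Real.rpow_add hN0]
            congr 4
            ring
    -- The full strength of `hβ` is used here: βσ + τ ≥ 2σ + 2τ = 2γ.
    have h6 : Q * (N : ℝ) ^ (-(β * σ)) * (sobolevNorm σ E * sobolevNorm σ q) ≤
        Q * C₂ * (1 + K) * (N : ℝ) ^ (-(2 * γ)) * L * R := by
      calc _ ≤ Q * (N : ℝ) ^ (-(β * σ)) * ((C₂ * (N : ℝ) ^ (-τ) * L) * ((1 + K) * R)) := by gcongr
        _ = Q * C₂ * (1 + K) * ((N : ℝ) ^ (-(β * σ)) * (N : ℝ) ^ (-τ)) * L * R := by ring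
        _ = Q * C₂ * (1 + K) * (N : ℝ) ^ (-(β * σ) + -τ) * L * R := by rw [← Real.rpow_add hN0]
        _ ≤ _ := by
            gcongr
            linarith
    rw [h2, h1]
    refine (norm_sub_le _ _).trans ((add_le_add (h3.trans h5) (h4.trans h6)).trans (le_of_eq ?_))
    ring
  rcases hRn.eq_or_lt with h0 | h0
  · rw [← h0]
    positivity
  · refine le_of_mul_le_mul_right ?_ h0
    rw [← sq]
    exact hR2

end OversampledCollocation

/-! ### Normal equations as an orthogonality relation -/

namespace OversampledCollocation
open ComplexConjugate Matrix

theorem arcWeight_equispaced (M : ℕ) (x₀ : ℝ) (j : ℤ) :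
    arcWeight (equispaced M x₀) j = 1 / M := by
  simp only [arcWeight, equispaced]
  push_cast
  ring

/-- Equal weights are a nonzero scalar and cancel, which leaves orthogonality of the residual to
each column of G. -/
theorem normalEquations_iff {m n : Type*} [Fintype m] [Fintype n] [DecidableEq m]
    (G : Matrix m n ℂ) {W : Matrix m m ℂ} {c : ℂ} (hW : W = diagonal fun _ => c) (hc : c ≠ 0)
    (a : n → ℂ) (b : m → ℂ) : (Gᴴ * W * G) *ᵥ a = (Gᴴ * W) *ᵥ b ↔
      ∀ i, ∑ j, ((G *ᵥ a) j - b j) * conj (G j i) = 0 := by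
  rw [← mulVec_mulVec, ← sub_eq_zero, ← mulVec_sub, ← mulVec_mulVec, funext_iff]
  refine forall_congr' fun i => ?_
  have h : (Gᴴ *ᵥ (W *ᵥ (G *ᵥ a - b))) i =
      c * ∑ j, ((G *ᵥ a) j - b j) * conj (G j i) := by
    rw [mulVec, dotProduct, Finset.mul_sum]
    refine Finset.sum_congr rfl fun j _ => ?_
    rw [hW, mulVec_diagonal, conjTranspose_apply, Pi.sub_apply, ← starRingEnd_apply]
    ring
  rw [h, Pi.zero_apply, mul_eq_zero, or_iff_right hc]

/-- Project b orthogonally onto the range of T. No injectivity is needed for existence. -/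
theorem exists_least_squares {S : Type*} [AddCommGroup S] [Module ℂ S] {m : Type*} [Fintype m]
    (T : S →ₗ[ℂ] m → ℂ) (b : m → ℂ) :
    ∃ v : S, ∀ χ : S, ∑ j, (T v j - b j) * conj (T χ j) = 0 := by
  let e := (WithLp.linearEquiv 2 ℂ (m → ℂ)).symm
  let U : Submodule ℂ (EuclideanSpace ℂ m) := LinearMap.range (e.toLinearMap ∘ₗ T)
  obtain ⟨v, hv⟩ := U.starProjection_apply_mem (e b)
  refine ⟨v, fun χ => ?_⟩
  have h := (U.mem_orthogonal _).1 (U.sub_starProjection_mem_orthogonal (e b)) (e (T χ)) ⟨χ, rfl⟩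
  rw [← hv, PiLp.inner_apply] at h
  rw [← neg_eq_zero, ← h, ← Finset.sum_neg_distrib]
  refine Finset.sum_congr rfl fun j _ => ?_
  rw [RCLike.inner_apply]
  simp [e]
  ring

/-- The hypothesis gives ‖t‖² = ⟨b, t⟩, so an orthogonal projection does not increase the norm. -/
theorem sum_norm_sq_le_of_least_squares {m : Type*} [Fintype m] {t b : m → ℂ}
    (h : ∑ j, (t j - b j) * conj (t j) = 0) : ∑ j, ‖t j‖ ^ 2 ≤ ∑ j, ‖b j‖ ^ 2 := by
  have h1 : ((∑ j, ‖t j‖ ^ 2 : ℝ) : ℂ) = ∑ j, b j * conj (t j) := by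
    rw [← sub_eq_zero, ← h]
    push_cast
    rw [← Finset.sum_sub_distrib]
    refine Finset.sum_congr rfl fun j _ => ?_
    rw [sub_mul, Complex.mul_conj, Complex.normSq_eq_norm_sq]
    push_cast
    rfl
  have h2 : ∑ j, ‖t j‖ ^ 2 ≤ ∑ j, ‖b j‖ * ‖t j‖ := by
    have h3 : ∑ j, ‖t j‖ ^ 2 = ‖((∑ j, ‖t j‖ ^ 2 : ℝ) : ℂ)‖ := by
      rw [Complex.norm_real, Real.norm_of_nonneg (Finset.sum_nonneg fun j _ => sq_nonneg _)]
    rw [h3, h1]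
    refine (norm_sum_le _ _).trans (le_of_eq ?_)
    simp only [norm_mul, RCLike.norm_conj]
  have h4 : ∑ j, ‖b j‖ * ‖t j‖ ≤ ∑ j, (‖b j‖ ^ 2 + ‖t j‖ ^ 2) / 2 :=
    Finset.sum_le_sum fun j _ => by nlinarith [sq_nonneg (‖b j‖ - ‖t j‖)]
  rw [← Finset.sum_div, Finset.sum_add_distrib] at h4
  linarith

variable {σ : ℝ} {V : PeriodicDistribution →ₗ[ℂ] PeriodicDistribution} {d N : ℕ} {Δ : Mesh N}

/-- The values of `V χ` at the collocation points. -/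
noncomputable def collocationTrace (hσ : 1 / 2 < σ)
    (hS : ∀ χ : splineSpace d Δ, V (splineDist d Δ χ) ∈ sobolev σ) (M : ℕ) (x₀ : ℝ) :
    splineSpace d Δ →ₗ[ℂ] Fin M → ℂ where
  toFun χ j := pointValue (V (splineDist d Δ χ)) (equispaced M x₀ ((j : ℕ) + 1))
  map_add' χ ψ := by
    funext j
    rw [map_add, map_add, pointValue_add hσ (hS χ) (hS ψ)]
    rfl
  map_smul' z χ := by
    funext j
    rw [map_smul, map_smul, pointValue_smul]
    rfl

theorem collocationTrace_apply (hσ : 1 / 2 < σ)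
    (hS : ∀ χ : splineSpace d Δ, V (splineDist d Δ χ) ∈ sobolev σ) (M : ℕ) (x₀ : ℝ)
    (χ : splineSpace d Δ) (j : Fin M) : collocationTrace hσ hS M x₀ χ j =
      pointValue (V (ofFunction χ)) (equispaced M x₀ ((j : ℕ) + 1)) := rfl

/-- Testing against the basis vectors is the same as testing against all splines, by conjugate
linearity. This removes the basis from the definition, so the choice of basis plays no role
afterwards. -/
theorem isCollocationSolution_iff (hσ : 1 / 2 < σ)
    (hS : ∀ χ : splineSpace d Δ, V (splineDist d Δ χ) ∈ sobolev σ) {M : ℕ} (hM : 0 < M) (x₀ : ℝ)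
    (f : PeriodicDistribution) (v : ℝ → ℂ) :
    IsCollocationSolution V (splineSpace d Δ) M (equispaced M x₀) f v ↔
      ∃ w : splineSpace d Δ, v = w ∧ ∀ χ, ∑ j, (collocationTrace hσ hS M x₀ w j -
        pointValue f (equispaced M x₀ ((j : ℕ) + 1))) *
          conj (collocationTrace hσ hS M x₀ χ j) = 0 := by
  set T := collocationTrace hσ hS M x₀ with hT
  set b : Fin M → ℂ := fun j => pointValue f (equispaced M x₀ ((j : ℕ) + 1)) with hb
  have hc : ((1 / M : ℝ) : ℂ) ≠ 0 := by
    have : (M : ℂ) ≠ 0 := by exact_mod_cast hM.ne'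
    push_cast
    exact one_div_ne_zero this
  have key : ∀ (n : ℕ) (φ : Module.Basis (Fin n) ℂ (splineSpace d Δ)) (a : Fin n → ℂ),
      (let G := collocationMatrix V M (equispaced M x₀) fun i => (φ i : ℝ → ℂ)
       let W := weightMatrix M (equispaced M x₀)
       (Gᴴ * W * G) *ᵥ a = (Gᴴ * W) *ᵥ b) ↔
      ∀ χ, ∑ j, (T (∑ i, a i • φ i) j - b j) * conj (T χ j) = 0 := by
    intro n φ a
    simp only [weightMatrix, arcWeight_equispaced]
    rw [normalEquations_iff _ rfl hc]
    have hG : ∀ j, (collocationMatrix V M (equispaced M x₀) (fun i => (φ i : ℝ → ℂ)) *ᵥ a) j =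
        T (∑ i, a i • φ i) j := by
      intro j
      rw [map_sum, Finset.sum_apply, mulVec, dotProduct]
      refine Finset.sum_congr rfl fun i _ => ?_
      rw [map_smul, Pi.smul_apply, smul_eq_mul, mul_comm]
      rfl
    simp only [hG]
    refine ⟨fun h χ => ?_, fun h i => h (φ i)⟩
    have e : ∀ j, conj (T χ j) = ∑ i, conj (φ.repr χ i) * conj (T (φ i) j) := by
      intro j
      conv_lhs => rw [← φ.sum_repr χ]
      rw [map_sum, Finset.sum_apply, map_sum]
      refine Finset.sum_congr rfl fun i _ => ?_
      rw [map_smul, Pi.smul_apply, smul_eq_mul, map_mul]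
    simp only [e, Finset.mul_sum]
    rw [Finset.sum_comm]
    refine Finset.sum_eq_zero fun i _ => ?_
    calc _ = conj (φ.repr χ i) * ∑ j, (T (∑ i, a i • φ i) j - b j) * conj (T (φ i) j) := by
          rw [Finset.mul_sum]
          exact Finset.sum_congr rfl fun j _ => by ring
      _ = 0 := by
          have h1 := h i
          rw [show (∑ j, (T (∑ i, a i • φ i) j - b j) * conj (T (φ i) j)) = 0 from h1, mul_zero]
  constructor
  · rintro ⟨n, φ, a, h, rfl⟩
    exact ⟨∑ i, a i • φ i, by simp, (key n φ a).1 h⟩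
  · rintro ⟨w, rfl, h⟩
    let φ := Module.finBasis ℂ (splineSpace d Δ)
    have hw : ∑ i, φ.repr w i • φ i = w := φ.sum_repr w
    refine ⟨_, φ, fun i => φ.repr w i, (key _ φ _).2 (by rwa [hw]), ?_⟩
    have h1 := congrArg Subtype.val hw
    rw [Submodule.coe_sum] at h1
    exact h1.symm

/-- A solution always exists, and solutions differ by the kernel of the collocation map. Unique
solvability is thus independent of f. -/
theorem existsUnique_isCollocationSolution_iff (hσ : 1 / 2 < σ)
    (hS : ∀ χ : splineSpace d Δ, V (splineDist d Δ χ) ∈ sobolev σ) {M : ℕ} (hM : 0 < M) (x₀ : ℝ)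
    (f : PeriodicDistribution) :
    (∃! v, IsCollocationSolution V (splineSpace d Δ) M (equispaced M x₀) f v) ↔
      Function.Injective (collocationTrace hσ hS M x₀) := by
  simp only [isCollocationSolution_iff hσ hS hM]
  set T := collocationTrace hσ hS M x₀
  set b : Fin M → ℂ := fun j => pointValue f (equispaced M x₀ ((j : ℕ) + 1))
  constructor
  · rintro ⟨v, ⟨w, rfl, hw⟩, huniq⟩
    rw [injective_iff_map_eq_zero]
    intro z hz
    have h := huniq (w + z : splineSpace d Δ) ⟨w + z, rfl, fun χ => by
      rw [map_add, hz, add_zero]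
      exact hw χ⟩
    simpa using Subtype.ext h
  · intro hT
    obtain ⟨w, hw⟩ := exists_least_squares T b
    refine ⟨w, ⟨w, rfl, hw⟩, ?_⟩
    rintro _ ⟨w', rfl, hw'⟩
    have h1 : T (w' - w) = 0 := by
      have h2 : ∑ j, (T (w' - w) j - (0 : Fin M → ℂ) j) * conj (T (w' - w) j) = 0 := by
        have e1 : ∑ j, (T w j - b j) * conj (T (w' - w) j) = 0 := hw (w' - w)
        have e2 : ∑ j, (T w' j - b j) * conj (T (w' - w) j) = 0 := hw' (w' - w)
        refine Eq.trans ?_ (sub_eq_zero.2 (e2.trans e1.symm))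
        rw [← Finset.sum_sub_distrib]
        refine Finset.sum_congr rfl fun j _ => ?_
        rw [map_sub, Pi.sub_apply, Pi.zero_apply]
        ring
      have h3 := sum_norm_sq_le_of_least_squares h2
      simp only [Pi.zero_apply, norm_zero] at h3
      rw [Finset.sum_eq_zero (s := Finset.univ) (f := fun _ : Fin M => (0 : ℝ) ^ 2)
        (fun _ _ => by simp)] at h3
      funext j
      have h4 := (Finset.sum_eq_zero_iff_of_nonneg fun j _ => sq_nonneg _).1
        (le_antisymm h3 (Finset.sum_nonneg fun j _ => sq_nonneg _)) j (Finset.mem_univ j)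
      simpa using h4
    have h5 := hT (h1.trans (map_zero T).symm)
    rw [sub_eq_zero.1 h5]

/-! ### Transfer of the spline estimates through V -/

/-- Take s to be the midpoint of p and q. Any pair of orders differing by 2α is then available, with
constants made non-negative. -/
theorem IsIsomorphismOfOrder.mapping {α : ℝ} (hV : IsIsomorphismOfOrder α V) {p q : ℝ}
    (hpq : p - q = 2 * α) :
    (∀ g ∈ sobolev p, V g ∈ sobolev q) ∧
    (∃ A : ℝ, 0 ≤ A ∧ ∀ g ∈ sobolev p, sobolevNorm q (V g) ≤ A * sobolevNorm p g) ∧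
    (∀ f ∈ sobolev q, ∃ g ∈ sobolev p, V g = f) ∧
    (∃ A : ℝ, 0 ≤ A ∧ ∀ g ∈ sobolev p, sobolevNorm p g ≤ A * sobolevNorm q (V g)) := by
  obtain ⟨h1, ⟨A, hA⟩, h3, ⟨B, hB⟩⟩ := hV ((p + q) / 2)
  have e1 : (p + q) / 2 + α = p := by linarith
  have e2 : (p + q) / 2 - α = q := by linarith
  rw [e1] at h1 hA h3 hB
  rw [e2] at h1 hA h3 hB
  refine ⟨h1, ⟨|A|, abs_nonneg _, fun g hg => (hA g hg).trans ?_⟩, fun f hf => ?_,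
    ⟨|B|, abs_nonneg _, fun g hg => (hB g hg).trans ?_⟩⟩
  · exact mul_le_mul_of_nonneg_right (le_abs_self A) (sobolevNorm_nonneg _ _)
  · obtain ⟨g, ⟨hg, rfl⟩, -⟩ := h3 f hf
    exact ⟨g, hg, rfl⟩
  · exact mul_le_mul_of_nonneg_right (le_abs_self B) (sobolevNorm_nonneg _ _)

/-- The images of the spline spaces have approximation order `γ` and an inverse estimate. -/
theorem exists_image_estimates {α : ℝ} (hV : IsIsomorphismOfOrder α V) (d : ℕ) (ρ : ℝ)
    {σ τ γ : ℝ} (hσ : 0 ≤ σ) (hτ : 1 / 2 < τ) (hγ : γ = σ + τ) (hγα : γ = d + 1 - 2 * α) :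
    ∃ K : ℝ, 0 ≤ K ∧ ∀ (N : ℕ) (Δ : Mesh N), Δ.IsQuasiUniform ρ →
      (∀ f ∈ splineSpace d Δ, sobolevNorm σ (V (ofFunction f)) ≤
        K * (N : ℝ) ^ σ * sobolevNorm 0 (V (ofFunction f))) ∧
      ∀ ψ ∈ sobolev γ, ∃ p ∈ splineSpace d Δ,
        sobolevNorm 0 (ψ - V (ofFunction p)) ≤ K * (N : ℝ) ^ (-γ) * sobolevNorm γ ψ ∧
        sobolevNorm σ (ψ - V (ofFunction p)) ≤ K * (N : ℝ) ^ (-τ) * sobolevNorm γ ψ := by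
  -- V takes the orders 2α, d + 1 - τ and d + 1 to 0, σ and γ. The middle one is admissible for
  -- splines because τ > 1/2.
  have hrs : 2 * α ≤ d + 1 - τ := by linarith
  have hs : d + 1 - τ < d + 1 / 2 := by linarith
  obtain ⟨C, hC, hinv⟩ := exists_inverse_estimate d ρ hrs hs
  obtain ⟨C', hC', happ⟩ := exists_spline_approximation d ρ hrs hs
  obtain ⟨-, ⟨A, hA, hVA⟩, -, ⟨A', hA', hVA'⟩⟩ := hV.mapping (p := 2 * α) (q := 0) (by ring)
  obtain ⟨-, ⟨B, hB, hVB⟩, -, -⟩ := hV.mapping (p := d + 1 - τ) (q := σ) (by linarith)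
  obtain ⟨-, -, hsurj, ⟨D, hD, hVD⟩⟩ := hV.mapping (p := d + 1) (q := γ) (by linarith)
  refine ⟨B * C * A' + A * C' * D + B * C' * D, by positivity, fun N Δ hΔ => ⟨fun f hf => ?_,
    fun ψ hψ => ?_⟩⟩
  · have hm := ofFunction_mem_sobolev hΔ hs hf
    have h1 := hVB _ hm
    have h2 := hinv N Δ hΔ f hf
    have h3 := hVA' _ (sobolev_mono hrs hm)
    have e : (d : ℝ) + 1 - τ - 2 * α = σ := by linarith
    rw [e] at h2
    have h4 := sobolevNorm_nonneg 0 (V (ofFunction f))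
    calc _ ≤ B * (C * (N : ℝ) ^ σ * (A' * sobolevNorm 0 (V (ofFunction f)))) :=
          h1.trans (mul_le_mul_of_nonneg_left (h2.trans (mul_le_mul_of_nonneg_left h3
            (by positivity))) hB)
      _ = B * C * A' * (N : ℝ) ^ σ * sobolevNorm 0 (V (ofFunction f)) := by ring
      _ ≤ _ := by
          gcongr
          rw [add_assoc]
          exact le_add_of_nonneg_right (by positivity)
  · obtain ⟨w, hw, rfl⟩ := hsurj ψ hψ
    have hwn := hVD w hw
    obtain ⟨p, hp, h1, h2⟩ := happ N Δ hΔ w hw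
    have hm : w - ofFunction p ∈ sobolev (d + 1 - τ) :=
      Submodule.sub_mem _ (sobolev_mono (by linarith) hw) (ofFunction_mem_sobolev hΔ hs hp)
    have e1 : 2 * α - (d + 1) = -γ := by linarith
    have e2 : (d : ℝ) + 1 - τ - (d + 1) = -τ := by ring
    rw [e1] at h1
    rw [e2] at h2
    have h5 := sobolevNorm_nonneg γ (V w)
    refine ⟨p, hp, ?_, ?_⟩ <;> rw [← map_sub]
    · calc _ ≤ A * (C' * (N : ℝ) ^ (-γ) * (D * sobolevNorm γ (V w))) :=
            (hVA _ (sobolev_mono hrs hm)).trans (mul_le_mul_of_nonneg_left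
              (h1.trans (mul_le_mul_of_nonneg_left hwn (by positivity))) hA)
        _ = A * C' * D * (N : ℝ) ^ (-γ) * sobolevNorm γ (V w) := by ring
        _ ≤ _ := by
            gcongr
            have : 0 ≤ B * C * A' := by positivity
            have : 0 ≤ B * C' * D := by positivity
            linarith
    · calc _ ≤ B * (C' * (N : ℝ) ^ (-τ) * (D * sobolevNorm γ (V w))) :=
            (hVB _ hm).trans (mul_le_mul_of_nonneg_left
              (h2.trans (mul_le_mul_of_nonneg_left hwn (by positivity))) hB)
        _ = B * C' * D * (N : ℝ) ^ (-τ) * sobolevNorm γ (V w) := by ring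
        _ ≤ _ := by
            gcongr
            have : 0 ≤ B * C * A' := by positivity
            have : 0 ≤ A * C' * D := by positivity
            linarith

end OversampledCollocation

/-! ### Choice of exponents and the two error bounds -/

namespace OversampledCollocation
open ComplexConjugate

variable {V : PeriodicDistribution →ₗ[ℂ] PeriodicDistribution}

/-- On one mesh, the collocation approximations are bounded by the data. -/
theorem exists_bound_of_fixed_mesh {σ ρ r : ℝ} {d N : ℕ} {Δ : Mesh N} (hσ : 1 / 2 < σ)
    (hS : ∀ χ : splineSpace d Δ, V (splineDist d Δ χ) ∈ sobolev σ) (hΔ : Δ.IsQuasiUniform ρ)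
    (hr : r < d + 1 / 2) {M : ℕ} (hM : 0 < M) (x₀ : ℝ) :
    ∃ C : ℝ, 0 ≤ C ∧ ∀ f ∈ sobolev σ,
      (∃! v, IsCollocationSolution V (splineSpace d Δ) M (equispaced M x₀) f v) →
      ∀ v, IsCollocationSolution V (splineSpace d Δ) M (equispaced M x₀) f v →
        sobolevNorm r (ofFunction v) ≤ C * sobolevNorm σ f := by
  by_cases hT : Function.Injective (collocationTrace hσ hS M x₀)
  · set T := collocationTrace hσ hS M x₀ with hTdef
    -- The solution is recovered linearly from its M values at the collocation points, and these are
    -- bounded by the data because least squares is a projection.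
    obtain ⟨L, hL⟩ := T.exists_leftInverse_of_injective (LinearMap.ker_eq_bot.2 hT)
    set B : ℝ := ∑ j, sobolevNorm r (splineDist d Δ (L (Pi.single j 1)))
    set P := Real.sqrt (∑' m : ℤ, (bracket m ^ (-σ)) ^ 2)
    have hB : 0 ≤ B := Finset.sum_nonneg fun j _ => sobolevNorm_nonneg _ _
    refine ⟨Real.sqrt M * P * B, by positivity, fun f hf _ v hv => ?_⟩
    obtain ⟨w, rfl, hw⟩ := (isCollocationSolution_iff hσ hS hM x₀ f v).1 hv
    have hfn := sobolevNorm_nonneg σ f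
    have h1 : ∀ j, ‖T w j‖ ≤ Real.sqrt M * P * sobolevNorm σ f := by
      intro j
      refine (sq_le_sq₀ (norm_nonneg _) (by positivity)).1 ?_
      calc ‖T w j‖ ^ 2 ≤ ∑ j, ‖T w j‖ ^ 2 :=
            Finset.single_le_sum (f := fun j => ‖T w j‖ ^ 2) (fun j _ => sq_nonneg _)
              (Finset.mem_univ j)
        _ ≤ ∑ j : Fin M, ‖pointValue f (equispaced M x₀ ((j : ℕ) + 1))‖ ^ 2 :=
            sum_norm_sq_le_of_least_squares (hw w)
        _ ≤ ∑ j : Fin M, (P * sobolevNorm σ f) ^ 2 := Finset.sum_le_sum fun j _ =>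
            pow_le_pow_left₀ (norm_nonneg _) (norm_pointValue_le hσ hf _) 2
        _ = (Real.sqrt M * P * sobolevNorm σ f) ^ 2 := by
            rw [Finset.sum_const, Finset.card_univ, Fintype.card_fin, nsmul_eq_mul, mul_assoc,
              mul_pow (Real.sqrt M), Real.sq_sqrt (Nat.cast_nonneg M)]
    have h2 : ofFunction w = ∑ j, T w j • splineDist d Δ (L (Pi.single j 1)) := by
      have h3 : L (T w) = w := LinearMap.congr_fun hL w
      rw [← splineDist_apply]
      conv_lhs => rw [← h3, pi_eq_sum_univ' (T w)]
      rw [map_sum, map_sum]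
      refine Finset.sum_congr rfl fun j _ => ?_
      rw [map_smul, map_smul]
    have h4 : ∀ j, T w j • splineDist d Δ (L (Pi.single j 1)) ∈ sobolev r := fun j =>
      Submodule.smul_mem _ _ (ofFunction_mem_sobolev hΔ hr (L (Pi.single j 1)).2)
    rw [h2]
    refine (sobolevNorm_sum_le Finset.univ h4).trans ?_
    calc ∑ j, sobolevNorm r (T w j • splineDist d Δ (L (Pi.single j 1)))
        ≤ ∑ j, (Real.sqrt M * P * sobolevNorm σ f) *
          sobolevNorm r (splineDist d Δ (L (Pi.single j 1))) := by
          refine Finset.sum_le_sum fun j _ => ?_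
          rw [sobolevNorm_smul]
          exact mul_le_mul_of_nonneg_right (h1 j) (sobolevNorm_nonneg _ _)
      _ = _ := by
          rw [← Finset.mul_sum]
          ring
  -- Without injectivity no f has a unique solution, so any constant will do.
  · exact ⟨0, le_rfl, fun f _ hu =>
      absurd ((existsUnique_isCollocationSolution_iff hσ hS hM x₀ f).1 hu) hT⟩

/-- The smoothness index splits so that both parts exceed `1/2`, as far as the oversampling
exponent allows. -/
theorem exists_exponents {γ β : ℝ} (hγ : 1 < γ) (hβ : 2 + 1 / (2 * γ - 1) < β) :
    ∃ σ τ : ℝ, 1 / 2 < σ ∧ 1 / 2 < τ ∧ γ = σ + τ ∧ 2 * σ + τ ≤ β * σ := by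
  have h1 : 0 < 2 * γ - 1 := by linarith
  have h2 : 0 < 1 / (2 * γ - 1) := by positivity
  have h3 : 1 < (β - 2) * (2 * γ - 1) := by
    rw [← div_lt_iff₀ h1]
    linarith
  have hβ1 : 0 < β - 1 := by linarith
  -- With τ = 1/2 + ε and σ = γ - τ, the last requirement reads (β - 1) ε ≤ h, and h > 0 is exactly
  -- the assumption on β. The other bound on ε keeps σ at least γ/2 > 1/2.
  set h := (β - 2) * γ - (β - 1) / 2 with hh
  have hpos : 0 < h := by rw [hh]; nlinarith
  have hq : 0 < h / (β - 1) := by positivity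
  set ε := min ((γ - 1) / 2) (h / (β - 1))
  have hε : 0 < ε := lt_min (by linarith) hq
  have hε1 : ε ≤ (γ - 1) / 2 := min_le_left _ _
  have hε2 : (β - 1) * ε ≤ h := by
    rw [mul_comm, ← le_div_iff₀ hβ1]
    exact min_le_right _ _
  refine ⟨γ - (1 / 2 + ε), 1 / 2 + ε, by linarith, by linarith, by ring, ?_⟩
  rw [hh] at hε2
  linarith

theorem IsIsomorphismOfOrder.eq_zero {α : ℝ} (hV : IsIsomorphismOfOrder α V) {s : ℝ}
    {g : PeriodicDistribution} (hg : g ∈ sobolev s) (h : V g = 0) : g = 0 := by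
  obtain ⟨-, -, -, ⟨A, -, hA⟩⟩ := hV.mapping (p := s) (q := s - 2 * α) (by ring)
  have h1 := hA g hg
  rw [h, sobolevNorm_zero, mul_zero] at h1
  exact eq_zero_of_sobolevNorm_eq_zero hg (le_antisymm h1 (sobolevNorm_nonneg _ _))

theorem exists_collocation_bound (d : ℕ) (α : ℝ) (hd : 2 * α < d)
    (hV : IsIsomorphismOfOrder α V) (ρ β : ℝ) (hβ : 2 + 1 / (2 * d + 1 - 4 * α) < β) :
    ∃ (N₀ : ℕ) (C : ℝ), ∀ N : ℕ, N₀ ≤ N → ∀ Δ : Mesh N, Δ.IsQuasiUniform ρ →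
      ∀ M : ℕ, (N : ℝ) ^ β ≤ M → ∀ x₀ : ℝ, ∀ u ∈ sobolev (d + 1),
        (∃! v, IsCollocationSolution V (splineSpace d Δ) M (equispaced M x₀) (V u) v) ∧
        ∀ v, IsCollocationSolution V (splineSpace d Δ) M (equispaced M x₀) (V u) v →
          ofFunction v - u ∈ sobolev (-d - 1 + 4 * α) ∧
          sobolevNorm (-d - 1 + 4 * α) (ofFunction v - u) ≤
            C * (N : ℝ) ^ (4 * α - 2 * d - 2) * sobolevNorm (d + 1) u := by
  obtain ⟨γ, hγα⟩ : ∃ γ : ℝ, γ = d + 1 - 2 * α := ⟨_, rfl⟩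
  obtain ⟨σ, τ, hσ, hτ, hγ, hβσ⟩ := exists_exponents (γ := γ) (β := β) (by linarith)
    (by convert hβ using 3; rw [hγα]; ring)
  have hs : d + 1 - τ < d + 1 / 2 := by linarith
  obtain ⟨K, hK, hest⟩ := exists_image_estimates hV d ρ (by linarith : 0 ≤ σ) hτ hγ hγα
  obtain ⟨N₀, C, hC, hLS⟩ := exists_discrete_least_squares_bound (K := K) hσ (by linarith : 0 < τ)
    hγ hβσ hK
  obtain ⟨hmap, -, -, -⟩ := hV.mapping (p := d + 1 - τ) (q := σ) (by linarith)
  obtain ⟨hmap', ⟨A, hA, hVA⟩, -, -⟩ := hV.mapping (p := d + 1) (q := γ) (by linarith)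
  -- The inverse of V carries the H^{-γ} bound on the residual to the error itself: -γ + 2α = -d - 1
  -- + 4α.
  obtain ⟨-, -, -, ⟨B, hB, hVB⟩⟩ := hV.mapping (p := -d - 1 + 4 * α) (q := -γ) (by linarith)
  refine ⟨N₀, B * C * A, fun N hN Δ hΔ M hM x₀ u hu => ?_⟩
  have hN0 : (0 : ℝ) < N := by exact_mod_cast Δ.pos
  have hM0 : 0 < M := by
    have : (0 : ℝ) < M := lt_of_lt_of_le (by positivity) hM
    exact_mod_cast this
  have hdist : ∀ χ : splineSpace d Δ, splineDist d Δ χ ∈ sobolev (d + 1 - τ) := fun χ =>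
    ofFunction_mem_sobolev hΔ hs χ.2
  have hS : ∀ χ : splineSpace d Δ, V (splineDist d Δ χ) ∈ sobolev σ := fun χ => hmap _ (hdist χ)
  have hφ := hmap' u hu
  have hφσ : V u ∈ sobolev σ := sobolev_mono (by linarith) hφ
  obtain ⟨hinj, hbound⟩ := hLS N hN Δ.pos M hM x₀ (LinearMap.range (V ∘ₗ splineDist d Δ))
    (by rintro _ ⟨χ, rfl⟩; exact hS χ)
    (by rintro _ ⟨χ, rfl⟩; exact (hest N Δ hΔ).1 χ χ.2)
    (fun ψ hψ => by
      obtain ⟨p, hp, h⟩ := (hest N Δ hΔ).2 ψ hψ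
      exact ⟨_, ⟨⟨p, hp⟩, rfl⟩, h⟩)
  refine ⟨(existsUnique_isCollocationSolution_iff hσ hS hM0 x₀ (V u)).2 ?_, fun v hv => ?_⟩
  · rw [injective_iff_map_eq_zero]
    intro χ hχ
    have h1 : V (splineDist d Δ χ) = 0 := by
      refine hinj _ ⟨χ, rfl⟩ ?_
      rw [discreteInner, Finset.sum_eq_zero, mul_zero]
      intro j _
      have h2 := congrFun hχ j
      rw [collocationTrace_apply] at h2
      rw [splineDist_apply, h2]
      simp
    exact (injective_iff_map_eq_zero _).1 (splineDist_injective d Δ) χ (hV.eq_zero (hdist χ) h1)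
  · obtain ⟨w, rfl, hw⟩ := (isCollocationSolution_iff hσ hS hM0 x₀ (V u) v).1 hv
    have hem : ofFunction w - u ∈ sobolev (-d - 1 + 4 * α) := sobolev_mono (by linarith)
      (Submodule.sub_mem _ (hdist w) (sobolev_mono (by linarith) hu))
    refine ⟨hem, ?_⟩
    have h1 := hbound (V u) hφ (V (splineDist d Δ w)) ⟨w, rfl⟩ (by
      rintro _ ⟨χ, rfl⟩
      rw [discreteInner]
      refine mul_eq_zero_of_right _ (Eq.trans (Finset.sum_congr rfl fun j _ => ?_) (hw χ))
      rw [pointValue_sub hσ (hS w) hφσ]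
      rfl)
    have h2 := hVB _ hem
    have e : 4 * α - 2 * d - 2 = -(2 * γ) := by rw [hγα]; ring
    rw [map_sub] at h2
    calc _ ≤ B * (C * (N : ℝ) ^ (-(2 * γ)) * (A * sobolevNorm (d + 1) u)) :=
          h2.trans (mul_le_mul_of_nonneg_left (h1.trans (mul_le_mul_of_nonneg_left (hVA u hu)
            (by positivity))) hB)
      _ = _ := by rw [e]; ring

theorem exists_collocation_bound_of_sequence (d : ℕ) (α : ℝ) (hd : 2 * α < d)
    (hV : IsIsomorphismOfOrder α V) (ρ β : ℝ) (hβ : 2 + 1 / (2 * d + 1 - 4 * α) < β)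
    (Δ : ∀ N : ℕ+, Mesh N) (M : ℕ+ → ℕ) (x₀ : ℕ+ → ℝ) (hΔ : ∀ N, (Δ N).IsQuasiUniform ρ)
    (hM : ∀ N : ℕ+, (N : ℝ) ^ β ≤ M N) :
    ∃ C : ℝ, ∀ N : ℕ+, ∀ u ∈ sobolev (d + 1),
      (∃! v, IsCollocationSolution V (splineSpace d (Δ N)) (M N)
        (equispaced (M N) (x₀ N)) (V u) v) →
      ∀ v, IsCollocationSolution V (splineSpace d (Δ N)) (M N)
        (equispaced (M N) (x₀ N)) (V u) v →
        ofFunction v - u ∈ sobolev (-d - 1 + 4 * α) ∧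
        sobolevNorm (-d - 1 + 4 * α) (ofFunction v - u) ≤
          C * (N : ℝ) ^ (4 * α - 2 * d - 2) * sobolevNorm (d + 1) u := by
  obtain ⟨N₀, C, hbig⟩ := exists_collocation_bound d α hd hV ρ β hβ
  have hsmall : ∀ N : ℕ+, ∃ c : ℝ, 0 ≤ c ∧ ∀ u ∈ sobolev (d + 1),
      (∃! v, IsCollocationSolution V (splineSpace d (Δ N)) (M N)
        (equispaced (M N) (x₀ N)) (V u) v) →
      ∀ v, IsCollocationSolution V (splineSpace d (Δ N)) (M N)
        (equispaced (M N) (x₀ N)) (V u) v →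
        ofFunction v - u ∈ sobolev (-d - 1 + 4 * α) ∧
        sobolevNorm (-d - 1 + 4 * α) (ofFunction v - u) ≤
          c * (N : ℝ) ^ (4 * α - 2 * d - 2) * sobolevNorm (d + 1) u := by
    intro N
    have hN0 : (0 : ℝ) < (N : ℕ) := by exact_mod_cast N.pos
    have hM0 : 0 < M N := by
      have : (0 : ℝ) < M N := lt_of_lt_of_le (by positivity) (hM N)
      exact_mod_cast this
    -- Room for s is left precisely because 2α < d: the splines lie in H^s, and their images lie
    -- above the exponent 1/2 needed for point values.
    obtain ⟨s, hs1, hs2⟩ : ∃ s : ℝ, 2 * α + 1 / 2 < s ∧ s < d + 1 / 2 := exists_between (by linarith)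
    obtain ⟨hmap, ⟨A, hA, hVA⟩, -, -⟩ := hV.mapping (p := s) (q := s - 2 * α) (by ring)
    have hσ : 1 / 2 < s - 2 * α := by linarith
    have hdist : ∀ χ ∈ splineSpace d (Δ N), ofFunction χ ∈ sobolev s := fun χ hχ =>
      ofFunction_mem_sobolev (hΔ N) hs2 hχ
    have hS : ∀ χ : splineSpace d (Δ N), V (splineDist d (Δ N) χ) ∈ sobolev (s - 2 * α) :=
      fun χ => hmap _ (hdist χ χ.2)
    have hr : -d - 1 + 4 * α ≤ s := by linarith
    obtain ⟨c, hc, hbd⟩ := exists_bound_of_fixed_mesh hσ hS (hΔ N) (lt_of_le_of_lt hr hs2) hM0 (x₀ N)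
    -- For fixed N the rate is just a number and is divided out; `c * A` bounds the approximation
    -- and 1 bounds u.
    refine ⟨(c * A + 1) * ((N : ℝ) ^ (4 * α - 2 * d - 2))⁻¹, by positivity,
      fun u hu hex v hv => ?_⟩
    have hus : u ∈ sobolev s := sobolev_mono (by linarith) hu
    have hvm : ofFunction v ∈ sobolev (-d - 1 + 4 * α) := by
      obtain ⟨w, rfl, -⟩ := (isCollocationSolution_iff hσ hS hM0 (x₀ N) (V u) v).1 hv
      exact sobolev_mono hr (hdist w w.2)
    have hum : u ∈ sobolev (-d - 1 + 4 * α) := sobolev_mono hr hus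
    refine ⟨Submodule.sub_mem _ hvm hum, (sobolevNorm_sub_le hvm hum).trans ?_⟩
    have h1 := hbd (V u) (hmap u hus) hex v hv
    have h2 := hVA u hus
    have h3 := sobolevNorm_mono (by linarith : s ≤ d + 1) hu
    have h4 := sobolevNorm_mono (by linarith : -d - 1 + 4 * α ≤ (d : ℝ) + 1) hu
    have h5 : c * sobolevNorm (s - 2 * α) (V u) ≤ c * (A * sobolevNorm (d + 1) u) :=
      mul_le_mul_of_nonneg_left (h2.trans (mul_le_mul_of_nonneg_left h3 hA)) hc
    rw [mul_assoc (c * A + 1), inv_mul_cancel₀ (by positivity), mul_one]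
    linarith
  choose c hc0 hc using hsmall
  -- Only finitely many N lie below N₀, so their constants can be summed. The successor turns N₀,
  -- possibly 0, into a positive bound.
  refine ⟨|C| + ∑ n ∈ Finset.Iic N₀.succPNat, c n, fun N u hu hex v hv => ?_⟩
  have hN0 : (0 : ℝ) < (N : ℕ) := by exact_mod_cast N.pos
  have hsum : 0 ≤ ∑ n ∈ Finset.Iic N₀.succPNat, c n := Finset.sum_nonneg fun n _ => hc0 n
  have hmono : ∀ C', C' ≤ |C| + ∑ n ∈ Finset.Iic N₀.succPNat, c n →
      C' * (N : ℝ) ^ (4 * α - 2 * d - 2) * sobolevNorm (d + 1) u ≤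
        (|C| + ∑ n ∈ Finset.Iic N₀.succPNat, c n) * (N : ℝ) ^ (4 * α - 2 * d - 2) *
          sobolevNorm (d + 1) u := fun C' h =>
    mul_le_mul_of_nonneg_right (mul_le_mul_of_nonneg_right h (by positivity))
      (sobolevNorm_nonneg _ _)
  rcases le_total N₀ (N : ℕ) with h | h
  · obtain ⟨h1, h2⟩ := (hbig N h (Δ N) (hΔ N) (M N) (hM N) (x₀ N) u hu).2 v hv
    exact ⟨h1, h2.trans (hmono C (by linarith [le_abs_self C]))⟩
  · obtain ⟨h1, h2⟩ := hc N u hu hex v hv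
    refine ⟨h1, h2.trans (hmono _ ?_)⟩
    have h3 : N ∈ Finset.Iic N₀.succPNat := by
      rw [Finset.mem_Iic, ← PNat.coe_le_coe, Nat.succPNat_coe]
      omega
    have h4 := Finset.single_le_sum (f := c) (fun n _ => hc0 n) h3
    linarith [abs_nonneg C]

end OversampledCollocation

theorem mainTheorem9 (d : ℕ) (α : ℝ) (hd : 2 * α < d)
    (V : PeriodicDistribution →ₗ[ℂ] PeriodicDistribution) (hV : IsIsomorphismOfOrder α V)
    (ρ β : ℝ) (hβ : 2 + 1 / (2 * d + 1 - 4 * α) < β) :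
    (∃ (N₀ : ℕ) (C : ℝ), ∀ N : ℕ, N₀ ≤ N → ∀ Δ : Mesh N, Δ.IsQuasiUniform ρ →
      ∀ M : ℕ, (N : ℝ) ^ β ≤ M → ∀ x₀ : ℝ, ∀ u ∈ sobolev (d + 1),
        (∃! v, IsCollocationSolution V (splineSpace d Δ) M (equispaced M x₀) (V u) v) ∧
        ∀ v, IsCollocationSolution V (splineSpace d Δ) M (equispaced M x₀) (V u) v →
          ofFunction v - u ∈ sobolev (-d - 1 + 4 * α) ∧
          sobolevNorm (-d - 1 + 4 * α) (ofFunction v - u) ≤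
            C * (N : ℝ) ^ (4 * α - 2 * d - 2) * sobolevNorm (d + 1) u) ∧
    (∀ (Δ : ∀ N : ℕ+, Mesh N) (M : ℕ+ → ℕ) (x₀ : ℕ+ → ℝ),
      (∀ N, (Δ N).IsQuasiUniform ρ) → (∀ N : ℕ+, (N : ℝ) ^ β ≤ M N) →
      ∃ C : ℝ, ∀ N : ℕ+, ∀ u ∈ sobolev (d + 1),
        (∃! v, IsCollocationSolution V (splineSpace d (Δ N)) (M N)
          (equispaced (M N) (x₀ N)) (V u) v) →
        ∀ v, IsCollocationSolution V (splineSpace d (Δ N)) (M N)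
          (equispaced (M N) (x₀ N)) (V u) v →
          ofFunction v - u ∈ sobolev (-d - 1 + 4 * α) ∧
          sobolevNorm (-d - 1 + 4 * α) (ofFunction v - u) ≤
            C * (N : ℝ) ^ (4 * α - 2 * d - 2) * sobolevNorm (d + 1) u) :=
  ⟨exists_collocation_bound d α hd hV ρ β hβ,
    exists_collocation_bound_of_sequence d α hd hV ρ β hβ⟩
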